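/- Let $n\ge 2$ and $\beta>2$, write $x=(x',x_n)\in\mathbb R^{n-1}\times\mathbb R$, and let $S_\beta=\{x\in\mathbb R^n: x_n=|x'|^\beta\}$. Let $\psi\in C_0^\infty(\mathbb R^n)$ be identically $1$ in a neighborhood of the origin, let $\mu_\beta=\psi\,\sigma$, where $\sigma$ is the surface measure induced by Lebesgue measure on $S_\beta$, and for $\theta\in SO(n)$ let $\mu_{\beta,\theta}$ be the rotated measure, $\int g\,d\mu_{\beta,\theta}=\int g(\theta^{-1}y)\,d\mu_\beta(y)$. Put $$R_\beta f(x,\theta)=(f*\mu_{\beta,\theta})(x)=\int f(x-\theta^{-1}y)\,d\mu_\beta(y).$$ Let $SO(n)$ carry Haar measure and let $1/p+1/p'=1$. (i) If $\frac{n+1}{n}<p<\frac{2\beta+2(n-1)}{\beta+2(n-1)}$ and $q=\frac{p'(n-1)(\beta-1)}{(p'-2)\beta-2(n-1)}$, then $$\|R_\beta f\|_{L^{q}(SO(n);L^{p'}(\mathbb R^n))}\le C\|f\|_{L^p(\mathbb R^n)}\quad\text{for all } f\in L^p(\mathbb R^n).$$ (ii) If $\frac{2\beta+2(n-1)}{\beta+2(n-1)}<p\le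 2$, then $$\|R_\beta f\|_{L^{\infty}(SO(n);L^{p'}(\mathbb R^n))}\le C\|f\|_{L^p(\mathbb R^n)}\quad\text{for all } f\in L^p(\mathbb R^n).$$ Here $C$ is a finite constant that does not depend on $f$ (it may depend on $n,\beta,\psi,p$ and the normalization of the Haar measure). -/

import Mathlib

open MeasureTheory Filter Topology
open scoped ENNReal NNReal ContDiff

noncomputable section

namespace RotatedRadon

/-- Euclidean space `ℝⁿ`. -/
abbrev E (n : ℕ) := EuclideanSpace ℝ (Fin n)

/-- The rotation group `SO(n)`, with the topology inherited from the matrices. -/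
abbrev SO (n : ℕ) := Matrix.specialOrthogonalGroup (Fin n) ℝ

/-- `SO(n)` carries its Borel σ-algebra. -/
instance instMeasurableSpaceSO (n : ℕ) : MeasurableSpace (SO n) := borel (SO n)

instance instBorelSpaceSO (n : ℕ) : BorelSpace (SO n) := ⟨rfl⟩

/-- The action of a rotation on `ℝⁿ`, `θ ↦ (y ↦ θ y)`. -/
def rotate {n : ℕ} (θ : SO n) (y : E n) : E n :=
  Matrix.toEuclideanCLM (n := Fin n) (𝕜 := ℝ) (θ : Matrix (Fin n) (Fin n) ℝ) y

/-- The point `(x', t)` of `ℝⁿ`, for `x' ∈ ℝⁿ⁻¹` and last coordinate `t ∈ ℝ` (`n ≥ 1`). -/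
def pointOf {n : ℕ} (x' : E (n - 1)) (t : ℝ) : E n :=
  WithLp.toLp 2 fun i : Fin n => if h : (i : ℕ) < n - 1 then x' ⟨i, h⟩ else t

/-- The surface measure induced by Lebesgue measure on the graph `xₙ = φ(x')`: the image under
`x' ↦ (x', φ(x'))` of the measure `√(1 + |∇φ(x')|²) dx'`. -/
def graphMeasure (n : ℕ) (φ : E (n - 1) → ℝ) : Measure (E n) :=
  Measure.map (fun x' => pointOf x' (φ x'))
    ((volume : Measure (E (n - 1))).withDensity
      fun x' => ENNReal.ofReal (Real.sqrt (1 + ‖gradient φ x'‖ ^ 2)))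

/-- The induced measure on the hypersurface `S_β = {(x', xₙ) : xₙ = |x'|^β}` in `ℝⁿ`. -/
def surfaceMeasure (n : ℕ) (β : ℝ) : Measure (E n) :=
  graphMeasure n fun x' => ‖x'‖ ^ β

/-- `R_β f(x, θ) = (f * μ_{β,θ})(x)`, where `dμ_β = ψ dσ` with `σ` the induced measure on `S_β`, and
where the rotated measure is given by `⟨g, μ_{β,θ}⟩ = ⟨g(θ⁻¹ ·), μ_β⟩`. -/
def radonTransform (n : ℕ) (β : ℝ) (ψ : E n → ℂ) (f : E n → ℂ) (x : E n) (θ : SO n) : ℂ :=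
  ∫ y, ψ y * f (x - rotate θ⁻¹ y) ∂(surfaceMeasure n β)

/-- The mixed norm of `L^q(SO(n); L^r(ℝⁿ))`. -/
def mixedNorm {n : ℕ} (ν : Measure (SO n)) (F : E n → SO n → ℂ) (q r : ℝ≥0∞) : ℝ≥0∞ :=
  eLpNorm (fun θ => eLpNorm (fun x => F x θ) r volume) q ν

/-- `R_β` is bounded from `L^p(ℝⁿ)` to `L^q(SO(n); L^r(ℝⁿ))`: for `f ∈ L^p` the integral which
defines `R_β f(x, θ)` converges absolutely for every `θ` and almost every `x`, the function `R_β f`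
is measurable, and `‖R_β f‖ ≤ C ‖f‖` with `C` independent of `f`. -/
def RadonBounded (n : ℕ) (β : ℝ) (ψ : E n → ℂ) (ν : Measure (SO n)) (p q r : ℝ≥0∞) : Prop :=
  ∃ C : ℝ≥0, ∀ f : E n → ℂ, MemLp f p volume →
    (∀ θ : SO n, ∀ᵐ x : E n,
      Integrable (fun y => ψ y * f (x - rotate θ⁻¹ y)) (surfaceMeasure n β)) ∧
    AEStronglyMeasurable (fun z : SO n × E n => radonTransform n β ψ f z.2 z.1)
      (ν.prod volume) ∧
    mixedNorm ν (radonTransform n β ψ f) q r ≤ C * eLpNorm f p volume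

end RotatedRadon

end

/-! Write n = d + 1 and p' = 2 + 2κ. The transform is dominated by a positive operator: ψ may be
replaced by a constant times a sum over dyadic scales of dilates of one nonnegative density χ
supported off the origin (`exists_absTransform_le_iSup`). By monotone convergence only bounds
uniform in the number K of scales are needed. On a small ball away from the origin |x'|^β is
strongly convex, so the Fourier transform of the corresponding piece of surface decays like (1 +
|t|)^(-d/2), and rapidly where |ξ'| is much larger than 1 + |t| (`oscDecay_of_convex`); χ is a
finite sum of such pieces. Homogeneity carries the estimate to all scales. Let m(ξ', t) be the
Fourier transform of the dyadic sum.

The passage from m to L^p is Stein interpolation (`norm_pairing_zero_le`) for the multipliers m(θξ)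
(1 + 2πi(θξ)ₙ)^(-z). On Re z = 1 the extra factor smears the surface along the last axis with a
Gamma density of parameter z; the kernel is then a bounded function and maps L¹ to L^∞. On Re z = -κ
Plancherel requires only that |m(θξ)|² |1 + 2πi(θξ)ₙ|^(2κ) has a bounded integral over θ, uniformly
in ξ, for a chosen finite measure W on SO(n). At z = 0 this gives L^p(dx) → L^{p'}(W × dx), with the
p'-th power of the norm linear in the multiplier bound (`lintegral_graphAverage_rpow_le`).

The choice of W separates the two parts. For (ii), W is a Dirac mass and m must be O((1 +
|t|)^(-κ)); the sum over scales converges when κβ < d. For (i), the outer norm is dualized: q =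
p's/2, and W = wν with w in the dual of L^{s/2}(ν). By Hölder it suffices to bound (1 + |t|)^κ |m|
in L^s(SO(n)) uniformly in ξ (`exists_eLpNorm_oscInt_dyadicSum_le`). Averaging over rotations gains
because each piece is large only when θξ is close to a normal direction. For κ = (d/β)(1 + (β -
1)/s) the powers of the scale ρ cancel exactly, and a piece is controlled by u = ρ^β |ξ| alone: by
u^(-δ) for u ≥ 1 and by u^ε for u < 1, with δ = d/2 - κ and ε = κ - d/s. Both exponents are
positive, so the scales sum without loss and the stated q is attained. -/

noncomputable section

namespace RotatedRadon

/-! ### Plancherel's identity for integrable square-integrable functions -/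

section Plancherel
open FourierTransform ComplexConjugate
open scoped SchwartzMap RealInnerProductSpace

variable {X : Type*} [NormedAddCommGroup X] [InnerProductSpace ℝ X] [FiniteDimensional ℝ X]
  [MeasurableSpace X] [BorelSpace X]

theorem continuous_fourier {f : X → ℂ} (hf : Integrable f) : Continuous (𝓕 f) :=
  VectorFourier.fourierIntegral_continuous Real.continuous_fourierChar
    (by exact continuous_inner) hf

/-- Both sides are the same tempered distribution: moving the transform onto a test function is the
definition on the left and Fubini on the right. This makes the L² isometry available for the
integral formula. -/
theorem fourier_toLp_ae_eq {f : X → ℂ} (hf : Integrable f) (hf2 : MemLp f 2) :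
    ((𝓕 (hf2.toLp f) : Lp ℂ 2 (volume : Measure X)) : X → ℂ) =ᵐ[volume] 𝓕 f := by
  apply ae_eq_of_integral_contDiff_smul_eq
  · exact (Lp.memLp _).locallyIntegrable (by norm_num)
  · exact (continuous_fourier hf).locallyIntegrable
  intro g hg hgc
  have hgc' : HasCompactSupport (fun x => (g x : ℂ)) := hgc.comp_left (g := fun t : ℝ => (t : ℂ)) (by simp)
  have hg' : ContDiff ℝ ∞ (fun x => (g x : ℂ)) := Complex.ofRealCLM.contDiff.comp hg
  let G : 𝓢(X, ℂ) := hgc'.toSchwartzMap hg'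
  have hG : ∀ x, G x = (g x : ℂ) := fun x => rfl
  have h1 := congrArg (fun T => T G) (Lp.fourier_toTemperedDistribution_eq (hf2.toLp f))
  simp only [TemperedDistribution.fourier_apply, Lp.toTemperedDistribution_apply] at h1
  have h2 : ∫ x, (𝓕 G) x • (hf2.toLp f) x = ∫ x, (𝓕 (G : X → ℂ)) x • f x := by
    refine integral_congr_ae ?_
    filter_upwards [hf2.coeFn_toLp] with x hx
    rw [hx]; rfl
  rw [h2] at h1
  have h3 : ∫ x, (𝓕 (G : X → ℂ)) x • f x = ∫ x, (G x) • 𝓕 f x := by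
    have := VectorFourier.integral_fourierIntegral_smul_eq_flip (𝕜 := ℝ) (L := innerₗ X)
      (μ := volume) (ν := volume) Real.continuous_fourierChar (by exact continuous_inner) G.integrable hf
    simpa using! this
  rw [h3] at h1
  calc ∫ x, g x • ((𝓕 (hf2.toLp f) : Lp ℂ 2 (volume : Measure X)) : X → ℂ) x
      = ∫ x, G x • ((𝓕 (hf2.toLp f) : Lp ℂ 2 (volume : Measure X)) : X → ℂ) x := by
        simp [hG]
    _ = ∫ x, (G x) • 𝓕 f x := h1.symm
    _ = _ := by simp [hG]

theorem memLp_fourier {f : X → ℂ} (hf : Integrable f) (hf2 : MemLp f 2) : MemLp (𝓕 f) 2 :=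
  (memLp_congr_ae (fourier_toLp_ae_eq hf hf2)).1 (Lp.memLp _)

theorem lintegral_enorm_sq_eq {Y : Type*} [MeasurableSpace Y] {ρ : Measure Y} (f : Y → ℂ) :
    eLpNorm f 2 ρ ^ 2 = ∫⁻ x, ‖f x‖ₑ ^ 2 ∂ρ := by
  rw [eLpNorm_eq_lintegral_rpow_enorm_toReal (by norm_num) (by norm_num), ← ENNReal.rpow_natCast,
    ← ENNReal.rpow_mul]
  simp

theorem eLpNorm_fourier {f : X → ℂ} (hf : Integrable f) (hf2 : MemLp f 2) :
    eLpNorm (𝓕 f) 2 volume = eLpNorm f 2 volume := by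
  rw [← eLpNorm_congr_ae (fourier_toLp_ae_eq hf hf2), ← eLpNorm_congr_ae hf2.coeFn_toLp,
    ← ENNReal.ofReal_toReal (Lp.eLpNorm_ne_top _), ← Lp.norm_def, Lp.norm_fourier_eq, Lp.norm_def,
    ENNReal.ofReal_toReal (Lp.eLpNorm_ne_top _)]

theorem fourier_conj (g : X → ℂ) (ξ : X) : 𝓕 (fun x => conj (g x)) ξ = conj (𝓕⁻ g ξ) := by
  rw [Real.fourier_eq, Real.fourierInv_eq, ← integral_conj]
  refine integral_congr_ae (.of_forall fun x => ?_)
  simp only [Circle.smul_def, smul_eq_mul, map_mul, ← Circle.coe_inv_eq_conj]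
  congr 2
  rw [← AddChar.map_neg_eq_inv]

theorem integrable_conj_iff' {g : X → ℂ} (hg : Integrable g) : Integrable (fun x => conj (g x)) :=
  (Complex.conjLIE.toContinuousLinearEquiv.toContinuousLinearMap.integrable_comp hg)

theorem memLp_conj {g : X → ℂ} {p : ℝ≥0∞} (hg : MemLp g p) : MemLp (fun x => conj (g x)) p :=
  hg.norm.of_le_mul (c := 1) (Complex.continuous_conj.comp_aestronglyMeasurable hg.1) (by simp)
theorem eLpNorm_fourierInv {g : X → ℂ} (hg : Integrable g) (hg2 : MemLp g 2) :
    eLpNorm (𝓕⁻ g) 2 volume = eLpNorm g 2 volume := by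
  have h := eLpNorm_fourier (integrable_conj_iff' hg) (memLp_conj hg2)
  rw [funext (fourier_conj g)] at h
  have h1 : eLpNorm (fun ξ => conj (𝓕⁻ g ξ)) 2 volume = eLpNorm (𝓕⁻ g) 2 volume :=
    eLpNorm_congr_norm_ae (by simp)
  have h2 : eLpNorm (fun ξ => conj (g ξ)) 2 volume = eLpNorm g 2 volume :=
    eLpNorm_congr_norm_ae (by simp)
  rwa [h1, h2] at h

theorem memLp_fourierInv {g : X → ℂ} (hg : Integrable g) (hg2 : MemLp g 2) : MemLp (𝓕⁻ g) 2 := by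
  have h := memLp_conj (memLp_fourier (integrable_conj_iff' hg) (memLp_conj hg2))
  simpa [funext (fourier_conj g)] using h

/-- Plancherel's identity in bilinear form. -/
theorem integral_mul_eq_integral_fourier_mul {f g : X → ℂ} (hf : Integrable f) (hf2 : MemLp f 2)
    (hg : Integrable g) (hg2 : MemLp g 2) :
    ∫ x, f x * g x = ∫ ξ, 𝓕 f ξ * 𝓕⁻ g ξ := by
  have hc := integrable_conj_iff' hg
  have hc2 := memLp_conj hg2
  have h := Lp.inner_fourier_eq (hc2.toLp _) (hf2.toLp f)
  rw [L2.inner_def, L2.inner_def] at h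
  refine Eq.trans (integral_congr_ae ?_) (h.symm.trans (integral_congr_ae ?_))
  · filter_upwards [hf2.coeFn_toLp, hc2.coeFn_toLp] with x h1 h2
    simp [h1, h2]
  · filter_upwards [fourier_toLp_ae_eq hf hf2, fourier_toLp_ae_eq hc hc2] with x h1 h2
    simp only [h1, h2, RCLike.inner_apply, fourier_conj]
    simp

theorem fourier_comp_sub (f : X → ℂ) (a ξ : X) :
    𝓕 (fun x => f (x - a)) ξ = Real.fourierChar (-⟪a, ξ⟫) * 𝓕 f ξ := by
  rw [Real.fourier_eq, Real.fourier_eq, ← integral_const_mul]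
  rw [← integral_sub_right_eq_self (fun x => (Real.fourierChar (-⟪a, ξ⟫) : ℂ) *
    Real.fourierChar (-⟪x, ξ⟫) • f x) a]
  refine integral_congr_ae (.of_forall fun x => ?_)
  simp only [Circle.smul_def, smul_eq_mul, ← mul_assoc, ← Circle.coe_mul,
    ← AddChar.map_add_eq_mul]
  congr 4
  rw [inner_sub_left]
  ring

end Plancherel

/-! ### Averages of translates as Fourier multipliers -/

section Pairing
open FourierTransform ComplexConjugate
open scoped RealInnerProductSpace

variable {X : Type*} [NormedAddCommGroup X] [InnerProductSpace ℝ X] [FiniteDimensional ℝ X]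
  [MeasurableSpace X] [BorelSpace X]
  {Y : Type*} [MeasurableSpace Y] {ρ : Measure Y} [SFinite ρ]

/-- The inequality |fg| ≤ |f|² + |g|² and translation invariance give a majorant, so Fubini applies
with h in L¹ and f, g in L². -/
theorem integrable_translate_mul {γ : Y → X} (hγ : Measurable γ) {h : Y → ℂ} (hh : Integrable h ρ)
    {f g : X → ℂ} (hfm : Measurable f) (hf2 : MemLp f 2) (hgm : Measurable g) (hg2 : MemLp g 2) :
    Integrable (fun q : X × Y => h q.2 * f (q.1 - γ q.2) * g q.1) (volume.prod ρ) := by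
  have hm : AEStronglyMeasurable (fun q : X × Y => h q.2 * f (q.1 - γ q.2) * g q.1)
      (volume.prod ρ) := by
    refine AEStronglyMeasurable.mul (AEStronglyMeasurable.mul hh.1.comp_snd ?_) ?_
    · exact (hfm.comp (measurable_fst.sub (hγ.comp measurable_snd))).aestronglyMeasurable
    · exact (hgm.comp measurable_fst).aestronglyMeasurable
  have hfi : Integrable (fun x => ‖f x‖ ^ 2) := hf2.integrable_norm_pow (by norm_num)
  have hgi : Integrable (fun x => ‖g x‖ ^ 2) := hg2.integrable_norm_pow (by norm_num)
  have hfs : ∀ y, Integrable (fun x => ‖f (x - γ y)‖ ^ 2) := fun y => hfi.comp_sub_right (γ y)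
  have hle : ∀ y x, ‖h y * f (x - γ y) * g x‖ ≤ ‖h y‖ * (‖f (x - γ y)‖ ^ 2 + ‖g x‖ ^ 2) := by
    intro y x
    rw [norm_mul, norm_mul, mul_assoc]
    gcongr
    nlinarith [sq_nonneg (‖f (x - γ y)‖ - ‖g x‖), sq_nonneg ‖f (x - γ y)‖, sq_nonneg ‖g x‖]
  have hi : ∀ y, Integrable (fun x => h y * f (x - γ y) * g x) := by
    intro y
    refine (((hfs y).add hgi).const_mul ‖h y‖).mono' ?_ (.of_forall fun x => hle y x)
    exact (((hfm.comp (measurable_id.sub_const _)).const_mul _).mul hgm).aestronglyMeasurable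
  rw [integrable_prod_iff' hm]
  refine ⟨.of_forall hi, ?_⟩
  refine (hh.norm.mul_const ((∫ x, ‖f x‖ ^ 2) + ∫ x, ‖g x‖ ^ 2)).mono' ?_ (.of_forall fun y => ?_)
  · exact hm.norm.prod_swap.integral_prod_right'
  · rw [Real.norm_of_nonneg (integral_nonneg fun _ => norm_nonneg _)]
    refine (integral_mono (hi y).norm (((hfs y).add hgi).const_mul ‖h y‖) (hle y)).trans ?_
    rw [integral_const_mul]
    refine le_of_eq ?_
    congr 1
    rw [integral_add' (hfs y) hgi, integral_sub_right_eq_self (fun x => ‖f x‖ ^ 2)]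

/-- Fubini, Plancherel for each fixed y, and Fubini again. The parameter space Y stays abstract
because it is used both as ℝᵈ, for the surface, and as ℝᵈ × ℝ, for the smeared surface. -/
theorem integral_translate_mul_eq {γ : Y → X} (hγ : Measurable γ) {h : Y → ℂ}
    (hh : Integrable h ρ) {f g : X → ℂ} (hfm : Measurable f) (hf : Integrable f) (hf2 : MemLp f 2)
    (hgm : Measurable g) (hg : Integrable g) (hg2 : MemLp g 2) :
    ∫ x, (∫ y, h y * f (x - γ y) ∂ρ) * g x =
      ∫ ξ, 𝓕 f ξ * (∫ y, Real.fourierChar (-⟪γ y, ξ⟫) * h y ∂ρ) * 𝓕⁻ g ξ := by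
  have hP : Integrable (fun ξ => 𝓕 f ξ * 𝓕⁻ g ξ) :=
    (memLp_fourier hf hf2).integrable_mul (memLp_fourierInv hg hg2)
  have h1 := integrable_translate_mul hγ hh hfm hf2 hgm hg2
  have h2 : Integrable (fun q : X × Y => (𝓕 f q.1 * 𝓕⁻ g q.1) *
      ((Real.fourierChar (-⟪γ q.2, q.1⟫) : ℂ) * h q.2)) (volume.prod ρ) := by
    refine (hP.mul_prod hh).norm.mono' ?_ (.of_forall fun q => ?_)
    · refine hP.1.comp_fst.mul (AEStronglyMeasurable.mul ?_ hh.1.comp_snd)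
      have : Measurable fun q : X × Y => -⟪γ q.2, q.1⟫ :=
        ((hγ.comp measurable_snd).inner measurable_fst).neg
      exact ((Real.continuous_fourierChar.subtype_val.measurable).comp this).aestronglyMeasurable
    · rw [norm_mul, norm_mul (_ : ℂ) (h q.2), Circle.norm_coe, one_mul, norm_mul (𝓕 f q.1 * 𝓕⁻ g q.1)]
  calc (∫ x, (∫ y, h y * f (x - γ y) ∂ρ) * g x)
      = ∫ x, ∫ y, h y * f (x - γ y) * g x ∂ρ := by simp_rw [integral_mul_const]
    _ = ∫ y, (∫ x, h y * f (x - γ y) * g x) ∂ρ := integral_integral_swap h1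
    _ = ∫ y, (∫ ξ, (𝓕 f ξ * 𝓕⁻ g ξ) * ((Real.fourierChar (-⟪γ y, ξ⟫) : ℂ) * h y)) ∂ρ := by
        refine integral_congr_ae (.of_forall fun y => ?_)
        have h3 := integral_mul_eq_integral_fourier_mul (f := fun x => f (x - γ y)) (g := g)
          (hf.comp_sub_right (γ y))
          (hf2.comp_measurePreserving (measurePreserving_sub_right volume (γ y))) hg hg2
        simp only [fourier_comp_sub] at h3
        simp_rw [mul_assoc]
        rw [integral_const_mul, h3, ← integral_const_mul]
        refine integral_congr_ae (.of_forall fun ξ => ?_)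
        simp only
        ring
    _ = ∫ ξ, ∫ y, (𝓕 f ξ * 𝓕⁻ g ξ) * ((Real.fourierChar (-⟪γ y, ξ⟫) : ℂ) * h y) ∂ρ :=
        (integral_integral_swap h2).symm
    _ = _ := by
        refine integral_congr_ae (.of_forall fun ξ => ?_)
        simp only
        rw [integral_const_mul]
        ring

end Pairing

/-! ### The complex Gamma density and its Fourier transform -/

section GammaKernel
open Complex Set

theorem integrableOn_cpow_mul_exp {a r : ℂ} (ha : 0 < a.re) (hr : 0 < r.re) :
    IntegrableOn (fun t : ℝ => (t : ℂ) ^ (a - 1) * exp (-(r * t))) (Ioi 0) := by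
  have h := (Real.GammaIntegral_convergent ha)
  have h2 : IntegrableOn (fun t : ℝ => Real.exp (-(r.re * t)) * t ^ (a.re - 1)) (Ioi 0) := by
    have := integrableOn_rpow_mul_exp_neg_mul_rpow (s := a.re - 1) (p := 1) (b := r.re)
      (by linarith) one_pos hr
    refine this.congr_fun (fun t ht => ?_) measurableSet_Ioi
    simp [mul_comm]
  refine h2.mono' ?_ ?_
  · refine ContinuousOn.aestronglyMeasurable ?_ measurableSet_Ioi
    intro t ht
    refine ContinuousAt.continuousWithinAt ?_
    refine ContinuousAt.mul ?_ (by fun_prop)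
    exact (continuousAt_cpow_const (Or.inl (by simpa using ht))).comp continuous_ofReal.continuousAt
  · filter_upwards [ae_restrict_mem measurableSet_Ioi] with t ht
    rw [norm_mul, norm_cpow_eq_rpow_re_of_pos ht, norm_exp]
    simp [mul_comm]

/-- For real r > 0 this is the classical Gamma integral. Both sides are holomorphic in the half
plane Re r > 0, so the identity theorem extends it. -/
theorem integral_cpow_mul_exp_neg {a r : ℂ} (ha : 0 < a.re) (hr : 0 < r.re) :
    ∫ t : ℝ in Ioi 0, (t : ℂ) ^ (a - 1) * exp (-(r * t)) = r ^ (-a) * Gamma a := by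
  let U : Set ℂ := {r | 0 < r.re}
  have hU : IsOpen U := isOpen_lt continuous_const continuous_re
  have hUc : IsPreconnected U := (convex_halfSpace_re_gt 0).isPreconnected
  have h1 : DifferentiableOn ℂ
      (fun r : ℂ => ∫ t : ℝ in Ioi 0, (t : ℂ) ^ (a - 1) * exp (-(r * t))) U := by
    intro r hr
    have hr : 0 < r.re := hr
    have hd := hasDerivAt_integral_of_dominated_loc_of_deriv_le
      (μ := volume.restrict (Ioi (0 : ℝ))) (𝕜 := ℂ) (x₀ := r) (s := {s : ℂ | r.re / 2 < s.re})
      (F := fun r (t : ℝ) => (t : ℂ) ^ (a - 1) * exp (-(r * t)))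
      (F' := fun r (t : ℝ) => (t : ℂ) ^ (a - 1) * (exp (-(r * t)) * (-t)))
      -- Differentiating in r brings down a factor t, which raises the exponent a to a + 1; the
      -- exponential is dominated by its value at Re r / 2.
      (bound := fun t => ‖(t : ℂ) ^ (a + 1 - 1) * exp (-(((r.re / 2 : ℝ) : ℂ) * t))‖)
      ((isOpen_lt continuous_const continuous_re).mem_nhds (by simpa using by linarith))
      ?_ (integrableOn_cpow_mul_exp ha hr) ?_ ?_ ?_ ?_
    · exact hd.2.differentiableAt.differentiableWithinAt
    · filter_upwards [hU.mem_nhds hr] with s hs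
      exact (integrableOn_cpow_mul_exp ha hs).1
    · have := (integrableOn_cpow_mul_exp ha hr).1
      have h2 : AEStronglyMeasurable (fun t : ℝ => -(t : ℂ)) (volume.restrict (Ioi (0 : ℝ))) :=
        (by fun_prop : Continuous fun t : ℝ => -(t : ℂ)).aestronglyMeasurable
      refine (this.mul h2).congr (.of_forall fun t => ?_)
      simp [mul_assoc]
    · filter_upwards [ae_restrict_mem measurableSet_Ioi] with t ht s hs
      have ht' : (0 : ℝ) < t := ht
      have hs : r.re / 2 < s.re := hs
      have ht0 : (t : ℂ) ≠ 0 := by exact_mod_cast ht'.ne'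
      have : (t : ℂ) ^ (a + 1 - 1) = t ^ (a - 1) * t := by
        rw [show a + 1 - 1 = (a - 1) + 1 by ring, cpow_add _ _ ht0, cpow_one]
      rw [this]
      rw [norm_mul, norm_mul, norm_mul, norm_mul, norm_neg, norm_exp, norm_exp,
        mul_assoc, mul_comm (Real.exp _) ‖(t : ℂ)‖]
      refine mul_le_mul_of_nonneg_left (mul_le_mul_of_nonneg_left (Real.exp_le_exp.2 ?_)
        (norm_nonneg _)) (norm_nonneg _)
      rw [neg_re, neg_re, mul_re, mul_re]
      simp only [ofReal_re, ofReal_im]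
      nlinarith
    · exact (integrableOn_cpow_mul_exp (a := a + 1) (by simpa using by linarith)
        (by simpa using by linarith)).norm
    · refine .of_forall fun t s _ => ?_
      have : HasDerivAt (fun s : ℂ => -(s * t)) (-t) s := by
        exact (by simpa using (hasDerivAt_id s).mul_const (t : ℂ) : HasDerivAt (fun s : ℂ => s * t) t s).neg
      exact (this.cexp).const_mul _
  have h2 : DifferentiableOn ℂ (fun r : ℂ => r ^ (-a) * Gamma a) U := by
    intro r hr
    exact ((differentiableAt_id.cpow (differentiableAt_const _)
      (Or.inl hr)).mul_const _).differentiableWithinAt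
  have h3 := (h1.analyticOnNhd hU).eqOn_of_preconnected_of_frequently_eq (h2.analyticOnNhd hU) hUc
    (z₀ := 1) (by simp [U]) ?_
  · exact h3 hr
  -- The real points 1 + 1/(k + 1) accumulate at 1 without meeting it.
  · have hev : ∀ᶠ k : ℕ in atTop, (1 : ℂ) + ((1 / ((k : ℝ) + 1) : ℝ) : ℂ) ∈
      {z : ℂ | (∫ t : ℝ in Ioi 0, (t : ℂ) ^ (a - 1) * exp (-(z * t))) = z ^ (-a) * Gamma a} := by
      refine .of_forall fun k => ?_
      have hk : (0 : ℝ) < 1 + 1 / ((k : ℝ) + 1) := by positivity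
      have := Complex.integral_cpow_mul_exp_neg_mul_Ioi ha hk
      rw [mem_ofPred_eq, show (1 : ℂ) + ((1 / ((k : ℝ) + 1) : ℝ) : ℂ) = ((1 + 1 / ((k : ℝ) + 1) : ℝ) : ℂ) by
        push_cast; ring, this, one_div, inv_cpow, cpow_neg]
      rw [arg_ofReal_of_nonneg hk.le]
      exact Real.pi_pos.ne
    have ht : Tendsto (fun k : ℕ => (1 : ℂ) + ((1 / ((k : ℝ) + 1) : ℝ) : ℂ)) atTop (𝓝[≠] 1) := by
      refine tendsto_nhdsWithin_iff.2 ⟨?_, .of_forall fun k => ?_⟩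
      · have := (continuous_ofReal.tendsto 0).comp (tendsto_one_div_add_atTop_nhds_zero_nat (𝕜 := ℝ))
        simpa using (tendsto_const_nhds (x := (1 : ℂ))).add this
      · have : ((k : ℝ) + 1) ≠ 0 := by positivity
        simp only [mem_compl_iff, mem_singleton_iff, add_eq_left, ofReal_eq_zero]
        positivity
    exact ht.frequently hev.frequently

/-- The density `t ^ (z - 1) e ^ (-t) / Γ(z)` of the Gamma distribution, with a complex parameter. -/
def gammaKernel (z : ℂ) (t : ℝ) : ℂ :=
  (Ioi (0 : ℝ)).indicator (fun t : ℝ => (t : ℂ) ^ (z - 1) * exp (-(1 * t)) / Gamma z) t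

theorem integrable_gammaKernel {z : ℂ} (hz : 0 < z.re) : Integrable (gammaKernel z) := by
  rw [show gammaKernel z = (Ioi (0 : ℝ)).indicator _ from rfl, integrable_indicator_iff measurableSet_Ioi]
  exact (integrableOn_cpow_mul_exp hz (by simp)).div_const _

/-- The Gamma integral with r = 1 + 2πis. It identifies the multiplier (1 + 2πis)^(-z) with
convolution by the Gamma density when Re z > 0. -/
theorem integral_fourierChar_mul_gammaKernel {z : ℂ} (hz : 0 < z.re) (s : ℝ) :
    ∫ t : ℝ, (Real.fourierChar (-(t * s)) : ℂ) * gammaKernel z t =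
      (1 + 2 * Real.pi * s * I) ^ (-z) := by
  have hG : Gamma z ≠ 0 := Gamma_ne_zero_of_re_pos hz
  have h := integral_cpow_mul_exp_neg (a := z) (r := 1 + 2 * Real.pi * s * I) hz (by simp)
  rw [← div_eq_iff hG] at h
  rw [← h, ← integral_div, ← integral_indicator measurableSet_Ioi]
  refine integral_congr_ae (.of_forall fun t => ?_)
  by_cases ht : t ∈ Ioi (0 : ℝ)
  · simp only [gammaKernel, indicator_of_mem ht, Real.fourierChar_apply]
    rw [mul_div_assoc', mul_left_comm, ← exp_add]
    congr 3
    push_cast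
    ring
  · simp [gammaKernel, indicator_of_notMem ht]

/-- For τ ≠ 0 the reflection formula gives |Γ(1 + iτ)|² = πτ / sinh(πτ), and e^(-x) sinh x = (1 -
e^(-2x))/2 ≤ x. -/
theorem norm_Gamma_one_add_mul_I (τ : ℝ) : Real.exp (-(Real.pi * |τ|)) ≤ ‖Gamma (1 + τ * I)‖ ^ 2 := by
  rcases eq_or_ne τ 0 with rfl | hτ
  · simp
  have h1 : ‖Gamma (1 + τ * I)‖ ^ 2 = ‖Gamma (1 + τ * I) * Gamma (1 - τ * I)‖ := by
    have : Gamma (1 - τ * I) = starRingEnd ℂ (Gamma (1 + τ * I)) := by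
      rw [← Gamma_conj]; simp [sub_eq_add_neg]
    rw [this, norm_mul, RCLike.norm_conj, sq]
  have h2 : Gamma (1 + τ * I) * Gamma (1 - τ * I) = τ * I * (Real.pi / sin (Real.pi * (τ * I))) := by
    rw [← Gamma_mul_Gamma_one_sub, add_comm (1 : ℂ), Gamma_add_one _ (by simp [hτ])]
    ring
  have hs : ‖sin (Real.pi * (τ * I))‖ = Real.sinh (Real.pi * |τ|) := by
    rw [← mul_assoc, ← ofReal_mul, sin_mul_I, ← ofReal_sinh]
    simp only [norm_mul, norm_I, mul_one, norm_real, Real.norm_eq_abs, Real.abs_sinh, abs_mul,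
      abs_of_pos Real.pi_pos]
  have hp : 0 < Real.pi * |τ| := by positivity
  rw [h1, h2]
  simp only [norm_mul, norm_div, hs, norm_I, norm_real, Real.norm_eq_abs, abs_of_pos Real.pi_pos]
  have hsp : 0 < Real.sinh (Real.pi * |τ|) := Real.sinh_pos_iff.2 hp
  rw [mul_one, mul_div_assoc', le_div_iff₀ hsp, mul_comm |τ|]
  set x := Real.pi * |τ|
  have h3 : Real.exp (-x) * Real.sinh x = (1 - Real.exp (-(2 * x))) / 2 := by
    rw [Real.sinh_eq, mul_div_assoc', mul_sub, ← Real.exp_add, ← Real.exp_add]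
    ring_nf
    simp
  rw [h3]
  have := Real.add_one_le_exp (-(2 * x))
  linarith

/-- On Re z = 1 the power of t has modulus one, so only 1/|Γ| matters. The exponential growth in τ
is later absorbed by the factor exp(z²). -/
theorem norm_gammaKernel_le (τ t : ℝ) :
    ‖gammaKernel (1 + τ * I) t‖ ≤ Real.exp (Real.pi * |τ|) := by
  by_cases ht : t ∈ Ioi (0 : ℝ)
  · have ht' : 0 < t := ht
    simp only [gammaKernel, indicator_of_mem ht, norm_div, norm_mul]
    rw [norm_cpow_eq_rpow_re_of_pos ht']
    have h1 := norm_Gamma_one_add_mul_I τ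
    have hG : 0 < ‖Gamma (1 + τ * I)‖ := norm_pos_iff.2 (Gamma_ne_zero_of_re_pos (by simp))
    have h2 : Real.exp (-(Real.pi * |τ|)) ≤ ‖Gamma (1 + τ * I)‖ := by
      by_contra! hc
      have : Real.exp (-(Real.pi * |τ|)) ≤ 1 := Real.exp_le_one_iff.2 (by have := Real.pi_pos; simp; positivity)
      nlinarith
    rw [div_le_iff₀ hG]
    have h3 : Real.exp (Real.pi * |τ|) * Real.exp (-(Real.pi * |τ|)) = 1 := by
      rw [← Real.exp_add]; simp
    have h4 : ‖exp (-(1 * (t : ℂ)))‖ ≤ 1 := by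
      rw [norm_exp]; simp [ht'.le]
    have : (1 + τ * I - 1 : ℂ).re = 0 := by simp
    rw [this, Real.rpow_zero, one_mul]
    have := Real.exp_pos (Real.pi * |τ|)
    nlinarith
  · rw [gammaKernel, indicator_of_notMem ht, norm_zero]
    positivity

end GammaKernel

/-! ### Nonstationary phase with uniform constants -/

section NonstationaryPhase
open Complex

variable {V : Type*} [NormedAddCommGroup V] [InnerProductSpace ℝ V]

theorem norm_iteratedFDeriv_mul_le_of_le {f g : V → ℝ} (hf : ContDiff ℝ ∞ f)
    (hg : ContDiff ℝ ∞ g) {N : ℕ} {A B : ℝ} (hA : ∀ j ≤ N, ∀ x, ‖iteratedFDeriv ℝ j f x‖ ≤ A)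
    (hB : ∀ j ≤ N, ∀ x, ‖iteratedFDeriv ℝ j g x‖ ≤ B) {j : ℕ} (hj : j ≤ N) (x : V) :
    ‖iteratedFDeriv ℝ j (fun y => f y * g y) x‖ ≤ 2 ^ N * A * B := by
  have hA0 : 0 ≤ A := (norm_nonneg _).trans (hA 0 (Nat.zero_le _) x)
  have hB0 : 0 ≤ B := (norm_nonneg _).trans (hB 0 (Nat.zero_le _) x)
  calc _ ≤ ∑ i ∈ Finset.range (j + 1), (j.choose i : ℝ) * ‖iteratedFDeriv ℝ i f x‖ *
        ‖iteratedFDeriv ℝ (j - i) g x‖ :=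
        norm_iteratedFDeriv_mul_le (N := ∞) hf hg x (mod_cast le_top)
    _ ≤ ∑ i ∈ Finset.range (j + 1), (j.choose i : ℝ) * (A * B) := by
        refine Finset.sum_le_sum fun i hi => ?_
        rw [mul_assoc]
        have := Finset.mem_range.1 hi
        gcongr
        · exact hA i (by omega) x
        · exact hB (j - i) (by omega) x
    _ = 2 ^ j * (A * B) := by
        rw [← Finset.sum_mul]
        congr 1
        exact_mod_cast Nat.sum_range_choose j
    _ ≤ 2 ^ N * A * B := by
        rw [mul_assoc]
        gcongr
        norm_num

theorem exists_smooth_inverse {c : ℝ} (hc : 0 < c) :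
    ∃ ζ : ℝ → ℝ, ContDiff ℝ ∞ ζ ∧ ∀ t, c ≤ t → ζ t * t = 1 := by
  refine ⟨fun t => Real.smoothTransition (2 * t / c - 1) / t, ?_, fun t ht => ?_⟩
  · rw [contDiff_iff_contDiffAt]
    intro t
    rcases lt_or_ge t (c / 2) with h | h
    · have : (fun t => Real.smoothTransition (2 * t / c - 1) / t) =ᶠ[𝓝 t] fun _ => 0 := by
        filter_upwards [gt_mem_nhds h] with s hs
        rw [Real.smoothTransition.zero_of_nonpos, zero_div]
        rw [sub_nonpos, div_le_one hc]; linarith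
      exact contDiffAt_const.congr_of_eventuallyEq this
    · have ht : t ≠ 0 := by have : 0 < t := by linarith
                            exact this.ne'
      refine ContDiffAt.div ?_ contDiffAt_id ht
      exact Real.smoothTransition.contDiffAt.comp t
        (((contDiffAt_const.mul contDiffAt_id).div_const c).sub contDiffAt_const)
  · beta_reduce
    rw [Real.smoothTransition.one_of_one_le, div_mul_cancel₀ _ (by linarith)]
    rw [le_sub_iff_add_le, le_div_iff₀ hc]; linarith

/-- The derivatives of ζ ∘ v involve ζ only on the compact interval [-D, D], so U depends on v
through D alone. This uniformity is essential because the phases to be inverted vary with ξ, t and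
h. -/
theorem exists_inverse_bound (N : ℕ) {c : ℝ} (hc : 0 < c) (D : ℝ) :
    ∃ U : ℝ, ∀ v : V → ℝ, ContDiff ℝ ∞ v → (∀ j ≤ N, ∀ x, ‖iteratedFDeriv ℝ j v x‖ ≤ D) →
      ∃ u : V → ℝ, ContDiff ℝ ∞ u ∧ (∀ j ≤ N, ∀ x, ‖iteratedFDeriv ℝ j u x‖ ≤ U) ∧
        ∀ x, c ≤ v x → u x * v x = 1 := by
  obtain ⟨ζ, hζ, hζ1⟩ := exists_smooth_inverse hc
  have hb : ∀ j : ℕ, ∃ M : ℝ, ∀ t ∈ Set.Icc (-D) D, ‖iteratedFDeriv ℝ j ζ t‖ ≤ M := fun j =>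
    isCompact_Icc.exists_bound_of_continuousOn
      (hζ.continuous_iteratedFDeriv (mod_cast le_top)).continuousOn
  choose M hM using hb
  let M' : ℝ := ∑ j ∈ Finset.range (N + 1), |M j|
  have hM' : ∀ j ≤ N, ∀ t ∈ Set.Icc (-D) D, ‖iteratedFDeriv ℝ j ζ t‖ ≤ M' := by
    intro j hj t ht
    refine (hM j t ht).trans ((le_abs_self _).trans ?_)
    exact Finset.single_le_sum (f := fun j => |M j|) (fun _ _ => abs_nonneg _)
      (Finset.mem_range.2 (by omega))
  have hM'0 : 0 ≤ M' := Finset.sum_nonneg fun _ _ => abs_nonneg _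
  refine ⟨N.factorial * M' * (max D 1) ^ N, fun v hv hD => ⟨ζ ∘ v, hζ.comp hv, fun j hj x => ?_,
    fun x hx => hζ1 _ hx⟩⟩
  have hvx : v x ∈ Set.Icc (-D) D := by
    have := hD 0 (Nat.zero_le _) x
    simpa [abs_le] using this
  have h1 := norm_iteratedFDeriv_comp_le (n := j) (N := ∞) hζ hv (mod_cast le_top) x
    (C := M') (D := max D 1) (fun i hi => hM' i (by omega) _ hvx) (fun i hi1 hi => ?_)
  · refine h1.trans ?_
    gcongr
    exact le_max_right _ _
  · refine (hD i (by omega) x).trans ((le_max_left D 1).trans ?_)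
    exact le_self_pow₀ (le_max_right _ _) (by omega)

variable [FiniteDimensional ℝ V] [MeasurableSpace V] [BorelSpace V]

/-- One integration by parts of e^{iP} against a u. On the support of a, the factor u turns the
derivative of the phase into the constant Λ. -/
theorem integral_cexp_mul_eq {P u a : V → ℝ} (hP : ContDiff ℝ ∞ P) (hu : ContDiff ℝ ∞ u)
    (ha : ContDiff ℝ ∞ a) (hac : HasCompactSupport a) (e : V) {Λ : ℝ}
    (h : ∀ x ∈ tsupport a, u x * fderiv ℝ P x e = Λ) :
    Λ * ∫ x, cexp (I * P x) * a x =
      I * ∫ x, cexp (I * P x) * (fderiv ℝ (fun y => a y * u y) x e : ℝ) := by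
  let f : V → ℂ := fun x => ((a x * u x : ℝ) : ℂ)
  let g : V → ℂ := fun x => cexp (I * P x)
  have hau : ContDiff ℝ ∞ (fun y => a y * u y) := ha.mul hu
  have hauc : HasCompactSupport (fun y => a y * u y) := hac.mul_right
  have hf : ContDiff ℝ ∞ f := ofRealCLM.contDiff.comp hau
  have hfc : HasCompactSupport f := hauc.comp_left (g := fun t : ℝ => (t : ℂ)) (by simp)
  have hg : ContDiff ℝ ∞ g :=
    (contDiff_const.mul (ofRealCLM.contDiff.comp hP)).cexp
  have hf' : ∀ x, fderiv ℝ f x e = ((fderiv ℝ (fun y => a y * u y) x e : ℝ) : ℂ) := by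
    intro x
    have := (ofRealCLM.hasFDerivAt.comp x ((hau.differentiable (by simp)) x).hasFDerivAt).fderiv
    change fderiv ℝ (ofRealCLM ∘ fun y => a y * u y) x e = _
    rw [this]; rfl
  have hg' : ∀ x, fderiv ℝ g x e = g x * (I * (fderiv ℝ P x e : ℝ)) := by
    intro x
    have h1 : HasFDerivAt (fun x => I * (P x : ℂ)) (I • (ofRealCLM.comp (fderiv ℝ P x))) x :=
      (ofRealCLM.hasFDerivAt.comp x ((hP.differentiable (by simp)) x).hasFDerivAt).const_mul I
    rw [h1.cexp.fderiv]
    simp [g]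
  have hcf' : Continuous fun x => fderiv ℝ f x e :=
    (hf.continuous_fderiv (by simp)).clm_apply continuous_const
  have hcg' : Continuous fun x => fderiv ℝ g x e :=
    (hg.continuous_fderiv (by simp)).clm_apply continuous_const
  have hibp := integral_mul_fderiv_eq_neg_fderiv_mul_of_integrable (μ := (volume : Measure V))
    (f := f) (g := g) (v := e)
    ((hcf'.mul hg.continuous).integrable_of_hasCompactSupport
      (HasCompactSupport.mul_right (hfc.fderiv_apply ℝ e)))
    ((hf.continuous.mul hcg').integrable_of_hasCompactSupport (HasCompactSupport.mul_right hfc))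
    ((hf.continuous.mul hg.continuous).integrable_of_hasCompactSupport
      (HasCompactSupport.mul_right hfc))
    (fun x _ => hf.differentiable (by simp) x) (fun x _ => hg.differentiable (by simp) x)
  have h1 : ∀ x, f x * fderiv ℝ g x e = I * (Λ * (cexp (I * P x) * a x)) := by
    intro x
    rw [hg']
    by_cases hx : x ∈ tsupport a
    · rw [← h x hx]; simp only [f, g]; push_cast; ring
    · simp [f, image_eq_zero_of_notMem_tsupport hx]
  have h2 : ∀ x, fderiv ℝ f x e * g x =
      cexp (I * P x) * (fderiv ℝ (fun y => a y * u y) x e : ℝ) := by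
    intro x; rw [hf']; simp only [g]; ring
  simp_rw [h1, h2, integral_const_mul] at hibp
  have h3 := congrArg (fun z => -I * z) hibp
  simp only [← mul_assoc] at h3
  simpa using h3

/-- **Nonstationary phase**: `N`-fold integration by parts along one direction. -/
theorem exists_norm_integral_cexp_mul_le (N : ℕ) {K : Set V} (hK : IsCompact K) (U A : ℝ) :
    ∃ C : ℝ, ∀ (P u a : V → ℝ) (e : V) (Λ : ℝ), ContDiff ℝ ∞ P → ContDiff ℝ ∞ u →
      ContDiff ℝ ∞ a → ‖e‖ ≤ 1 → 0 ≤ Λ → (∀ j ≤ N, ∀ x, ‖iteratedFDeriv ℝ j u x‖ ≤ U) →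
      (∀ j ≤ N, ∀ x, ‖iteratedFDeriv ℝ j a x‖ ≤ A) → tsupport a ⊆ K →
      (∀ x ∈ tsupport a, u x * fderiv ℝ P x e = Λ) →
      Λ ^ N * ‖∫ x, cexp (I * P x) * a x‖ ≤ C := by
  induction N generalizing A with
  | zero =>
    refine ⟨A * volume.real K, fun P u a e Λ hP hu ha he hΛ hU hA hs h => ?_⟩
    have h1 : ∫ x, cexp (I * P x) * a x = ∫ x in K, cexp (I * P x) * a x := by
      rw [setIntegral_eq_integral_of_forall_compl_eq_zero]
      intro x hx
      rw [image_eq_zero_of_notMem_tsupport (fun h => hx (hs h))]; simp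
    rw [pow_zero, one_mul, h1]
    refine norm_setIntegral_le_of_norm_le_const hK.measure_lt_top fun x _ => ?_
    have := hA 0 le_rfl x
    rw [norm_mul, mul_comm I, norm_exp_ofReal_mul_I, one_mul]
    simpa using this
  | succ N ih =>
    -- Each integration by parts replaces a by the derivative of a u along e. This costs one
    -- derivative and, by the Leibniz rule, the factor in the new bound; no bound on P enters.
    obtain ⟨C, hC⟩ := ih (2 ^ (N + 1) * A * U)
    refine ⟨C, fun P u a e Λ hP hu ha he hΛ hU hA hs h => ?_⟩
    have hau : ContDiff ℝ ∞ (fun y => a y * u y) := ha.mul hu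
    have hac : HasCompactSupport a := hK.of_isClosed_subset (isClosed_tsupport a) hs
    let b : V → ℝ := fun x => fderiv ℝ (fun y => a y * u y) x e
    have hb : ContDiff ℝ ∞ b := (hau.fderiv_right (m := ∞) (by simp)).clm_apply contDiff_const
    have hbs : tsupport b ⊆ tsupport a :=
      (tsupport_fderiv_apply_subset ℝ e).trans (tsupport_mul_subset_left)
    have hibp := integral_cexp_mul_eq hP hu ha hac e h
    have h3 := congrArg norm hibp
    rw [norm_mul, norm_mul, norm_I, one_mul, norm_real, Real.norm_of_nonneg hΛ] at h3
    rw [pow_succ, mul_assoc, h3]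
    refine hC P u b e Λ hP hu hb he hΛ (fun j hj => hU j (by omega)) (fun j hj x => ?_)
      (hbs.trans hs) (fun x hx => h x (hbs hx))
    refine (norm_iteratedFDeriv_clm_apply_const (N := ∞) (c := e)
      (hau.fderiv_right (m := ∞) (by simp)).contDiffAt (mod_cast le_top)).trans ?_
    rw [norm_iteratedFDeriv_fderiv]
    have := norm_iteratedFDeriv_mul_le_of_le ha hu hA hU (j := j + 1) (by omega) x
    exact (mul_le_of_le_one_left (norm_nonneg _) he).trans this

end NonstationaryPhase

/-! ### Oscillatory integrals: rapid decay and correlations -/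

section OscillatoryIntegral
open Complex ComplexConjugate
open scoped RealInnerProductSpace

variable {V : Type*} [NormedAddCommGroup V] [InnerProductSpace ℝ V]

/-- All derivatives of `f` are bounded. -/
def BoundedDerivatives (f : V → ℝ) : Prop :=
  ∀ N : ℕ, ∃ M : ℝ, ∀ j ≤ N, ∀ x, ‖iteratedFDeriv ℝ j f x‖ ≤ M

theorem boundedDerivatives_of_hasCompactSupport {f : V → ℝ} (hf : ContDiff ℝ ∞ f)
    (hc : HasCompactSupport f) : BoundedDerivatives f := by
  intro N
  have hb : ∀ j : ℕ, ∃ M : ℝ, ∀ x, ‖iteratedFDeriv ℝ j f x‖ ≤ M := fun j =>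
    (hf.continuous_iteratedFDeriv (mod_cast le_top)).bounded_above_of_compact_support
      (hc.iteratedFDeriv j)
  choose M hM using hb
  refine ⟨∑ j ∈ Finset.range (N + 1), |M j|, fun j hj x => ?_⟩
  refine (hM j x).trans ((le_abs_self _).trans ?_)
  exact Finset.single_le_sum (f := fun j => |M j|) (fun _ _ => abs_nonneg _)
    (Finset.mem_range.2 (by omega))

theorem norm_iteratedFDeriv_translate_sub_le {w : V → ℝ} (hw : ContDiff ℝ ∞ w) {j : ℕ} {B : ℝ}
    (hB : ∀ x, ‖iteratedFDeriv ℝ (j + 1) w x‖ ≤ B) (h x : V) :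
    ‖iteratedFDeriv ℝ j (fun y => w (y + h) - w y) x‖ ≤ B * ‖h‖ := by
  have hw' : ContDiff ℝ ∞ (fun y => w (y + h)) := hw.comp (contDiff_id.add contDiff_const)
  have h1 : iteratedFDeriv ℝ j (fun y => w (y + h) - w y) x =
      iteratedFDeriv ℝ j w (x + h) - iteratedFDeriv ℝ j w x := by
    rw [fun_iteratedFDeriv_sub_apply (hw'.contDiffAt.of_le (mod_cast le_top))
      (hw.contDiffAt.of_le (mod_cast le_top)), iteratedFDeriv_comp_add_right]
  rw [h1]
  have h2 := Convex.norm_image_sub_le_of_norm_fderiv_le (𝕜 := ℝ) (f := iteratedFDeriv ℝ j w) (C := B)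
    (s := Set.univ) (fun x _ => (hw.differentiable_iteratedFDeriv (m := j)
      (by exact_mod_cast ENat.natCast_lt_top j)) x)
    (fun x _ => by rw [norm_fderiv_iteratedFDeriv]; exact hB x) convex_univ
    (Set.mem_univ x) (Set.mem_univ (x + h))
  simpa using h2

theorem norm_iteratedFDeriv_fderiv_apply_le {w : V → ℝ} (hw : ContDiff ℝ ∞ w) {j : ℕ} {B : ℝ}
    (hB : ∀ x, ‖iteratedFDeriv ℝ (j + 1) w x‖ ≤ B) (e x : V) :
    ‖iteratedFDeriv ℝ j (fun y => fderiv ℝ w y e) x‖ ≤ ‖e‖ * B := by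
  refine (norm_iteratedFDeriv_clm_apply_const (N := ∞) (c := e)
    (hw.fderiv_right (m := ∞) (by simp)).contDiffAt (mod_cast le_top)).trans ?_
  rw [norm_iteratedFDeriv_fderiv]
  gcongr
  exact hB x

theorem norm_iteratedFDeriv_one_add_mul_le {w : V → ℝ} (hw : ContDiff ℝ ∞ w) {j : ℕ} {B s : ℝ}
    (hB : ∀ x, ‖iteratedFDeriv ℝ j w x‖ ≤ B) (hs : |s| ≤ 1) (x : V) :
    ‖iteratedFDeriv ℝ j (fun y => 1 + s * w y) x‖ ≤ 1 + B := by
  have hB0 : 0 ≤ B := (norm_nonneg _).trans (hB x)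
  have h1 : ContDiff ℝ ∞ (fun y => s * w y) := contDiff_const.mul hw
  rw [fun_iteratedFDeriv_add_apply contDiffAt_const (h1.contDiffAt.of_le (mod_cast le_top))]
  refine (norm_add_le _ _).trans (add_le_add ?_ ?_)
  · rcases Nat.eq_zero_or_pos j with rfl | hj
    · simp
    · rw [iteratedFDeriv_const_of_ne (by omega)]; simp
  · have : iteratedFDeriv ℝ j (fun y => s * w y) x = s • iteratedFDeriv ℝ j w x :=
      iteratedFDeriv_const_smul_apply (a := s) (hw.contDiffAt.of_le (mod_cast le_top))
    rw [this, norm_smul, Real.norm_eq_abs]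
    exact (mul_le_of_le_one_left (norm_nonneg _) hs).trans (hB x)

variable [FiniteDimensional ℝ V] [MeasurableSpace V] [BorelSpace V]

/-- The oscillatory integral with amplitude `χ` and phase `⟪x, ξ⟫ + φ(x) t`. -/
def oscInt (φ χ : V → ℝ) (ξ : V) (t : ℝ) : ℂ :=
  ∫ x, (Real.fourierChar (-(⟪x, ξ⟫ + φ x * t)) : ℂ) * (χ x : ℂ)

theorem fourierChar_eq_cexp (s : ℝ) : (Real.fourierChar s : ℂ) = cexp (I * (2 * Real.pi * s : ℝ)) := by
  rw [Real.fourierChar_apply, mul_comm]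

theorem norm_oscInt_le (φ χ : V → ℝ) (ξ : V) (t : ℝ) : ‖oscInt φ χ ξ t‖ ≤ ∫ x, |χ x| := by
  refine (norm_integral_le_integral_norm _).trans (le_of_eq ?_)
  refine integral_congr_ae (.of_forall fun x => ?_)
  beta_reduce
  rw [norm_mul, Circle.norm_coe, one_mul, norm_real, Real.norm_eq_abs]

/-- When |ξ| dominates |t| sup‖∇φ‖, the phase has derivative comparable to |ξ| along ξ/|ξ|. Divided
by its size this derivative is 1 + s w with s = t/|ξ| and |s| ≤ 1, so its bounds are uniform in ξ
and t. -/
theorem exists_norm_oscInt_le_of_le {φ χ : V → ℝ} (hφ : ContDiff ℝ ∞ φ) (hφb : BoundedDerivatives φ)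
    (hχ : ContDiff ℝ ∞ χ) (hχc : HasCompactSupport χ) :
    ∃ L : ℝ, 1 ≤ L ∧ ∀ N : ℕ, ∃ C : ℝ, ∀ (ξ : V) (t : ℝ), L * |t| ≤ ‖ξ‖ →
      ‖ξ‖ ^ N * ‖oscInt φ χ ξ t‖ ≤ C := by
  obtain ⟨D₁, hD₁⟩ := hφb 1
  have hfd : ∀ x, ‖fderiv ℝ φ x‖ ≤ D₁ := fun x => by
    have := hD₁ 1 le_rfl x
    rwa [norm_iteratedFDeriv_one] at this
  -- The factor 2 D₁ makes t∇φ at most |ξ|/2, and the 1 ensures |t| ≤ |ξ|. The threshold does not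
  -- depend on N.
  refine ⟨max 1 (2 * D₁), le_max_left _ _, fun N => ?_⟩
  obtain ⟨M, hM⟩ := hφb (N + 1)
  obtain ⟨A, hA⟩ := boundedDerivatives_of_hasCompactSupport hχ hχc N
  obtain ⟨U, hU⟩ := exists_inverse_bound (V := V) N (c := 1 / 2) (by norm_num) (1 + M)
  obtain ⟨C, hC⟩ := exists_norm_integral_cexp_mul_le N (hχc : IsCompact (tsupport χ)) U A
  -- The second summand covers ξ = 0 with N = 0, where the power of ‖ξ‖ equals 1.
  refine ⟨max C 0 + if N = 0 then ∫ x, |χ x| else 0, fun ξ t hξt => ?_⟩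
  rcases eq_or_ne ξ 0 with rfl | hξ
  · rcases Nat.eq_zero_or_pos N with rfl | hN
    · simp only [pow_zero, one_mul, if_true]
      have := norm_oscInt_le φ χ 0 t
      have := le_max_right C 0
      linarith
    · rw [norm_zero, zero_pow hN.ne', zero_mul, if_neg hN.ne', add_zero]
      exact le_max_right _ _
  have hn : 0 < ‖ξ‖ := norm_pos_iff.2 hξ
  have hmain : ‖ξ‖ ^ N * ‖oscInt φ χ ξ t‖ ≤ C := by
    let e : V := ‖ξ‖⁻¹ • ξ
    have he : ‖e‖ = 1 := by simp [e, norm_smul, hn.ne']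
    let s : ℝ := t / ‖ξ‖
    have hs1 : |s| * max 1 (2 * D₁) ≤ 1 := by
      simp only [s]
      rw [abs_div, abs_norm, div_mul_eq_mul_div, div_le_one hn, mul_comm]; exact hξt
    have hs : |s| ≤ 1 := by
      nlinarith [le_max_left 1 (2 * D₁), abs_nonneg s]
    have hs2 : |s| * D₁ ≤ 1 / 2 := by nlinarith [le_max_right 1 (2 * D₁), abs_nonneg s]
    let w : V → ℝ := fun x => fderiv ℝ φ x e
    have hw : ContDiff ℝ ∞ w := (hφ.fderiv_right (m := ∞) (by simp)).clm_apply contDiff_const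
    have hwb : ∀ j ≤ N, ∀ x, ‖iteratedFDeriv ℝ j w x‖ ≤ M := fun j hj x => by
      have := norm_iteratedFDeriv_fderiv_apply_le hφ (j := j) (hM (j + 1) (by omega)) e x
      rwa [he, one_mul] at this
    obtain ⟨u, hu, huU, hu1⟩ := hU (fun x => 1 + s * w x) (contDiff_const.add (contDiff_const.mul hw))
      (fun j hj x => norm_iteratedFDeriv_one_add_mul_le hw (hwb j hj) hs x)
    let P : V → ℝ := fun x => 2 * Real.pi * (-(⟪x, ξ⟫ + φ x * t))
    have hin : ContDiff ℝ ∞ fun x : V => ⟪x, ξ⟫ := contDiff_id.inner ℝ contDiff_const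
    have hP : ContDiff ℝ ∞ P :=
      contDiff_const.mul ((hin.add (hφ.mul contDiff_const)).neg)
    have hPd : ∀ x, fderiv ℝ P x (-e) = 2 * Real.pi * ‖ξ‖ * (1 + s * w x) := by
      intro x
      have h1 : HasFDerivAt (fun x : V => ⟪x, ξ⟫) (innerSL ℝ ξ) x := by
        have := (innerSL ℝ ξ).hasFDerivAt (x := x)
        refine this.congr_of_eventuallyEq (.of_forall fun y => ?_)
        simp [real_inner_comm]
      have h2 := (((h1.add (((hφ.differentiable (by simp)) x).hasFDerivAt.mul_const t)).neg).const_mul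
        (2 * Real.pi)).fderiv
      have h3 : fderiv ℝ P x = _ := h2
      rw [h3]
      simp only [neg_add_rev, map_neg, smul_add, smul_neg, add_apply,
        neg_apply, smul_apply, smul_eq_mul, e, w, s,
        map_smul, innerSL_apply_apply, real_inner_self_eq_norm_sq]
      field_simp
      ring
    have h4 := hC P u χ (-e) (2 * Real.pi * ‖ξ‖) hP hu hχ (by rw [norm_neg, he]) (by positivity)
      huU hA subset_rfl (fun x _ => by
        rw [hPd, mul_left_comm, hu1, mul_one]
        have h5 : |s * w x| ≤ 1 / 2 := by
          rw [abs_mul]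
          refine le_trans ?_ hs2
          gcongr
          refine ((fderiv ℝ φ x).le_opNorm e).trans ?_
          rw [he, mul_one]; exact hfd x
        have := neg_le_of_abs_le h5
        linarith)
    have h6 : oscInt φ χ ξ t = ∫ x, cexp (I * P x) * χ x := by
      refine integral_congr_ae (.of_forall fun x => ?_)
      beta_reduce
      rw [fourierChar_eq_cexp]
    rw [h6]
    refine le_trans ?_ h4
    gcongr
    have := Real.pi_gt_three
    nlinarith
  refine hmain.trans ((le_max_left C 0).trans (le_add_of_nonneg_right ?_))
  split_ifs
  · exact integral_nonneg fun _ => abs_nonneg _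
  · exact le_rfl

/-- Expand the square as a double integral and substitute x = y + h. -/
theorem norm_integral_sq_le {F : V → ℂ} (hF : Integrable F) :
    ‖∫ x, F x‖ ^ 2 ≤ ∫ h, ‖∫ y, F (y + h) * conj (F y)‖ := by
  have hFc : Integrable fun x => conj (F x) := integrable_conj_iff' hF
  have h1 : ((∫ x, F x) * conj (∫ x, F x) : ℂ) = ∫ h, ∫ y, F (y + h) * conj (F y) := by
    have hint : Integrable (fun p : V × V => F (p.1 + p.2) * conj (F p.1)) (volume.prod volume) := by
      have := (measurePreserving_prod_add (volume : Measure V) (volume : Measure V)).integrable_comp_of_integrable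
        (hFc.mul_prod hF)
      refine this.congr (.of_forall fun p => ?_)
      simp [mul_comm]
    rw [← integral_integral_swap hint, ← integral_conj, ← integral_const_mul]
    refine integral_congr_ae (.of_forall fun y => ?_)
    beta_reduce
    rw [integral_mul_const]
    congr 1
    simp_rw [add_comm y]
    exact (integral_add_right_eq_self F y).symm
  calc ‖∫ x, F x‖ ^ 2 = ‖((∫ x, F x) * conj (∫ x, F x) : ℂ)‖ := by
        rw [norm_mul, RCLike.norm_conj, sq]
    _ ≤ _ := by rw [h1]; exact norm_integral_le_integral_norm _

/-- In the correlation the linear phase contributes only a unimodular constant. What remains is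
t(φ(y + h) - φ(y)), whose derivative along h is at least c|t||h|² in size by strong convexity. The
phase is therefore nonstationary in the direction h/|h|. -/
theorem exists_norm_correlation_le {φ χ : V → ℝ} (hφ : ContDiff ℝ ∞ φ)
    (hφb : BoundedDerivatives φ) (hχ : ContDiff ℝ ∞ χ) (hχc : HasCompactSupport χ) {c : ℝ}
    (hc : 0 < c) (hconv : ∀ x ∈ tsupport χ, ∀ y ∈ tsupport χ,
      c * ‖x - y‖ ^ 2 ≤ fderiv ℝ φ x (x - y) - fderiv ℝ φ y (x - y)) (N : ℕ) :
    ∃ C : ℝ, ∀ t h, (|t| * ‖h‖) ^ N *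
      ‖∫ y, cexp (I * (2 * Real.pi * (-((φ (y + h) - φ y) * t)) : ℝ)) * (χ (y + h) * χ y : ℝ)‖ ≤ C := by
  obtain ⟨M, hM⟩ := hφb (N + 2)
  obtain ⟨A, hA⟩ := boundedDerivatives_of_hasCompactSupport hχ hχc N
  obtain ⟨U, hU⟩ := exists_inverse_bound (V := V) N hc M
  obtain ⟨C, hC⟩ := exists_norm_integral_cexp_mul_le N (hχc : IsCompact (tsupport χ)) U (2 ^ N * A * A)
  obtain ⟨C₀, hC₀⟩ := exists_norm_integral_cexp_mul_le 0 (hχc : IsCompact (tsupport χ))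
    0 (2 ^ N * A * A)
  refine ⟨max C C₀, fun t h => ?_⟩
  let P : V → ℝ := fun y => 2 * Real.pi * (-((φ (y + h) - φ y) * t))
  let a : V → ℝ := fun y => χ (y + h) * χ y
  have hφh : ContDiff ℝ ∞ fun y => φ (y + h) := hφ.comp (contDiff_id.add contDiff_const)
  have hχh : ContDiff ℝ ∞ fun y => χ (y + h) := hχ.comp (contDiff_id.add contDiff_const)
  have hP : ContDiff ℝ ∞ P := contDiff_const.mul ((hφh.sub hφ).mul contDiff_const).neg
  have ha : ContDiff ℝ ∞ a := hχh.mul hχ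
  have haA : ∀ j ≤ N, ∀ x, ‖iteratedFDeriv ℝ j a x‖ ≤ 2 ^ N * A * A := by
    intro j hj x
    refine norm_iteratedFDeriv_mul_le_of_le hχh hχ (fun j hj x => ?_) hA hj x
    rw [iteratedFDeriv_comp_add_right]
    exact hA j hj _
  have has : tsupport a ⊆ tsupport χ := tsupport_mul_subset_right
  have has' : ∀ y ∈ tsupport a, y + h ∈ tsupport χ := by
    have hcl : IsClosed {y : V | y + h ∈ tsupport χ} :=
      (isClosed_tsupport χ).preimage (continuous_id.add continuous_const)
    intro y hy
    refine closure_minimal (fun z hz => ?_) hcl hy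
    refine subset_tsupport χ ?_
    intro h0
    exact hz (by simp [a, h0])
  change (|t| * ‖h‖) ^ N * ‖∫ y, cexp (I * P y) * a y‖ ≤ _
  rcases eq_or_ne (|t| * ‖h‖) 0 with h0 | h0
  · rcases Nat.eq_zero_or_pos N with rfl | hN
    · refine le_trans ?_ (le_max_right C C₀)
      exact hC₀ P 0 a 0 0 hP contDiff_const ha (by simp) le_rfl (fun j hj x => by
        obtain rfl : j = 0 := by omega
        simp) haA has (by simp)
    · rw [h0, zero_pow hN.ne', zero_mul]
      refine le_trans ?_ (le_max_right C C₀)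
      have := hC₀ P 0 a 0 0 hP contDiff_const ha (by simp) le_rfl (fun j hj x => by
        obtain rfl : j = 0 := by omega
        simp) (fun j hj => haA j (by omega)) has (by simp)
      exact le_trans (by positivity) this
  have ht : t ≠ 0 := by rintro rfl; simp at h0
  have hh : h ≠ 0 := by rintro rfl; simp at h0
  have hn : 0 < ‖h‖ := norm_pos_iff.2 hh
  have htp : 0 < |t| := abs_pos.2 ht
  -- The sign makes the derivative of P along e positive on the support of the amplitude.
  let e : V := (-(SignType.sign t : ℝ) * ‖h‖⁻¹) • h
  have he : ‖e‖ ≤ 1 := by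
    have : |(SignType.sign t : ℝ)| ≤ 1 := by
      rcases lt_or_gt_of_ne ht with h1 | h1 <;> simp [h1]
    simp only [e, norm_smul, norm_mul, norm_neg, norm_inv, norm_norm]
    rw [mul_assoc, inv_mul_cancel₀ hn.ne', mul_one]
    exact this
  -- Dividing by |h|² makes w(y + h) - w(y) at least c, while the size |h|⁻¹ of the direction is
  -- compensated by the increment h. The derivative bounds thus remain uniform as h tends to 0.
  let w : V → ℝ := fun y => fderiv ℝ φ y ((‖h‖⁻¹ ^ 2) • h)
  have hw : ContDiff ℝ ∞ w := (hφ.fderiv_right (m := ∞) (by simp)).clm_apply contDiff_const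
  have hwn : ‖(‖h‖⁻¹ ^ 2) • h‖ = ‖h‖⁻¹ := by
    simp only [norm_smul, norm_pow, norm_inv, norm_norm]
    field_simp
  obtain ⟨u, hu, huU, hu1⟩ := hU (fun y => w (y + h) - w y)
    ((hw.comp (contDiff_id.add contDiff_const)).sub hw) (fun j hj x => by
      have := norm_iteratedFDeriv_translate_sub_le hw (j := j)
        (fun x => norm_iteratedFDeriv_fderiv_apply_le hφ (hM (j + 1 + 1) (by omega)) _ x) h x
      rw [hwn] at this
      rwa [mul_right_comm, inv_mul_cancel₀ hn.ne', one_mul] at this)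
  have hPd : ∀ y, fderiv ℝ P y e = 2 * Real.pi * (|t| * ‖h‖) * (w (y + h) - w y) := by
    intro y
    have h1 : HasFDerivAt (fun y => φ (y + h)) (fderiv ℝ φ (y + h)) y :=
      (hasFDerivAt_comp_add_right h).2 ((hφ.differentiable (by simp)) (y + h)).hasFDerivAt
    have h2 := ((((h1.sub ((hφ.differentiable (by simp)) y).hasFDerivAt).mul_const t).neg).const_mul
        (2 * Real.pi)).fderiv
    have h3 : fderiv ℝ P y = _ := h2
    rw [h3]
    have hsg : (SignType.sign t : ℝ) * t = |t| := sign_mul_self t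
    simp only [neg_apply, smul_apply,
      sub_apply, smul_eq_mul, e, w, map_smul]
    rw [← hsg]
    field_simp
  have h4 := hC P u a e (2 * Real.pi * (|t| * ‖h‖)) hP hu ha he (by positivity) huU haA has
    (fun y hy => by
      rw [hPd, mul_left_comm, hu1, mul_one]
      have h5 := hconv (y + h) (has' y hy) y (has hy)
      rw [add_sub_cancel_left] at h5
      simp only [w, map_smul, smul_eq_mul]
      rw [← mul_sub, inv_pow, inv_mul_eq_div, le_div_iff₀ (by positivity)]
      exact h5)
  refine le_trans ?_ (h4.trans (le_max_left C C₀))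
  have := Real.pi_gt_three
  have h0 : 0 ≤ |t| * ‖h‖ := by positivity
  have h5 : |t| * ‖h‖ ≤ 2 * Real.pi * (|t| * ‖h‖) := by nlinarith
  exact mul_le_mul_of_nonneg_right (pow_le_pow_left₀ h0 h5 N) (norm_nonneg _)

end OscillatoryIntegral

/-! ### Fourier decay for convex graphs and for an annular density -/

section OscillatoryDecay
open Complex ComplexConjugate Module
open scoped RealInnerProductSpace

variable {V : Type*} [NormedAddCommGroup V] [InnerProductSpace ℝ V]

/-- With a = |x|^(β-2) and b = |y|^(β-2), the inner product of ax - by with x - y is (a + b)|x -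
y|²/2 + (a - b)(|x|² - |y|²)/2, and the last term is nonnegative because a, b are ordered like |x|,
|y|. The segment from x to y may pass near the origin. -/
theorem inner_norm_rpow_sub_ge {β r : ℝ} (hβ : 2 ≤ β) (hr : 0 < r) {x y : V} (hx : r ≤ ‖x‖)
    (hy : r ≤ ‖y‖) :
    β * r ^ (β - 2) * ‖x - y‖ ^ 2 ≤
      fderiv ℝ (fun x : V => ‖x‖ ^ β) x (x - y) - fderiv ℝ (fun x : V => ‖x‖ ^ β) y (x - y) := by
  rw [fderiv_norm_rpow x (by linarith), fderiv_norm_rpow y (by linarith)]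
  simp only [smul_apply, innerSL_apply_apply, smul_eq_mul]
  have hx0 : 0 < ‖x‖ := hr.trans_le hx
  have hy0 : 0 < ‖y‖ := hr.trans_le hy
  set a := ‖x‖ ^ (β - 2)
  set b := ‖y‖ ^ (β - 2)
  have ha : r ^ (β - 2) ≤ a := Real.rpow_le_rpow hr.le hx (by linarith)
  have hb : r ^ (β - 2) ≤ b := Real.rpow_le_rpow hr.le hy (by linarith)
  have hmono : 0 ≤ (a - b) * (‖x‖ ^ 2 - ‖y‖ ^ 2) := by
    rcases le_total ‖x‖ ‖y‖ with h | h
    · have h1 : a ≤ b := Real.rpow_le_rpow hx0.le h (by linarith)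
      have h2 : ‖x‖ ^ 2 ≤ ‖y‖ ^ 2 := by gcongr
      nlinarith
    · have h1 : b ≤ a := Real.rpow_le_rpow hy0.le h (by linarith)
      have h2 : ‖y‖ ^ 2 ≤ ‖x‖ ^ 2 := by gcongr
      nlinarith
  have e1 : ⟪x, x - y⟫ = (‖x - y‖ ^ 2 + (‖x‖ ^ 2 - ‖y‖ ^ 2)) / 2 := by
    rw [norm_sub_sq_real, inner_sub_right, real_inner_self_eq_norm_sq]; ring
  have e2 : ⟪y, x - y⟫ = (-‖x - y‖ ^ 2 + (‖x‖ ^ 2 - ‖y‖ ^ 2)) / 2 := by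
    rw [norm_sub_sq_real, inner_sub_right, real_inner_self_eq_norm_sq, real_inner_comm]; ring
  rw [e1, e2]
  have h4 : r ^ (β - 2) * ‖x - y‖ ^ 2 ≤ (a + b) / 2 * ‖x - y‖ ^ 2 := by
    gcongr; linarith
  nlinarith

variable [FiniteDimensional ℝ V] [MeasurableSpace V] [BorelSpace V]

theorem integrable_oscInt_integrand {φ χ : V → ℝ} (hφ : Continuous φ) (hχ : Integrable χ) (ξ : V)
    (t : ℝ) :
    Integrable fun x => (Real.fourierChar (-(⟪x, ξ⟫ + φ x * t)) : ℂ) * (χ x : ℂ) := by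
  refine hχ.norm.mono' ?_ (.of_forall fun x => ?_)
  · refine AEStronglyMeasurable.mul ?_ (continuous_ofReal.comp_aestronglyMeasurable hχ.1)
    refine Continuous.aestronglyMeasurable ?_
    exact (Real.continuous_fourierChar.comp (by fun_prop)).subtype_val
  · rw [norm_mul, Circle.norm_coe, one_mul, norm_real]

/-- The correlation at h is O((1 + |t||h|)^(-(d+1))), and its integral over h is O(|t|^(-d)). This
gives the stationary phase rate without locating critical points. -/
theorem exists_norm_oscInt_sq_le {φ χ : V → ℝ} (hφ : ContDiff ℝ ∞ φ)
    (hφb : BoundedDerivatives φ) (hχ : ContDiff ℝ ∞ χ) (hχc : HasCompactSupport χ) {c : ℝ}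
    (hc : 0 < c) (hconv : ∀ x ∈ tsupport χ, ∀ y ∈ tsupport χ,
      c * ‖x - y‖ ^ 2 ≤ fderiv ℝ φ x (x - y) - fderiv ℝ φ y (x - y)) :
    ∃ C : ℝ, ∀ ξ t, |t| ^ finrank ℝ V * ‖oscInt φ χ ξ t‖ ^ 2 ≤ C := by
  let d := finrank ℝ V
  obtain ⟨C₀, hC₀⟩ := exists_norm_correlation_le hφ hφb hχ hχc hc hconv 0
  obtain ⟨C₁, hC₁⟩ := exists_norm_correlation_le hφ hφb hχ hχc hc hconv (d + 1)
  let B : ℝ := 2 ^ (d + 1) * (C₀ + C₁)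
  have hint : Integrable (fun h : V => (1 + ‖h‖) ^ (-((d + 1 : ℕ) : ℝ))) :=
    integrable_one_add_norm (by push_cast; simp [d])
  let S : ℝ := ∫ h : V, (1 + ‖h‖) ^ (-((d + 1 : ℕ) : ℝ))
  refine ⟨max (B * S) ((∫ x, |χ x|) ^ 2), fun ξ t => ?_⟩
  rcases eq_or_ne t 0 with rfl | ht
  · refine le_trans ?_ (le_max_right _ _)
    refine (mul_le_of_le_one_left (by positivity) (pow_le_one₀ (by simp) (by simp))).trans ?_
    exact pow_le_pow_left₀ (norm_nonneg _) (norm_oscInt_le φ χ ξ 0) 2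
  refine le_trans ?_ (le_max_left _ _)
  have htp : 0 < |t| := abs_pos.2 ht
  let F : V → ℂ := fun x => (Real.fourierChar (-(⟪x, ξ⟫ + φ x * t)) : ℂ) * (χ x : ℂ)
  have hF : Integrable F :=
    integrable_oscInt_integrand hφ.continuous (hχ.continuous.integrable_of_hasCompactSupport hχc) ξ t
  have hFF : ∀ h y, F (y + h) * conj (F y) = (Real.fourierChar (-⟪h, ξ⟫) : ℂ) *
      (cexp (I * (2 * Real.pi * (-((φ (y + h) - φ y) * t)) : ℝ)) * (χ (y + h) * χ y : ℝ)) := by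
    intro h y
    simp only [F, map_mul, conj_ofReal, ← Circle.coe_inv_eq_conj]
    rw [← AddChar.map_neg_eq_inv, ← fourierChar_eq_cexp]
    have h1 : Real.fourierChar (-⟪h, ξ⟫) * Real.fourierChar (-((φ (y + h) - φ y) * t)) =
        Real.fourierChar (-(⟪y + h, ξ⟫ + φ (y + h) * t)) * Real.fourierChar (-(-(⟪y, ξ⟫ + φ y * t))) := by
      rw [← AddChar.map_add_eq_mul, ← AddChar.map_add_eq_mul]
      congr 1
      rw [inner_add_left]
      ring
    have h2 := congrArg (fun z : Circle => (z : ℂ)) h1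
    simp only [Circle.coe_mul] at h2
    push_cast
    rw [← mul_assoc (Real.fourierChar (-⟪h, ξ⟫) : ℂ), h2]
    ring
  have hb : ∀ h, ‖∫ y, F (y + h) * conj (F y)‖ ≤ B * (1 + ‖|t| • h‖) ^ (-((d + 1 : ℕ) : ℝ)) := by
    intro h
    simp_rw [hFF, integral_const_mul]
    rw [norm_mul, Circle.norm_coe, one_mul, norm_smul, Real.norm_eq_abs, abs_abs]
    set G := ‖∫ y, cexp (I * (2 * Real.pi * (-((φ (y + h) - φ y) * t)) : ℝ)) * (χ (y + h) * χ y : ℝ)‖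
    have h0 := hC₀ t h
    have h1 := hC₁ t h
    rw [pow_zero, one_mul] at h0
    have hs : 0 ≤ |t| * ‖h‖ := by positivity
    have hG : 0 ≤ G := norm_nonneg _
    rw [Real.rpow_neg (by positivity), Real.rpow_natCast, ← div_eq_mul_inv,
      le_div_iff₀ (by positivity)]
    have h2 : (1 + |t| * ‖h‖) ^ (d + 1) ≤ 2 ^ (d + 1) * (1 + (|t| * ‖h‖) ^ (d + 1)) := by
      have := add_pow_le (zero_le_one) hs (d + 1)
      refine this.trans ?_
      rw [one_pow, Nat.add_sub_cancel]
      gcongr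
      · norm_num
      · omega
    calc G * (1 + |t| * ‖h‖) ^ (d + 1) ≤ G * (2 ^ (d + 1) * (1 + (|t| * ‖h‖) ^ (d + 1))) := by gcongr
      _ = 2 ^ (d + 1) * (G + (|t| * ‖h‖) ^ (d + 1) * G) := by ring
      _ ≤ B := by
        simp only [B]
        gcongr
  have hint' : Integrable (fun h : V => B * (1 + ‖|t| • h‖) ^ (-((d + 1 : ℕ) : ℝ))) :=
    ((hint.comp_smul htp.ne')).const_mul B
  have h3 : ‖oscInt φ χ ξ t‖ ^ 2 ≤ B * ((|t| ^ d)⁻¹ * S) := by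
    refine (norm_integral_sq_le hF).trans ?_
    refine (integral_mono_of_nonneg (.of_forall fun _ => norm_nonneg _) hint' (.of_forall hb)).trans ?_
    rw [integral_const_mul, Measure.integral_comp_smul volume
      (fun h : V => (1 + ‖h‖) ^ (-((d + 1 : ℕ) : ℝ))), smul_eq_mul, abs_of_pos (by positivity)]
  calc |t| ^ d * ‖oscInt φ χ ξ t‖ ^ 2 ≤ |t| ^ d * (B * ((|t| ^ d)⁻¹ * S)) := by gcongr
    _ = B * S := by field_simp

/-- The decay of a Fourier transform of a smooth density on a hypersurface with nonvanishing
curvature, including rapid decay away from the normal directions. -/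
def OscDecay (φ χ : V → ℝ) : Prop :=
  ∀ N : ℕ, ∃ C : ℝ, 0 < C ∧ ∀ ξ t, ‖oscInt φ χ ξ t‖ ≤
    C * (1 + |t|) ^ (-((finrank ℝ V : ℝ) / 2)) * (1 + ‖ξ‖ / (1 + |t|)) ^ (-(N : ℝ))

/-- For |ξ| ≥ L|t| the phase is nonstationary; for |ξ| ≤ L|t| the quotient |ξ|/(1 + |t|) is bounded
and the square bound suffices. -/
theorem oscDecay_of_convex {φ χ : V → ℝ} (hφ : ContDiff ℝ ∞ φ)
    (hφb : BoundedDerivatives φ) (hχ : ContDiff ℝ ∞ χ) (hχc : HasCompactSupport χ) {c : ℝ}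
    (hc : 0 < c) (hconv : ∀ x ∈ tsupport χ, ∀ y ∈ tsupport χ,
      c * ‖x - y‖ ^ 2 ≤ fderiv ℝ φ x (x - y) - fderiv ℝ φ y (x - y)) :
    OscDecay φ χ := by
  intro N
  let d := finrank ℝ V
  obtain ⟨L, hL, hLN⟩ := exists_norm_oscInt_le_of_le hφ hφb hχ hχc
  obtain ⟨C₂, hC₂⟩ := exists_norm_oscInt_sq_le hφ hφb hχ hχc hc hconv
  -- The d extra powers of |ξ| pay for (1 + |t|)^(d/2), since |t| ≤ |ξ| in that regime.
  obtain ⟨C₃, hC₃⟩ := hLN (N + d)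
  let C₀ : ℝ := ∫ x, |χ x|
  have hC₀ : ∀ ξ t, ‖oscInt φ χ ξ t‖ ≤ C₀ := norm_oscInt_le φ χ
  have hC₀0 : 0 ≤ C₀ := integral_nonneg fun _ => abs_nonneg _
  have hC₂0 : 0 ≤ C₂ := le_trans (by positivity) (hC₂ 0 0)
  let A : ℝ := 2 ^ d * (C₀ ^ 2 + C₂)
  let B : ℝ := 2 ^ (N + d) * (C₀ + |C₃|)
  have hA : 0 ≤ A := by positivity
  have hB : 0 ≤ B := by positivity
  refine ⟨Real.sqrt A * (1 + L) ^ N + B + 1, by positivity, fun ξ t => ?_⟩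
  have ht0 : 0 ≤ |t| := abs_nonneg t
  set G := ‖oscInt φ χ ξ t‖
  have hG : 0 ≤ G := norm_nonneg _
  have hT : (1 : ℝ) ≤ 1 + |t| := by linarith
  have e1 : (1 + |t|) ^ (-((d : ℝ) / 2)) = (Real.sqrt ((1 + |t|) ^ d))⁻¹ := by
    rw [Real.rpow_neg (by positivity), Real.sqrt_eq_rpow, ← Real.rpow_natCast, ← Real.rpow_mul
      (by positivity)]
    congr 2; ring
  have e2 : (1 + ‖ξ‖ / (1 + |t|)) ^ (-(N : ℝ)) = ((1 + ‖ξ‖ / (1 + |t|)) ^ N)⁻¹ := by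
    rw [Real.rpow_neg (by positivity), Real.rpow_natCast]
  change G ≤ _ * (1 + |t|) ^ (-((d : ℝ) / 2)) * _
  rw [e1, e2, ← div_eq_mul_inv, ← div_eq_mul_inv, le_div_iff₀ (by positivity),
    le_div_iff₀ (by positivity)]
  have hpoly : ∀ (s : ℝ) (k : ℕ), 0 ≤ s → (1 + s) ^ k ≤ 2 ^ k * (1 + s ^ k) := by
    intro s k hs
    refine (add_pow_le zero_le_one hs k).trans ?_
    rw [one_pow]
    gcongr
    · norm_num
    · omega
  rcases le_total (L * |t|) ‖ξ‖ with h | h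
  · have h1 : ‖ξ‖ / (1 + |t|) ≤ ‖ξ‖ := div_le_self (norm_nonneg _) hT
    have h2 : Real.sqrt ((1 + |t|) ^ d) ≤ (1 + ‖ξ‖) ^ d := by
      have h3 : (1 + |t|) ^ d ≤ (1 + ‖ξ‖) ^ d := by
        gcongr
        nlinarith
      refine (Real.sqrt_le_sqrt h3).trans ?_
      rw [Real.sqrt_le_left (by positivity)]
      exact le_self_pow₀ (one_le_pow₀ (by simp)) (by norm_num)
    calc G * (1 + ‖ξ‖ / (1 + |t|)) ^ N * Real.sqrt ((1 + |t|) ^ d)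
        ≤ G * (1 + ‖ξ‖) ^ N * (1 + ‖ξ‖) ^ d := by gcongr
      _ = G * (1 + ‖ξ‖) ^ (N + d) := by ring
      _ ≤ G * (2 ^ (N + d) * (1 + ‖ξ‖ ^ (N + d))) := by
          gcongr; exact hpoly _ _ (norm_nonneg _)
      _ = 2 ^ (N + d) * (G + ‖ξ‖ ^ (N + d) * G) := by ring
      _ ≤ B := by
          simp only [B]
          have := hC₃ ξ t h
          have := le_abs_self C₃
          have := hC₀ ξ t
          gcongr
          linarith
      _ ≤ _ := by
          have : 0 ≤ Real.sqrt A * (1 + L) ^ N := by positivity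
          linarith
  · have h1 : ‖ξ‖ / (1 + |t|) ≤ L := by
      rw [div_le_iff₀ (by positivity)]; nlinarith
    have h2 : G * Real.sqrt ((1 + |t|) ^ d) ≤ Real.sqrt A := by
      apply Real.le_sqrt_of_sq_le
      rw [mul_pow, Real.sq_sqrt (by positivity)]
      calc G ^ 2 * (1 + |t|) ^ d ≤ G ^ 2 * (2 ^ d * (1 + |t| ^ d)) := by
            gcongr; exact hpoly _ _ ht0
        _ = 2 ^ d * (G ^ 2 + |t| ^ d * G ^ 2) := by ring
        _ ≤ A := by
            simp only [A]
            gcongr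
            · exact hC₀ ξ t
            · exact hC₂ ξ t
    calc G * (1 + ‖ξ‖ / (1 + |t|)) ^ N * Real.sqrt ((1 + |t|) ^ d)
        = (G * Real.sqrt ((1 + |t|) ^ d)) * (1 + ‖ξ‖ / (1 + |t|)) ^ N := by ring
      _ ≤ Real.sqrt A * (1 + L) ^ N := by gcongr
      _ ≤ _ := by linarith

/-- The function |x|^β need not be smooth at the origin, so it is multiplied by a cutoff κ that
equals 1 near the support of χ and is supported off the origin. Neither the convexity condition nor
the integral sees the change. -/
theorem exists_bump_oscDecay {β : ℝ} (hβ : 2 ≤ β) {c : V} (hc : 1 ≤ ‖c‖) :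
    ∃ χ : V → ℝ, Continuous χ ∧ HasCompactSupport χ ∧ (∀ x, 0 ≤ χ x) ∧
      (∀ x, ‖x‖ ≤ 1 / 2 → χ x = 0) ∧
      (∀ x ∈ Metric.ball c (1 / 8), χ x = 1) ∧ OscDecay (fun x : V => ‖x‖ ^ β) χ := by
  let χ : ContDiffBump c := ⟨1 / 8, 1 / 4, by norm_num, by norm_num⟩
  let κ : ContDiffBump c := ⟨1 / 2, 3 / 4, by norm_num, by norm_num⟩
  let φ : V → ℝ := fun x => κ x * ‖x‖ ^ β
  have hφ : ContDiff ℝ ∞ φ := by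
    refine contDiff_iff_contDiffAt.2 fun x => ?_
    by_cases hx : x ∉ tsupport φ
    · exact contDiffAt_const.congr_of_eventuallyEq (notMem_tsupport_iff_eventuallyEq.1 hx)
    rw [not_not] at hx
    have hx' : x ∈ Metric.closedBall c (3 / 4) := by
      rw [← show tsupport κ = Metric.closedBall c (3 / 4) from κ.tsupport_eq]
      exact tsupport_mul_subset_left hx
    have hx0 : x ≠ 0 := by
      rintro rfl
      rw [Metric.mem_closedBall, dist_zero_left] at hx'
      linarith
    exact κ.contDiffAt.mul ((contDiffAt_norm ℝ hx0).rpow_const_of_ne (norm_ne_zero_iff.2 hx0))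
  have hφc : HasCompactSupport φ := κ.hasCompactSupport.mul_right
  have hloc : ∀ x ∈ tsupport χ, φ =ᶠ[𝓝 x] fun x : V => ‖x‖ ^ β := by
    intro x hx
    rw [χ.tsupport_eq] at hx
    have hx' : x ∈ Metric.ball c (1 / 2) :=
      Metric.closedBall_subset_ball (by norm_num : (1 / 4 : ℝ) < 1 / 2) hx
    filter_upwards [Metric.isOpen_ball.mem_nhds hx'] with y hy
    simp only [φ]
    rw [κ.one_of_mem_closedBall (Metric.ball_subset_closedBall hy), one_mul]
  have hnorm : ∀ x ∈ tsupport χ, (3 / 4 : ℝ) ≤ ‖x‖ := by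
    intro x hx
    rw [χ.tsupport_eq, Metric.mem_closedBall, dist_eq_norm] at hx
    have h1 := norm_sub_norm_le c x
    rw [norm_sub_rev] at h1
    change ‖x - c‖ ≤ 1 / 4 at hx
    linarith
  have hdec : OscDecay φ χ := by
    refine oscDecay_of_convex hφ (boundedDerivatives_of_hasCompactSupport hφ hφc) χ.contDiff
      χ.hasCompactSupport (c := β * (3 / 4) ^ (β - 2)) (by positivity) fun x hx y hy => ?_
    rw [(hloc x hx).fderiv_eq, (hloc y hy).fderiv_eq]
    exact inner_norm_rpow_sub_ge hβ (by norm_num) (hnorm x hx) (hnorm y hy)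
  refine ⟨χ, χ.continuous, χ.hasCompactSupport, fun x => χ.nonneg, fun x hx =>
    image_eq_zero_of_notMem_tsupport fun h => by have := hnorm x h; linarith, fun x hx =>
    χ.one_of_mem_closedBall (Metric.ball_subset_closedBall hx), fun N => ?_⟩
  obtain ⟨C, hC, h⟩ := hdec N
  refine ⟨C, hC, fun ξ t => ?_⟩
  have : oscInt (fun x : V => ‖x‖ ^ β) χ ξ t = oscInt φ χ ξ t := by
    refine integral_congr_ae (.of_forall fun x => ?_)
    beta_reduce
    by_cases hx : x ∈ tsupport χ
    · rw [(hloc x hx).eq_of_nhds]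
    · rw [image_eq_zero_of_notMem_tsupport hx]; simp
  rw [this]
  exact h ξ t

theorem OscDecay.sum {ι : Type*} (s : Finset ι) {φ : V → ℝ} (hφ : Continuous φ) {χ : ι → V → ℝ}
    (hi : ∀ i ∈ s, Integrable (χ i)) (h : ∀ i ∈ s, OscDecay φ (χ i)) :
    OscDecay φ (fun x => ∑ i ∈ s, χ i x) := by
  intro N
  have h' : ∀ i, ∃ C : ℝ, 0 < C ∧ (i ∈ s → ∀ ξ t, ‖oscInt φ (χ i) ξ t‖ ≤
    C * (1 + |t|) ^ (-((finrank ℝ V : ℝ) / 2)) * (1 + ‖ξ‖ / (1 + |t|)) ^ (-(N : ℝ))) := by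
    intro i
    by_cases hs : i ∈ s
    · obtain ⟨C, hC, hh⟩ := h i hs N
      exact ⟨C, hC, fun _ => hh⟩
    · exact ⟨1, one_pos, fun h => absurd h hs⟩
  choose C hC hb using h'
  refine ⟨∑ i ∈ s, C i + 1, add_pos_of_nonneg_of_pos (Finset.sum_nonneg fun i _ => (hC i).le) one_pos,
    fun ξ t => ?_⟩
  have e : oscInt φ (fun x => ∑ i ∈ s, χ i x) ξ t = ∑ i ∈ s, oscInt φ (χ i) ξ t := by
    unfold oscInt
    rw [← integral_finsetSum s fun i hi' => integrable_oscInt_integrand hφ (hi i hi') ξ t]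
    refine integral_congr_ae (.of_forall fun x => ?_)
    beta_reduce
    push_cast
    rw [Finset.mul_sum]
  rw [e, mul_assoc, add_mul, Finset.sum_mul]
  refine (norm_sum_le _ _).trans ?_
  have h1 : 0 ≤ 1 * ((1 + |t|) ^ (-((finrank ℝ V : ℝ) / 2)) * (1 + ‖ξ‖ / (1 + |t|)) ^ (-(N : ℝ))) := by
    positivity
  refine le_add_of_le_of_nonneg (Finset.sum_le_sum fun i hi => ?_) h1
  rw [← mul_assoc]
  exact hb i hi ξ t

/-- A density which dominates an annulus and for which the hypersurface `xₙ = |x'| ^ β` has a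
decaying Fourier transform. -/
theorem exists_annulus_oscDecay (V : Type*) [NormedAddCommGroup V] [InnerProductSpace ℝ V]
    [FiniteDimensional ℝ V] [MeasurableSpace V] [BorelSpace V] {β : ℝ} (hβ : 2 ≤ β) :
    ∃ χ : V → ℝ, Continuous χ ∧ HasCompactSupport χ ∧ (∀ x, 0 ≤ χ x) ∧
      (∀ x, ‖x‖ ≤ 1 / 2 → χ x = 0) ∧ (∀ x, 1 ≤ ‖x‖ → ‖x‖ ≤ 2 → 1 ≤ χ x) ∧
      OscDecay (fun x : V => ‖x‖ ^ β) χ := by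
  have hex : ∀ c : V, ∃ χ : V → ℝ, Continuous χ ∧ HasCompactSupport χ ∧ (∀ x, 0 ≤ χ x) ∧
      (∀ x, ‖x‖ ≤ 1 / 2 → χ x = 0) ∧
      (1 ≤ ‖c‖ → (∀ x ∈ Metric.ball c (1 / 8), χ x = 1) ∧ OscDecay (fun x : V => ‖x‖ ^ β) χ) := by
    intro c
    by_cases hc : 1 ≤ ‖c‖
    · obtain ⟨χ, h1, h2, h3, h0, h4, h5⟩ := exists_bump_oscDecay hβ hc
      exact ⟨χ, h1, h2, h3, h0, fun _ => ⟨h4, h5⟩⟩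
    · exact ⟨0, continuous_const, HasCompactSupport.zero, fun _ => le_rfl, fun _ _ => rfl,
        fun h => absurd h hc⟩
  choose χ hχ hχc hχ0 hχz hχ1 using hex
  have hK : IsCompact {x : V | 1 ≤ ‖x‖ ∧ ‖x‖ ≤ 2} := by
    refine (isCompact_closedBall (0 : V) 2).of_isClosed_subset ?_ fun x hx => by simpa using hx.2
    exact (isClosed_le continuous_const continuous_norm).inter
      (isClosed_le continuous_norm continuous_const)
  obtain ⟨s, hs, hcov⟩ := hK.elim_nhds_subcover (fun c => Metric.ball c (1 / 8))
    (fun c _ => Metric.ball_mem_nhds c (by norm_num))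
  refine ⟨fun x => ∑ c ∈ s, χ c x, continuous_finsetSum s fun c _ => hχ c, ?_,
    fun x => Finset.sum_nonneg fun c _ => hχ0 c x,
    fun x hx => Finset.sum_eq_zero fun c _ => hχz c x hx, fun x h1 h2 => ?_, ?_⟩
  · refine HasCompactSupport.intro (K := ⋃ c ∈ s, tsupport (χ c))
      (s.isCompact_biUnion fun c _ => hχc c) fun x hx => Finset.sum_eq_zero fun c hc => ?_
    exact image_eq_zero_of_notMem_tsupport fun h => hx (Set.mem_biUnion hc h)
  · obtain ⟨c, hc, hx⟩ := Set.mem_iUnion₂.1 (hcov ⟨h1, h2⟩)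
    rw [← (hχ1 c (hs c hc).1).1 x hx]
    exact Finset.single_le_sum (f := fun c => χ c x) (fun c _ => hχ0 c x) hc
  · exact OscDecay.sum s (Continuous.rpow_const continuous_norm fun _ => Or.inr (by linarith))
      (fun c _ => (hχ c).integrable_of_hasCompactSupport (hχc c)) fun c hc => (hχ1 c (hs c hc).1).2

end OscillatoryDecay

/-! ### The rotation group and its Haar measure -/

section Rotations
open Module
open scoped RealInnerProductSpace

variable {n : ℕ}

instance instSecondCountableSO : SecondCountableTopology (SO n) :=
  haveI : SecondCountableTopology (Matrix (Fin n) (Fin n) ℝ) :=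
    inferInstanceAs (SecondCountableTopology (Fin n → Fin n → ℝ))
  TopologicalSpace.Subtype.secondCountableTopology _

instance instIsTopologicalGroupSO : IsTopologicalGroup (SO n) where
  continuous_mul := by
    refine continuous_induced_rng.2 ?_
    exact (continuous_subtype_val.comp continuous_fst).matrix_mul
      (continuous_subtype_val.comp continuous_snd)
  continuous_inv := by
    refine continuous_induced_rng.2 ?_
    exact continuous_subtype_val.matrix_conjTranspose

theorem SO.mul_transpose (θ : SO n) : (θ : Matrix (Fin n) (Fin n) ℝ) * (θ : Matrix (Fin n) (Fin n) ℝ).transpose = 1 :=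
  (Matrix.mem_orthogonalGroup_iff _ _).1 (Matrix.mem_specialOrthogonalGroup_iff.1 θ.2).1

instance instCompactSpaceSO : CompactSpace (SO n) := by
  refine isCompact_iff_compactSpace (s := ((Matrix.specialOrthogonalGroup (Fin n) ℝ :
    Submonoid (Matrix (Fin n) (Fin n) ℝ)) : Set (Matrix (Fin n) (Fin n) ℝ))).1 ?_
  have hK : IsCompact {A : Matrix (Fin n) (Fin n) ℝ | ∀ i j, A i j ∈ Set.Icc (-1 : ℝ) 1} := by
    have := isCompact_univ_pi (fun _ : Fin n => isCompact_univ_pi fun _ : Fin n =>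
      (isCompact_Icc : IsCompact (Set.Icc (-1 : ℝ) 1)))
    refine Eq.mp (congrArg IsCompact ?_) this
    ext A
    exact ⟨fun h i j => h i trivial j trivial, fun h i _ j _ => h i j⟩
  refine hK.of_isClosed_subset ?_ fun A hA i j => ?_
  · have : ((Matrix.specialOrthogonalGroup (Fin n) ℝ : Submonoid (Matrix (Fin n) (Fin n) ℝ)) :
        Set (Matrix (Fin n) (Fin n) ℝ)) = {A | A * A.transpose = 1} ∩ {A | A.det = 1} := by
      ext A
      simp only [SetLike.mem_coe, Matrix.mem_specialOrthogonalGroup_iff,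
        Matrix.mem_orthogonalGroup_iff]
      rfl
    rw [this]
    exact (isClosed_eq (continuous_id.matrix_mul continuous_id.matrix_transpose)
      continuous_const).inter (isClosed_eq continuous_id.matrix_det continuous_const)
  · have h := congrFun (congrFun (SO.mul_transpose ⟨A, hA⟩) i) i
    simp only [Matrix.mul_apply, Matrix.transpose_apply, Matrix.one_apply_eq] at h
    have h1 : A i j * A i j ≤ 1 := by
      rw [← h]
      exact Finset.single_le_sum (f := fun k => A i k * A i k) (fun k _ => mul_self_nonneg _)
        (Finset.mem_univ j)
    exact abs_le.1 (abs_le_one_iff_mul_self_le_one.2 h1)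

/-- Compact groups are unimodular: by uniqueness a right translate of ν is a multiple of ν, and
equality of the finite total masses forces the factor 1. -/
instance (ν : Measure (SO n)) [ν.IsHaarMeasure] : ν.IsMulRightInvariant where
  map_mul_right_eq_self g := by
    have h := Measure.isMulInvariant_eq_smul_of_compactSpace (ν.map (· * g)) ν
    set c := Measure.haarScalarFactor (ν.map (· * g)) ν
    have h1 := congrArg (fun m => m Set.univ) h
    simp only [Measure.smul_apply] at h1
    rw [Measure.map_apply (measurable_mul_const g) MeasurableSet.univ, Set.preimage_univ] at h1
    have h2 : (c : ℝ≥0∞) = 1 := by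
      have h3 : (c : ℝ≥0∞) * ν Set.univ = 1 * ν Set.univ := by
        rw [one_mul]; exact h1.symm
      exact (ENNReal.mul_left_inj (NeZero.ne _) (measure_ne_top _ _)).1 h3
    rw [h, show c = 1 by exact_mod_cast h2, one_smul]

theorem rotate_mul (θ ρ : SO n) (x : E n) : rotate (θ * ρ) x = rotate θ (rotate ρ x) := by
  simp [rotate]

theorem rotate_one (x : E n) : rotate (1 : SO n) x = x := by
  simp [rotate]

theorem inner_rotate (θ : SO n) (x y : E n) : ⟪rotate θ x, rotate θ y⟫ = ⟪x, y⟫ := by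
  have h : (θ : Matrix (Fin n) (Fin n) ℝ).transpose * θ = 1 :=
    (Matrix.mem_orthogonalGroup_iff' _ _).1 (Matrix.mem_specialOrthogonalGroup_iff.1 θ.2).1
  simp only [rotate, EuclideanSpace.inner_eq_star_dotProduct, Matrix.ofLp_toEuclideanCLM, star_trivial]
  rw [Matrix.dotProduct_mulVec, Matrix.vecMul_mulVec, h, Matrix.vecMul_one]

/-- The linear isometry of a rotation. -/
def rotateEquiv (θ : SO n) : E n ≃ₗᵢ[ℝ] E n where
  toFun := rotate θ
  invFun := rotate θ⁻¹
  left_inv x := by rw [← rotate_mul, inv_mul_cancel, rotate_one]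
  right_inv x := by rw [← rotate_mul, mul_inv_cancel, rotate_one]
  map_add' x y := by simp [rotate]
  map_smul' c x := by simp [rotate]
  norm_map' x := by
    change ‖rotate θ x‖ = ‖x‖
    rw [norm_eq_sqrt_real_inner, norm_eq_sqrt_real_inner, inner_rotate]

theorem norm_rotate (θ : SO n) (x : E n) : ‖rotate θ x‖ = ‖x‖ := (rotateEquiv θ).norm_map x

theorem rotate_smul (θ : SO n) (c : ℝ) (x : E n) : rotate θ (c • x) = c • rotate θ x :=
  (rotateEquiv θ).map_smul c x

theorem inner_rotate_inv (θ : SO n) (x y : E n) : ⟪rotate θ⁻¹ x, y⟫ = ⟪x, rotate θ y⟫ := by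
  rw [← inner_rotate θ, ← rotate_mul, mul_inv_cancel, rotate_one]

theorem measurePreserving_rotate (θ : SO n) : MeasurePreserving (rotate θ : E n → E n) :=
  (rotateEquiv θ).measurePreserving

theorem continuous_rotate : Continuous fun p : SO n × E n => rotate p.1 p.2 := by
  have h : (fun p : SO n × E n => rotate p.1 p.2) = fun p => WithLp.toLp 2
      (Matrix.mulVec (p.1 : Matrix (Fin n) (Fin n) ℝ) (WithLp.ofLp p.2)) := by
    ext p i; simp [rotate, Matrix.ofLp_toEuclideanCLM]
  rw [h]
  refine (PiLp.continuous_toLp 2 _).comp ?_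
  exact (continuous_subtype_val.comp continuous_fst).matrix_mulVec
    ((PiLp.continuous_ofLp 2 _).comp continuous_snd)

theorem measurable_rotate : Measurable fun p : SO n × E n => rotate p.1 p.2 :=
  continuous_rotate.measurable

theorem measurable_rotate_inv : Measurable fun p : SO n × E n => rotate p.1⁻¹ p.2 :=
  (continuous_rotate.comp ((continuous_fst.inv).prodMk continuous_snd)).measurable

theorem exists_rotate_eq_of_isometry (F : E n ≃ₗᵢ[ℝ] E n)
    (hF : LinearMap.det (F.toLinearEquiv : E n →ₗ[ℝ] E n) = 1) : ∃ ρ : SO n, ∀ x, rotate ρ x = F x := by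
  let G : E n →L[ℝ] E n := (F.toContinuousLinearEquiv : E n →L[ℝ] E n)
  let M : Matrix (Fin n) (Fin n) ℝ := (Matrix.toEuclideanCLM (n := Fin n) (𝕜 := ℝ)).symm G
  have hM : Matrix.toEuclideanCLM (n := Fin n) (𝕜 := ℝ) M = G :=
    (Matrix.toEuclideanCLM (n := Fin n) (𝕜 := ℝ)).apply_symm_apply G
  have hdet : M.det = 1 := by
    rw [← hF]
    have h1 : (Matrix.toEuclideanLin M : E n →ₗ[ℝ] E n) = (F.toLinearEquiv : E n →ₗ[ℝ] E n) := by
      rw [← Matrix.coe_toEuclideanCLM_eq_toEuclideanLin, hM]; rfl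
    rw [← h1, show Matrix.toEuclideanLin M = Matrix.toLpLin 2 2 M from rfl,
      Matrix.toLpLin_eq_toLin, LinearMap.det_toLin]
  have horth : M ∈ Matrix.orthogonalGroup (Fin n) ℝ := by
    rw [Matrix.mem_orthogonalGroup_iff']
    have hin : ∀ x y : E n, ⟪Matrix.toEuclideanCLM (n := Fin n) (𝕜 := ℝ) M x,
        Matrix.toEuclideanCLM (n := Fin n) (𝕜 := ℝ) M y⟫ = ⟪x, y⟫ := by
      intro x y; rw [hM]; exact F.inner_map_map x y
    ext i j
    have := hin (EuclideanSpace.single i 1) (EuclideanSpace.single j 1)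
    simp only [EuclideanSpace.inner_eq_star_dotProduct, Matrix.ofLp_toEuclideanCLM, star_trivial] at this
    simp only [PiLp.ofLp_single, Matrix.mulVec_single_one] at this
    rw [Matrix.mul_apply, Matrix.one_apply]
    simp only [dotProduct, Matrix.col_apply] at this
    simp only [Matrix.transpose_apply, mul_comm (M _ i)]
    rw [this]
    simp [Pi.single_apply, eq_comm]
  refine ⟨⟨M, Matrix.mem_specialOrthogonalGroup_iff.2 ⟨horth, hdet⟩⟩, fun x => ?_⟩
  simp only [rotate]
  rw [hM]; rfl

/-- For x ≠ y, reflect x to y, then reflect in a hyperplane containing y: the product has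
determinant 1 and y stays fixed. Such a hyperplane exists because n ≥ 2. -/
theorem exists_rotate_eq (hn : 2 ≤ n) {x y : E n} (h : ‖x‖ = ‖y‖) : ∃ ρ : SO n, rotate ρ x = y := by
  rcases eq_or_ne x y with rfl | hxy
  · exact ⟨1, rotate_one x⟩
  have hdet : ∀ u : E n, u ≠ 0 →
      LinearMap.det ((Submodule.reflection (ℝ ∙ u)ᗮ).toLinearEquiv : E n →ₗ[ℝ] E n) = -1 := by
    intro u hu
    have := Submodule.det_reflection (𝕜 := ℝ) ((ℝ ∙ u)ᗮ)
    rw [Submodule.orthogonal_orthogonal, finrank_span_singleton hu, pow_one] at this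
    exact this
  obtain ⟨u, hu, huy⟩ : ∃ u : E n, u ≠ 0 ∧ ⟪u, y⟫ = 0 := by
    have h1 : 0 < finrank ℝ (ℝ ∙ y)ᗮ := by
      have h2 := (ℝ ∙ y).finrank_add_finrank_orthogonal
      have h3 := (finrank_span_le_card (R := ℝ) ({y} : Set (E n)))
      rw [Set.toFinset_singleton, Finset.card_singleton] at h3
      rw [finrank_euclideanSpace_fin] at h2
      omega
    obtain ⟨⟨u, hu⟩, hu0⟩ := finrank_pos_iff_exists_ne_zero.1 h1
    refine ⟨u, fun h => hu0 (Subtype.ext h), ?_⟩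
    rw [real_inner_comm]
    exact Submodule.mem_orthogonal_singleton_iff_inner_right.1 hu
  obtain ⟨ρ, hρ⟩ := exists_rotate_eq_of_isometry
    ((Submodule.reflection (ℝ ∙ (x - y))ᗮ).trans (Submodule.reflection (ℝ ∙ u)ᗮ)) (by
      have h1 := hdet (x - y) (sub_ne_zero.2 hxy)
      have h2 := hdet u hu
      have : (((Submodule.reflection (ℝ ∙ (x - y))ᗮ).trans
          (Submodule.reflection (ℝ ∙ u)ᗮ)).toLinearEquiv : E n →ₗ[ℝ] E n) =
          ((Submodule.reflection (ℝ ∙ u)ᗮ).toLinearEquiv : E n →ₗ[ℝ] E n) ∘ₗ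
          ((Submodule.reflection (ℝ ∙ (x - y))ᗮ).toLinearEquiv : E n →ₗ[ℝ] E n) := rfl
      rw [this, LinearMap.det_comp, h1, h2]; norm_num)
  refine ⟨ρ, ?_⟩
  rw [hρ, LinearIsometryEquiv.trans_apply, Submodule.reflection_sub h]
  exact Submodule.reflection_mem_subspace_eq_self
    (Submodule.mem_orthogonal_singleton_iff_inner_right.2 huy)

theorem lintegral_rotate_eq (hn : 2 ≤ n) (ν : Measure (SO n)) [ν.IsHaarMeasure] (h : E n → ℝ≥0∞)
    {x y : E n} (hxy : ‖x‖ = ‖y‖) : ∫⁻ θ, h (rotate θ x) ∂ν = ∫⁻ θ, h (rotate θ y) ∂ν := by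
  obtain ⟨ρ, rfl⟩ := exists_rotate_eq hn hxy
  simp_rw [← rotate_mul]
  exact (lintegral_mul_right_eq_self (fun θ => h (rotate θ x)) ρ).symm

end Rotations

/-! ### Coordinates (x', t) and averages over the sphere -/

section Splitting
open Module
open scoped RealInnerProductSpace

variable {d : ℕ}

/-- The point `(x, t)` of `ℝᵈ⁺¹`. -/
def join (x : E d) (t : ℝ) : E (d + 1) := WithLp.toLp 2 (Fin.snoc (α := fun _ => ℝ) (WithLp.ofLp x) t)

/-- The first `d` coordinates. -/
def head (x : E (d + 1)) : E d := WithLp.toLp 2 fun i => x i.castSucc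

/-- The last coordinate. -/
def last (x : E (d + 1)) : ℝ := x (Fin.last d)

theorem pointOf_eq_join (x : E d) (t : ℝ) : pointOf (n := d + 1) x t = join x t := by
  ext i
  simp only [pointOf, join, Fin.snoc]
  rfl

@[simp] theorem head_join (x : E d) (t : ℝ) : head (join x t) = x := by
  ext i; simp [head, join]

@[simp] theorem last_join (x : E d) (t : ℝ) : last (join x t) = t := by
  simp [last, join]

theorem join_head_last (x : E (d + 1)) : join (head x) (last x) = x := by
  ext i
  refine Fin.lastCases ?_ (fun j => ?_) i
  · simp [join, last]
  · simp [join, head]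

theorem inner_join (x : E d) (t : ℝ) (ξ : E (d + 1)) : ⟪join x t, ξ⟫ = ⟪x, head ξ⟫ + t * last ξ := by
  simp only [EuclideanSpace.inner_eq_star_dotProduct, star_trivial, dotProduct, Fin.sum_univ_castSucc,
    join, head, last, Fin.snoc_castSucc, Fin.snoc_last]
  ring

theorem norm_sq_eq (x : E (d + 1)) : ‖x‖ ^ 2 = ‖head x‖ ^ 2 + last x ^ 2 := by
  rw [← real_inner_self_eq_norm_sq, ← real_inner_self_eq_norm_sq]
  nth_rewrite 1 [← join_head_last x]
  rw [inner_join, sq]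

theorem norm_head_le (x : E (d + 1)) : ‖head x‖ ≤ ‖x‖ := by
  have := norm_sq_eq x
  nlinarith [norm_nonneg x, norm_nonneg (head x), sq_nonneg (last x)]

theorem abs_last_le (x : E (d + 1)) : |last x| ≤ ‖x‖ := by
  have := norm_sq_eq x
  exact abs_le_of_sq_le_sq (by nlinarith [sq_nonneg ‖head x‖]) (norm_nonneg x)

theorem norm_le_head_add_last (x : E (d + 1)) : ‖x‖ ≤ ‖head x‖ + |last x| := by
  have := norm_sq_eq x
  have h1 : |last x| ^ 2 = last x ^ 2 := sq_abs _
  nlinarith [norm_nonneg x, norm_nonneg (head x), abs_nonneg (last x)]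

theorem head_smul (c : ℝ) (x : E (d + 1)) : head (c • x) = c • head x := by
  ext i; simp [head]

theorem continuous_head : Continuous (head : E (d + 1) → E d) := by
  unfold head; fun_prop

theorem continuous_last : Continuous (last : E (d + 1) → ℝ) := by
  unfold last; fun_prop

theorem measurePreserving_join :
    MeasurePreserving (fun p : E d × ℝ => join p.1 p.2) (volume.prod volume) volume := by
  have h1 := (volume_preserving_piFinSuccAbove (fun _ : Fin (d + 1) => ℝ) (Fin.last d)).symm
  have h2 := (PiLp.volume_preserving_toLp (Fin (d + 1))).comp h1
  have h3 : MeasurePreserving (fun p : E d × ℝ => (p.2, WithLp.ofLp p.1))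
      (volume.prod volume) (volume.prod volume) :=
    ((MeasurePreserving.id volume).prod (PiLp.volume_preserving_ofLp (Fin d))).comp
      Measure.measurePreserving_swap
  have h4 : (fun p : E d × ℝ => join p.1 p.2) =
      (WithLp.toLp 2 ∘ (MeasurableEquiv.piFinSuccAbove (fun _ : Fin (d + 1) => ℝ) (Fin.last d)).symm) ∘
        fun p => (p.2, WithLp.ofLp p.1) := by
    funext p
    ext i
    refine Fin.lastCases ?_ (fun j => ?_) i
    · simp [join, MeasurableEquiv.piFinSuccAbove]
    · simp [join, MeasurableEquiv.piFinSuccAbove]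
  rw [h4]
  exact h2.comp h3

theorem lintegral_eq_lintegral_join (f : E (d + 1) → ℝ≥0∞) (hf : Measurable f) :
    ∫⁻ x, f x = ∫⁻ t : ℝ, ∫⁻ x : E d, f (join x t) := by
  rw [← measurePreserving_join.lintegral_comp hf, lintegral_prod_symm]
  exact (hf.comp measurePreserving_join.measurable).aemeasurable

theorem lintegral_one_add_mul_norm_rpow {s : ℝ} (hs : (d : ℝ) < s) {v : ℝ} (hv : 0 < v) :
    ∫⁻ z : E d, ENNReal.ofReal ((1 + v * ‖z‖) ^ (-s)) =
      ENNReal.ofReal (v ^ (-(d : ℝ))) * ∫⁻ z : E d, ENNReal.ofReal ((1 + ‖z‖) ^ (-s)) := by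
  have hint : Integrable (fun h : E d => (1 + ‖h‖) ^ (-s)) := integrable_one_add_norm (by simpa using hs)
  have h5 : ∀ z : E d, (1 + v * ‖z‖) ^ (-s) = (fun z : E d => (1 + ‖z‖) ^ (-s)) (v • z) := by
    intro z; simp [norm_smul, abs_of_pos hv]
  have h6 : Integrable fun z : E d => (1 + v * ‖z‖) ^ (-s) := by
    simp_rw [h5]; exact hint.comp_smul hv.ne'
  have h7 : ∫ z : E d, (1 + v * ‖z‖) ^ (-s) = v ^ (-(d : ℝ)) * ∫ z : E d, (1 + ‖z‖) ^ (-s) := by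
    simp_rw [h5]
    rw [Measure.integral_comp_smul_of_nonneg volume (fun z : E d => (1 + ‖z‖) ^ (-s)) v (hR := hv.le),
      finrank_euclideanSpace_fin,
      Real.rpow_neg hv.le, Real.rpow_natCast, smul_eq_mul]
  rw [← ofReal_integral_eq_lintegral_ofReal h6 (ae_of_all _ fun z => by positivity), h7,
    ENNReal.ofReal_mul (by positivity), ofReal_integral_eq_lintegral_ofReal hint
      (ae_of_all _ fun z => by positivity)]

theorem measurable_one_add_mul_norm_head_rpow (s : ℝ) {v : ℝ} (hv : 0 < v) :
    Measurable fun y : E (d + 1) => ENNReal.ofReal ((1 + v * ‖head y‖) ^ (-s)) := by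
  refine ENNReal.measurable_ofReal.comp (Continuous.measurable ?_)
  refine Continuous.rpow_const ?_ fun y => Or.inl (by positivity)
  exact continuous_const.add (continuous_const.mul continuous_head.norm)

/-- Inside the unit ball, normalizing y can only lengthen its first d coordinates. The integrand is
thus bounded by its value at y, and the ball may be enlarged to the slab |t| ≤ 1, whose width is the
factor 2. -/
theorem setLIntegral_ball_head_le {s : ℝ} (hs : (d : ℝ) < s) {v : ℝ} (hv : 0 < v) :
    ∫⁻ y in Metric.ball (0 : E (d + 1)) 1,
        ENNReal.ofReal ((1 + v * ‖head (‖y‖⁻¹ • y)‖) ^ (-s)) ≤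
      2 * (ENNReal.ofReal (v ^ (-(d : ℝ))) * ∫⁻ z : E d, ENNReal.ofReal ((1 + ‖z‖) ^ (-s))) := by
  have hk : Measurable fun y : E (d + 1) => ‖y‖⁻¹ • y := by fun_prop
  have hgk : Measurable fun y : E (d + 1) => ENNReal.ofReal ((1 + v * ‖head (‖y‖⁻¹ • y)‖) ^ (-s)) :=
    (measurable_one_add_mul_norm_head_rpow s hv).comp hk
  have e2 : ∫⁻ y in Metric.ball (0 : E (d + 1)) 1,
        ENNReal.ofReal ((1 + v * ‖head (‖y‖⁻¹ • y)‖) ^ (-s)) ≤ ∫⁻ t : ℝ, ∫⁻ z : E d,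
      (Set.Icc (-1 : ℝ) 1).indicator 1 t * ENNReal.ofReal ((1 + v * ‖z‖) ^ (-s)) := by
    rw [← lintegral_indicator measurableSet_ball, lintegral_eq_lintegral_join _
      (hgk.indicator measurableSet_ball)]
    refine lintegral_mono fun t => lintegral_mono fun z => ?_
    by_cases hz : join z t ∈ Metric.ball (0 : E (d + 1)) 1
    · have hz1 : ‖join z t‖ < 1 := by simpa using hz
      have ht : t ∈ Set.Icc (-1 : ℝ) 1 := by
        have := abs_last_le (join z t)
        rw [last_join] at this
        exact abs_le.1 (this.trans hz1.le)
      rw [Set.indicator_of_mem hz, Set.indicator_of_mem ht, Pi.one_apply, one_mul]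
      refine ENNReal.ofReal_le_ofReal ?_
      have hs0 : 0 ≤ s := (Nat.cast_nonneg d).trans hs.le
      refine Real.rpow_le_rpow_of_nonpos (by positivity) ?_ (by linarith)
      gcongr
      rw [head_smul, head_join, norm_smul, norm_inv, norm_norm]
      rcases eq_or_ne z 0 with rfl | hz0
      · simp
      have hp : 0 < ‖join z t‖ := by
        refine lt_of_lt_of_le (norm_pos_iff.2 hz0) ?_
        simpa using norm_head_le (join z t)
      rw [inv_mul_eq_div, le_div_iff₀ hp]
      exact mul_le_of_le_one_right (norm_nonneg _) hz1.le
    · rw [Set.indicator_of_notMem hz]; exact zero_le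
  refine e2.trans (le_of_eq ?_)
  have hm : Measurable fun z : E d => ENNReal.ofReal ((1 + v * ‖z‖) ^ (-s)) := by
    refine ENNReal.measurable_ofReal.comp (Continuous.measurable ?_)
    exact Continuous.rpow_const (by fun_prop) fun y => Or.inl (by positivity)
  simp_rw [lintegral_const_mul _ hm, lintegral_one_add_mul_norm_rpow hs hv]
  rw [lintegral_mul_const _ (measurable_one.indicator measurableSet_Icc),
    lintegral_indicator_one measurableSet_Icc, Real.volume_Icc]
  norm_num

theorem measurable_rotate_swap {n : ℕ} : Measurable fun p : E n × SO n => rotate p.2 p.1 :=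
  (continuous_rotate.comp (continuous_snd.prodMk continuous_fst)).measurable

/-- The average over rotations takes the same value at every unit vector, in particular at y/|y|.
Integrating over y in the ball, exchanging the integrals and rotating the ball eliminates θ. -/
theorem volume_ball_mul_lintegral_rotate (hd : 1 ≤ d) (ν : Measure (SO (d + 1))) [ν.IsHaarMeasure]
    {g : E (d + 1) → ℝ≥0∞} (hg : Measurable g) {x : E (d + 1)} (hx : ‖x‖ = 1) :
    volume (Metric.ball (0 : E (d + 1)) 1) * ∫⁻ θ, g (rotate θ x) ∂ν =
      (∫⁻ y in Metric.ball (0 : E (d + 1)) 1, g (‖y‖⁻¹ • y)) * ν Set.univ := by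
  let k : E (d + 1) → E (d + 1) := fun y => ‖y‖⁻¹ • y
  have hk : Measurable k := by fun_prop
  have h1 : ∀ y : E (d + 1), y ≠ 0 → ∫⁻ θ, g (rotate θ x) ∂ν = ∫⁻ θ, g (k (rotate θ y)) ∂ν := by
    intro y hy0
    rw [lintegral_rotate_eq (by omega) ν g (x := x) (y := k y)]
    · simp only [k, rotate_smul, norm_rotate]
    · rw [hx]; simp [k, norm_smul, hy0]
  have hr : Measurable fun p : E (d + 1) × SO (d + 1) => rotate p.2 p.1 := measurable_rotate_swap
  have hjm : Measurable fun p : E (d + 1) × SO (d + 1) => g (k (rotate p.2 p.1)) :=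
    (hg.comp hk).comp hr
  have e1 : ∀ θ : SO (d + 1), ∫⁻ y in Metric.ball (0 : E (d + 1)) 1, g (k (rotate θ y)) =
      ∫⁻ y in Metric.ball (0 : E (d + 1)) 1, g (k y) := by
    intro θ
    have hgk : Measurable fun y => g (k y) := hg.comp hk
    rw [← lintegral_indicator measurableSet_ball, ← lintegral_indicator measurableSet_ball,
      ← (measurePreserving_rotate θ).lintegral_comp (hgk.indicator measurableSet_ball)]
    refine lintegral_congr fun y => ?_
    simp only [Set.indicator, mem_ball_zero_iff, norm_rotate]
  calc volume (Metric.ball (0 : E (d + 1)) 1) * ∫⁻ θ, g (rotate θ x) ∂ν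
      = ∫⁻ y in Metric.ball (0 : E (d + 1)) 1, (∫⁻ θ, g (rotate θ x) ∂ν) := by
        rw [setLIntegral_const, mul_comm]
    _ = ∫⁻ y in Metric.ball (0 : E (d + 1)) 1, (∫⁻ θ, g (k (rotate θ y)) ∂ν) := by
        refine lintegral_congr_ae ?_
        have h0 : ∀ᵐ y : E (d + 1) ∂(volume.restrict (Metric.ball 0 1)), y ≠ 0 :=
          ae_restrict_of_ae (by simp [ae_iff])
        filter_upwards [h0] with y hy0
        exact h1 y hy0
    _ = ∫⁻ θ, (∫⁻ y in Metric.ball (0 : E (d + 1)) 1, g (k (rotate θ y))) ∂ν :=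
        lintegral_lintegral_swap hjm.aemeasurable
    _ = _ := by rw [lintegral_congr e1, lintegral_const]

/-- The integrand is concentrated where θx lies within about 1/v of the poles, a set of measure of
order v^(-d); the condition s > d controls the tails. -/
theorem exists_lintegral_rotate_head_le (hd : 1 ≤ d) (ν : Measure (SO (d + 1))) [ν.IsHaarMeasure]
    {s : ℝ} (hs : (d : ℝ) < s) :
    ∃ C : ℝ≥0, ∀ (v : ℝ) (x : E (d + 1)), 0 < v → ‖x‖ = 1 →
      ∫⁻ θ, ENNReal.ofReal ((1 + v * ‖head (rotate θ x)‖) ^ (-s)) ∂ν ≤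
        C * ENNReal.ofReal (v ^ (-(d : ℝ))) := by
  obtain ⟨S, hS⟩ : ∃ S : ℝ≥0, ∫⁻ x : E d, ENNReal.ofReal ((1 + ‖x‖) ^ (-s)) = S := by
    have hint : Integrable (fun h : E d => (1 + ‖h‖) ^ (-s)) :=
      integrable_one_add_norm (by simpa using hs)
    have h := hint.lintegral_lt_top
    exact ⟨_, (ENNReal.coe_toNNReal h.ne).symm⟩
  obtain ⟨b, hb, hb0⟩ : ∃ b : ℝ≥0, volume (Metric.ball (0 : E (d + 1)) 1) = b ∧ b ≠ 0 := by
    refine ⟨_, (ENNReal.coe_toNNReal measure_ball_lt_top.ne).symm, ?_⟩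
    rw [ENNReal.toNNReal_ne_zero]
    exact ⟨(Metric.measure_ball_pos volume 0 one_pos).ne', measure_ball_lt_top.ne⟩
  obtain ⟨a, ha⟩ : ∃ a : ℝ≥0, ν Set.univ = a := ⟨_, (ENNReal.coe_toNNReal (measure_ne_top _ _)).symm⟩
  refine ⟨b⁻¹ * (2 * S * a), fun v x hv hx => ?_⟩
  have h6 := volume_ball_mul_lintegral_rotate hd ν (measurable_one_add_mul_norm_head_rpow s hv) hx
  have h3 := setLIntegral_ball_head_le (d := d) hs hv
  rw [hS] at h3
  rw [hb, ha] at h6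
  have hb1 : (b : ℝ≥0∞) ≠ 0 := by simpa using hb0
  generalize ∫⁻ θ, ENNReal.ofReal ((1 + v * ‖head (rotate θ x)‖) ^ (-s)) ∂ν = I at h6 ⊢
  generalize ∫⁻ y in Metric.ball (0 : E (d + 1)) 1,
    ENNReal.ofReal ((1 + v * ‖head (‖y‖⁻¹ • y)‖) ^ (-s)) = J at h6 h3
  generalize ENNReal.ofReal (v ^ (-(d : ℝ))) = D at h3 ⊢
  calc I = (b : ℝ≥0∞)⁻¹ * (b * I) := by
        rw [← mul_assoc, ENNReal.inv_mul_cancel hb1 ENNReal.coe_ne_top, one_mul]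
    _ = (b : ℝ≥0∞)⁻¹ * (J * a) := by rw [h6]
    _ ≤ (b : ℝ≥0∞)⁻¹ * (2 * (D * S) * a) := by gcongr
    _ = _ := by
      rw [ENNReal.coe_mul, ENNReal.coe_mul, ENNReal.coe_mul, ENNReal.coe_inv hb0, ENNReal.coe_ofNat]
      ring

end Splitting

/-! ### Dyadic sums and uniform multiplier bounds -/

section MultiplierBounds
open Module
open scoped RealInnerProductSpace

/-- Two geometric series meet where q^k R crosses 1, and both are dominated by their terms near the
crossing, whatever R and K are. -/
theorem exists_sum_min_rpow_le {q δ ε : ℝ} (hq0 : 0 < q) (hq1 : q < 1) (hδ : 0 < δ) (hε : 0 < ε) :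
    ∃ C : ℝ, 0 < C ∧ ∀ (K : ℕ) (R : ℝ), 0 < R →
      ∑ k ∈ Finset.range K, (if 1 ≤ q ^ k * R then (q ^ k * R) ^ (-δ) else (q ^ k * R) ^ ε) ≤ C := by
  have ha1 : q ^ δ < 1 := Real.rpow_lt_one hq0.le hq1 hδ
  have hb1 : q ^ ε < 1 := Real.rpow_lt_one hq0.le hq1 hε
  have ha0 : 0 < q ^ δ := Real.rpow_pos_of_pos hq0 δ
  set a := q ^ δ
  set b := q ^ ε
  set A := a / (1 - a) with hA
  set B := 1 / (1 - b) with hB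
  have hA0 : 0 < A := div_pos ha0 (by linarith)
  have hB0 : 0 < B := div_pos one_pos (by linarith)
  have hAe : (A + 1) * a = A := by rw [hA]; field_simp [(by linarith : (1 - a) ≠ 0)]; ring
  have hBe : 1 + B * b = B := by rw [hB]; field_simp [(by linarith : (1 - b) ≠ 0)]; ring
  refine ⟨A + 1 + B, by positivity, fun K R hR => ?_⟩
  -- Induction on K with u = q^K R: before the crossing A u^(-δ) bounds the terms already summed;
  -- after it B u^ε is the full remaining geometric tail and is kept in reserve.
  have key : (1 ≤ q ^ K * R → ∑ k ∈ Finset.range K, (if 1 ≤ q ^ k * R then (q ^ k * R) ^ (-δ) else (q ^ k * R) ^ ε) ≤ A * (q ^ K * R) ^ (-δ)) ∧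
      (q ^ K * R < 1 → ∑ k ∈ Finset.range K, (if 1 ≤ q ^ k * R then (q ^ k * R) ^ (-δ) else (q ^ k * R) ^ ε) + B * (q ^ K * R) ^ ε ≤ A + 1 + B) := by
    induction K with
    | zero =>
      simp only [Finset.range_zero, Finset.sum_empty, pow_zero, one_mul, zero_add]
      refine ⟨fun _ => by positivity, fun h => ?_⟩
      have : R ^ ε ≤ 1 := Real.rpow_le_one hR.le h.le hε.le
      nlinarith
    | succ K ih =>
      obtain ⟨h1, h2⟩ := ih
      have hu0 : 0 < q ^ K * R := by positivity
      rw [Finset.sum_range_succ]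
      have e : q ^ (K + 1) * R = q * (q ^ K * R) := by ring
      rw [e]
      generalize ∑ k ∈ Finset.range K, (if 1 ≤ q ^ k * R then (q ^ k * R) ^ (-δ) else (q ^ k * R) ^ ε) = S at h1 h2 ⊢
      generalize q ^ K * R = u at h1 h2 hu0 ⊢
      have eδ : (q * u) ^ (-δ) = a⁻¹ * u ^ (-δ) := by
        rw [Real.mul_rpow hq0.le hu0.le, Real.rpow_neg hq0.le]
      have eε : (q * u) ^ ε = b * u ^ ε := Real.mul_rpow hq0.le hu0.le
      by_cases hu : 1 ≤ u
      · rw [if_pos hu]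
        have hS := h1 hu
        have hu1 : u ^ (-δ) ≤ 1 := Real.rpow_le_one_of_one_le_of_nonpos hu (by linarith)
        have hup : 0 < u ^ (-δ) := by positivity
        refine ⟨fun _ => ?_, fun h => ?_⟩
        · rw [eδ]
          have : A * (a⁻¹ * u ^ (-δ)) = (A + 1) * u ^ (-δ) := by
            nth_rewrite 1 [← hAe]; field_simp
          rw [this]; linarith
        · have : (q * u) ^ ε ≤ 1 := Real.rpow_le_one (by positivity) h.le hε.le
          nlinarith
      · rw [if_neg hu]
        have hS := h2 (not_le.1 hu)
        refine ⟨fun h => absurd h (not_le.2 ?_), fun h => ?_⟩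
        · nlinarith
        · rw [eε]
          calc S + u ^ ε + B * (b * u ^ ε) = S + (1 + B * b) * u ^ ε := by ring
            _ ≤ A + 1 + B := by rwa [hBe]
  rcases le_or_gt 1 (q ^ K * R) with h | h
  · refine (key.1 h).trans ?_
    have : (q ^ K * R) ^ (-δ) ≤ 1 := Real.rpow_le_one_of_one_le_of_nonpos h (by linarith)
    nlinarith
  · have h2 := key.2 h
    have : 0 < (q ^ K * R) ^ ε := by positivity
    nlinarith

theorem sum_range_pow_le {a : ℝ} (ha0 : 0 ≤ a) (ha1 : a < 1) (K : ℕ) :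
    ∑ k ∈ Finset.range K, a ^ k ≤ (1 - a)⁻¹ :=
  (summable_geometric_of_lt_one ha0 ha1).sum_le_tsum _ (fun _ _ => by positivity) |>.trans
    (tsum_geometric_of_lt_one ha0 ha1).le

variable {V : Type*} [NormedAddCommGroup V] [InnerProductSpace ℝ V]

/-- The sum of the dilates of `χ` to the dyadic scales `M`, `M / 2`, …, `M / 2 ^ (K - 1)`. -/
def dyadicSum (χ : V → ℝ) (M : ℝ) (K : ℕ) (x : V) : ℝ :=
  ∑ k ∈ Finset.range K, χ ((M * (1 / 2) ^ k)⁻¹ • x)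

theorem continuous_dyadicSum {χ : V → ℝ} (hχ : Continuous χ) (M : ℝ) (K : ℕ) :
    Continuous (dyadicSum χ M K) :=
  continuous_finsetSum _ fun _ _ => hχ.comp (continuous_const_smul _)

variable [FiniteDimensional ℝ V] [MeasurableSpace V] [BorelSpace V]

theorem integrable_dyadicSum {χ : V → ℝ} (hχ : Integrable χ) {M : ℝ} (hM : 0 < M) (K : ℕ) :
    Integrable (dyadicSum χ M K) :=
  integrable_finsetSum _ fun _ _ => hχ.comp_smul (by positivity)

/-- Substitution x = ry together with |ry|^β = r^β |y|^β; every scale is thereby reduced to the unit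
scale. -/
theorem oscInt_comp_smul {β r : ℝ} (hr : 0 < r) (χ : V → ℝ) (ξ : V) (t : ℝ) :
    oscInt (fun x => ‖x‖ ^ β) (fun x => χ (r⁻¹ • x)) ξ t =
      (r ^ finrank ℝ V : ℝ) * oscInt (fun x => ‖x‖ ^ β) χ (r • ξ) (r ^ β * t) := by
  unfold oscInt
  have h := Measure.integral_comp_smul (volume : Measure V) (fun x : V =>
    (Real.fourierChar (-(⟪x, ξ⟫ + ‖x‖ ^ β * t)) : ℂ) * (χ (r⁻¹ • x) : ℂ)) r
  have e : ∀ x : V, (Real.fourierChar (-(⟪r • x, ξ⟫ + ‖r • x‖ ^ β * t)) : ℂ) * (χ (r⁻¹ • r • x) : ℂ) =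
      (Real.fourierChar (-(⟪x, r • ξ⟫ + ‖x‖ ^ β * (r ^ β * t))) : ℂ) * (χ x : ℂ) := by
    intro x
    rw [inv_smul_smul₀ hr.ne', real_inner_smul_left, real_inner_smul_right, norm_smul,
      Real.norm_of_nonneg hr.le, Real.mul_rpow hr.le (norm_nonneg _)]
    congr 4
    ring
  simp_rw [e] at h
  rw [h, abs_of_pos (by positivity), Complex.real_smul, ← mul_assoc, ← Complex.ofReal_mul,
    mul_inv_cancel₀ (by positivity), Complex.ofReal_one, one_mul]

theorem oscInt_dyadicSum {β M : ℝ} (hβ : 0 ≤ β) (hM : 0 < M) {χ : V → ℝ} (hχ : Integrable χ) (K : ℕ)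
    (ξ : V) (t : ℝ) :
    oscInt (fun x => ‖x‖ ^ β) (dyadicSum χ M K) ξ t = ∑ k ∈ Finset.range K,
      (((M * (1 / 2) ^ k) ^ finrank ℝ V : ℝ) : ℂ) * oscInt (fun x => ‖x‖ ^ β) χ
        ((M * (1 / 2) ^ k) • ξ) ((M * (1 / 2) ^ k) ^ β * t) := by
  have h : ∀ k ∈ Finset.range K, Integrable fun x : V =>
      (Real.fourierChar (-(⟪x, ξ⟫ + ‖x‖ ^ β * t)) : ℂ) * (χ ((M * (1 / 2) ^ k)⁻¹ • x) : ℂ) :=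
    fun k _ => integrable_oscInt_integrand
      (Continuous.rpow_const continuous_norm fun _ => Or.inr hβ) (hχ.comp_smul (by positivity)) ξ t
  have h' : ∀ k ∈ Finset.range K, (((M * (1 / 2) ^ k) ^ finrank ℝ V : ℝ) : ℂ) *
      oscInt (fun x => ‖x‖ ^ β) χ ((M * (1 / 2) ^ k) • ξ) ((M * (1 / 2) ^ k) ^ β * t) =
      oscInt (fun x => ‖x‖ ^ β) (fun x => χ ((M * (1 / 2) ^ k)⁻¹ • x)) ξ t :=
    fun k _ => (oscInt_comp_smul (by positivity) χ ξ t).symm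
  rw [Finset.sum_congr rfl h']
  unfold oscInt dyadicSum
  rw [← integral_finsetSum _ h]
  refine integral_congr_ae (.of_forall fun x => ?_)
  beta_reduce
  push_cast
  rw [Finset.mul_sum]

theorem continuous_oscInt {φ χ : V → ℝ} (hφ : Continuous φ) (hχ : Integrable χ) :
    Continuous fun p : V × ℝ => oscInt φ χ p.1 p.2 := by
  unfold oscInt
  refine continuous_of_dominated (bound := fun x => ‖χ x‖)
    (fun p => (integrable_oscInt_integrand hφ hχ p.1 p.2).1) (fun p => .of_forall fun x => ?_)
    hχ.norm (.of_forall fun x => ?_)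
  · rw [norm_mul, Circle.norm_coe, one_mul, Complex.norm_real]
  · refine Continuous.mul ?_ continuous_const
    exact (Real.continuous_fourierChar.comp (by fun_prop)).subtype_val

theorem one_add_le_one_add_scaled {β M ρ : ℝ} (hβ : 0 ≤ β) (hM : 1 ≤ M) (hρ0 : 0 < ρ) (hρ1 : ρ ≤ 1)
    {t : ℝ} (ht : 0 ≤ t) : ρ ^ β * (1 + t) ≤ 1 + (M * ρ) ^ β * t := by
  have h1 : ρ ^ β ≤ 1 := Real.rpow_le_one hρ0.le hρ1 hβ
  have h2 : 1 ≤ M ^ β := Real.one_le_rpow hM hβ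
  have h3 : 0 < ρ ^ β := by positivity
  rw [Real.mul_rpow (by linarith) hρ0.le]
  have h4 : ρ ^ β * t ≤ M ^ β * ρ ^ β * t := by
    have : 0 ≤ ρ ^ β * t := by positivity
    nlinarith
  linarith

/-- The unscaled weight (1 + |t|)^κ is replaced by the weight (1 + (Mρ)^β |t|)^κ natural to the
scale, at the cost ρ^(-βκ). -/
theorem norm_oscInt_mul_rpow_le {β κ M ρ C : ℝ} (hβ : 0 ≤ β) (hκ0 : 0 ≤ κ) (hM : 1 ≤ M) (hρ0 : 0 < ρ)
    (hρ1 : ρ ≤ 1) {χ : V → ℝ} {N : ℕ}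
    (hC : ∀ ξ t, ‖oscInt (fun x : V => ‖x‖ ^ β) χ ξ t‖ ≤
      C * (1 + |t|) ^ (-((finrank ℝ V : ℝ) / 2)) * (1 + ‖ξ‖ / (1 + |t|)) ^ (-(N : ℝ))) (hC0 : 0 ≤ C)
    (ξ : V) (t : ℝ) :
    ‖oscInt (fun x : V => ‖x‖ ^ β) χ ((M * ρ) • ξ) ((M * ρ) ^ β * t)‖ * (1 + |t|) ^ κ ≤
      C * ρ ^ (-(β * κ)) * (1 + (M * ρ) ^ β * |t|) ^ (κ - (finrank ℝ V : ℝ) / 2) *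
        (1 + (M * ρ) * ‖ξ‖ / (1 + (M * ρ) ^ β * |t|)) ^ (-(N : ℝ)) := by
  have hM0 : 0 < M := by linarith
  have h1 := hC ((M * ρ) • ξ) ((M * ρ) ^ β * t)
  rw [norm_smul, abs_mul, Real.norm_of_nonneg (by positivity : 0 ≤ M * ρ),
    abs_of_nonneg (by positivity : 0 ≤ (M * ρ) ^ β)] at h1
  have h2 := one_add_le_one_add_scaled hβ hM hρ0 hρ1 (abs_nonneg t)
  have h3 : (1 + |t|) ^ κ ≤ ρ ^ (-(β * κ)) * (1 + (M * ρ) ^ β * |t|) ^ κ := by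
    have h4 : (ρ ^ β * (1 + |t|)) ^ κ ≤ (1 + (M * ρ) ^ β * |t|) ^ κ :=
      Real.rpow_le_rpow (by positivity) h2 hκ0
    rw [Real.mul_rpow (by positivity) (by positivity), ← Real.rpow_mul hρ0.le] at h4
    rw [Real.rpow_neg hρ0.le, inv_mul_eq_div, le_div_iff₀ (by positivity), mul_comm]
    exact h4
  set T := 1 + (M * ρ) ^ β * |t| with hT
  have hT0 : 0 < T := by positivity
  rw [show κ - (finrank ℝ V : ℝ) / 2 = -((finrank ℝ V : ℝ) / 2) + κ by ring, Real.rpow_add hT0]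
  calc _ ≤ (C * T ^ (-((finrank ℝ V : ℝ) / 2)) * (1 + M * ρ * ‖ξ‖ / T) ^ (-(N : ℝ))) *
        (ρ ^ (-(β * κ)) * T ^ κ) := by gcongr
    _ = _ := by ring

/-- The multiplier of the dyadic sum decays like `(1 + |t|) ^ (-κ)` for every `κ < d / β`. -/
theorem exists_norm_oscInt_dyadicSum_le {β κ M : ℝ} (hβ : 2 ≤ β) (hκ0 : 0 ≤ κ)
    (hκ : κ * β < finrank ℝ V) (hM : 1 ≤ M) {χ : V → ℝ} (hχ : Integrable χ)
    (hosc : OscDecay (fun x : V => ‖x‖ ^ β) χ) :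
    ∃ C : ℝ, 0 < C ∧ ∀ K ξ t,
      ‖oscInt (fun x : V => ‖x‖ ^ β) (dyadicSum χ M K) ξ t‖ * (1 + |t|) ^ κ ≤ C := by
  -- Decay in ξ is not used here, so N = 0 suffices.
  obtain ⟨C, hC0, hC⟩ := hosc 0
  have hM0 : 0 < M := by linarith
  set d := finrank ℝ V
  set a : ℝ := (1 / 2) ^ ((d : ℝ) - β * κ) with ha
  have ha0 : 0 < a := by positivity
  have ha1 : a < 1 := Real.rpow_lt_one (by norm_num) (by norm_num) (by nlinarith)
  refine ⟨M ^ d * C * (1 - a)⁻¹, mul_pos (by positivity) (inv_pos.2 (by linarith)), fun K ξ t => ?_⟩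
  rw [oscInt_dyadicSum (by linarith) hM0 hχ]
  calc _ ≤ (∑ k ∈ Finset.range K, ‖(((M * (1 / 2) ^ k) ^ d : ℝ) : ℂ) *
          oscInt (fun x => ‖x‖ ^ β) χ ((M * (1 / 2) ^ k) • ξ) ((M * (1 / 2) ^ k) ^ β * t)‖) *
          (1 + |t|) ^ κ := by
        gcongr; exact norm_sum_le _ _
    -- The dilation factor and the cost of the weight combine to ρ^(d - βκ), a convergent geometric
    -- series because κβ < d.
    _ ≤ ∑ k ∈ Finset.range K, M ^ d * C * a ^ k := by
        rw [Finset.sum_mul]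
        refine Finset.sum_le_sum fun k _ => ?_
        have hρ0 : (0 : ℝ) < (1 / 2) ^ k := by positivity
        have hρ1 : ((1 : ℝ) / 2) ^ k ≤ 1 := pow_le_one₀ (by norm_num) (by norm_num)
        have h := norm_oscInt_mul_rpow_le (by linarith) hκ0 hM hρ0 hρ1 hC hC0.le ξ t
        have e : a ^ k = (((1 : ℝ) / 2) ^ k) ^ d * (((1 : ℝ) / 2) ^ k) ^ (-(β * κ)) := by
          rw [ha, ← Real.rpow_natCast, ← Real.rpow_mul (by norm_num), ← Real.rpow_natCast _ d,
            ← Real.rpow_add hρ0, ← Real.rpow_natCast (1 / 2) k, ← Real.rpow_mul (by norm_num)]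
          ring_nf
        rw [e]
        set ρ : ℝ := (1 / 2) ^ k
        rw [norm_mul, Complex.norm_real, Real.norm_of_nonneg (by positivity), mul_assoc]
        -- The exponent is nonpositive: κβ < d and β ≥ 2 imply κ ≤ d/2.
        have h1 : (1 + (M * ρ) ^ β * |t|) ^ (κ - (d : ℝ) / 2) ≤ 1 := by
          refine Real.rpow_le_one_of_one_le_of_nonpos ?_ (by nlinarith)
          have : 0 ≤ (M * ρ) ^ β * |t| := by positivity
          linarith
        have h2 : (1 + (M * ρ) * ‖ξ‖ / (1 + (M * ρ) ^ β * |t|)) ^ (-((0 : ℕ) : ℝ)) = 1 := by simp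
        rw [h2, mul_one] at h
        calc _ ≤ (M * ρ) ^ d * (C * ρ ^ (-(β * κ)) * 1) := by
              refine mul_le_mul_of_nonneg_left (h.trans ?_) (by positivity)
              gcongr
          _ = _ := by rw [mul_pow]; ring
    _ ≤ _ := by
        rw [← Finset.mul_sum]
        gcongr
        exact sum_range_pow_le ha0.le ha1 K

/-- Boundedly many dilates overlap at a point. This is encoded by χ(x) ≤ L min(|x|, 1/|x|), which
holds since χ vanishes near 0 and far away, and by a two-sided geometric sum. -/
theorem exists_dyadicSum_le {V : Type*} [NormedAddCommGroup V] [InnerProductSpace ℝ V] {χ : V → ℝ}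
    (hχ : Continuous χ) (hχc : HasCompactSupport χ) (hχ0 : ∀ x, ‖x‖ ≤ 1 / 2 → χ x = 0) {M : ℝ}
    (hM : 0 < M) : ∃ A : ℝ, 0 < A ∧ ∀ K x, dyadicSum χ M K x ≤ A := by
  obtain ⟨C, hC⟩ := hχ.bounded_above_of_compact_support hχc
  obtain ⟨r, hr⟩ := hχc.isCompact.isBounded.exists_norm_le
  obtain ⟨B, hB0, hB⟩ := exists_sum_min_rpow_le (q := 1 / 2) (δ := 1) (ε := 1) (by norm_num)
    (by norm_num) one_pos one_pos
  have hC0 : 0 ≤ C := (norm_nonneg _).trans (hC 0)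
  set L := 2 * C + |r| * C with hL
  have hL0 : 0 ≤ L := by positivity
  have h1 : ∀ x, χ x ≤ L * ‖x‖ := by
    intro x
    rcases le_or_gt ‖x‖ (1 / 2) with h | h
    · rw [hχ0 x h]; positivity
    · calc χ x ≤ C := (le_abs_self _).trans (hC x)
        _ ≤ C * (2 * ‖x‖) := le_mul_of_one_le_right hC0 (by linarith)
        _ ≤ L * ‖x‖ := by
          have : 0 ≤ |r| * C * ‖x‖ := by positivity
          rw [hL]; linarith
  have h2 : ∀ x, χ x ≤ L * ‖x‖⁻¹ := by
    intro x
    by_cases hx : x ∈ tsupport χ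
    · rcases le_or_gt ‖x‖ (1 / 2) with h | h
      · rw [hχ0 x h]; positivity
      · have hx0 : 0 < ‖x‖ := by linarith
        rw [← div_eq_mul_inv, le_div_iff₀ hx0]
        calc χ x * ‖x‖ ≤ C * |r| := by
              refine mul_le_mul ((le_abs_self _).trans (hC x)) ((hr x hx).trans (le_abs_self _))
                hx0.le hC0
          _ ≤ L := by rw [hL]; linarith
    · rw [image_eq_zero_of_notMem_tsupport hx]; positivity
  refine ⟨L * B + 1, by positivity, fun K x => ?_⟩
  rcases eq_or_ne x 0 with rfl | hx
  · have : dyadicSum χ M K 0 = 0 := Finset.sum_eq_zero fun k _ => by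
      rw [smul_zero]; exact hχ0 0 (by simp)
    rw [this]; positivity
  have hx0 : 0 < ‖x‖ := norm_pos_iff.2 hx
  have h3 : dyadicSum χ M K x ≤ ∑ k ∈ Finset.range K, L * (if 1 ≤ (1 / 2) ^ k * (M / ‖x‖) then
      ((1 / 2) ^ k * (M / ‖x‖)) ^ (-(1 : ℝ)) else ((1 / 2) ^ k * (M / ‖x‖)) ^ (1 : ℝ)) := by
    refine Finset.sum_le_sum fun k _ => ?_
    have e : ‖(M * (1 / 2) ^ k)⁻¹ • x‖ = ((1 / 2) ^ k * (M / ‖x‖))⁻¹ := by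
      rw [norm_smul, Real.norm_of_nonneg (by positivity)]
      field_simp
    split_ifs
    · rw [Real.rpow_neg_one, ← e]; exact h1 _
    · rw [Real.rpow_one, ← inv_inv ((1 / 2) ^ k * (M / ‖x‖)), ← e]; exact h2 _
  rw [← Finset.mul_sum] at h3
  have := mul_le_mul_of_nonneg_left (hB K (M / ‖x‖) (by positivity)) hL0
  linarith

theorem dyadicSum_nonneg {V : Type*} [NormedAddCommGroup V] [InnerProductSpace ℝ V] {χ : V → ℝ}
    (hχ : ∀ x, 0 ≤ χ x) (M : ℝ) (K : ℕ) (x : V) : 0 ≤ dyadicSum χ M K x :=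
  Finset.sum_nonneg fun _ _ => hχ _

theorem exists_one_le_dyadicSum {V : Type*} [NormedAddCommGroup V] [InnerProductSpace ℝ V]
    {χ : V → ℝ} (hχ0 : ∀ x, 0 ≤ χ x) (hχ : ∀ x, 1 ≤ ‖x‖ → ‖x‖ ≤ 2 → 1 ≤ χ x) {M : ℝ} (hM : 0 < M)
    {x : V} (hx0 : x ≠ 0) (hx : ‖x‖ ≤ M) : ∃ K₀, ∀ K ≥ K₀, 1 ≤ dyadicSum χ M K x := by
  have hx0' : 0 < ‖x‖ := norm_pos_iff.2 hx0
  obtain ⟨k, hk1, hk2⟩ := exists_nat_pow_near (x := M / ‖x‖) (y := 2)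
    (by rwa [one_le_div hx0']) (by norm_num)
  rw [le_div_iff₀ hx0'] at hk1
  rw [div_lt_iff₀ hx0'] at hk2
  refine ⟨k + 2, fun K hK => ?_⟩
  have h1 : 1 ≤ χ ((M * (1 / 2) ^ (k + 1))⁻¹ • x) := by
    have e : ‖(M * (1 / 2) ^ (k + 1))⁻¹ • x‖ = 2 ^ (k + 1) * ‖x‖ / M := by
      rw [norm_smul, Real.norm_of_nonneg (by positivity)]
      simp only [one_div, inv_pow, mul_inv, inv_inv]
      ring
    refine hχ _ ?_ ?_
    · rw [e, one_le_div hM]; exact hk2.le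
    · rw [e, div_le_iff₀ hM, pow_succ]; linarith
  refine h1.trans ?_
  exact Finset.single_le_sum (f := fun k => χ ((M * (1 / 2) ^ k)⁻¹ • x)) (fun _ _ => hχ0 _)
    (Finset.mem_range.2 (by omega))

end MultiplierBounds

/-! ### The multiplier averaged over rotations -/

section AveragedMultiplier
open Module

variable {d : ℕ}

theorem exists_eLpNorm_rotate_head_le (hd : 1 ≤ d) (ν : Measure (SO (d + 1))) [ν.IsHaarMeasure]
    {a s : ℝ} (hs : 0 < s) (has : (d : ℝ) < a * s) :
    ∃ C : ℝ, 0 < C ∧ ∀ (c v : ℝ) (x : E (d + 1)) (g : SO (d + 1) → ℝ), 0 ≤ c → 0 < v → ‖x‖ = 1 →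
      (∀ θ, ‖g θ‖ ≤ c * (1 + v * ‖head (rotate θ x)‖) ^ (-a)) →
      eLpNorm g (ENNReal.ofReal s) ν ≤ ENNReal.ofReal (C * (c * v ^ (-((d : ℝ) / s)))) := by
  obtain ⟨C, hC⟩ := exists_lintegral_rotate_head_le hd ν has
  refine ⟨((C : ℝ) + 1) ^ (1 / s), by positivity, fun c v x g hc hv hx hg => ?_⟩
  have hs' : ENNReal.ofReal s ≠ 0 := by simpa using hs
  have h1 : eLpNorm (fun θ => (1 + v * ‖head (rotate θ x)‖) ^ (-a)) (ENNReal.ofReal s) ν ≤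
      ENNReal.ofReal (((C : ℝ) + 1) ^ (1 / s) * v ^ (-((d : ℝ) / s))) := by
    rw [eLpNorm_eq_lintegral_rpow_enorm_toReal hs' ENNReal.ofReal_ne_top, ENNReal.toReal_ofReal hs.le]
    have h2 : ∀ θ : SO (d + 1), ‖(1 + v * ‖head (rotate θ x)‖) ^ (-a)‖ₑ ^ s =
        ENNReal.ofReal ((1 + v * ‖head (rotate θ x)‖) ^ (-(a * s))) := by
      intro θ
      rw [← ofReal_norm, Real.norm_of_nonneg (by positivity),
        ENNReal.ofReal_rpow_of_nonneg (by positivity) hs.le, ← Real.rpow_mul (by positivity), neg_mul]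
    simp_rw [h2]
    have h3 : (C : ℝ≥0∞) * ENNReal.ofReal (v ^ (-(d : ℝ))) ≤
        ENNReal.ofReal (((C : ℝ) + 1) * v ^ (-(d : ℝ))) := by
      rw [ENNReal.ofReal_mul (by positivity)]
      gcongr
      rw [← ENNReal.ofReal_coe_nnreal]
      exact ENNReal.ofReal_le_ofReal (by linarith)
    refine (ENNReal.rpow_le_rpow ((hC v x hv hx).trans h3) (by positivity)).trans (le_of_eq ?_)
    rw [ENNReal.ofReal_rpow_of_nonneg (by positivity) (by positivity),
      Real.mul_rpow (by positivity) (by positivity), ← Real.rpow_mul hv.le]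
    congr 3
    field_simp
  calc eLpNorm g (ENNReal.ofReal s) ν
      ≤ eLpNorm (fun θ => c • (1 + v * ‖head (rotate θ x)‖) ^ (-a)) (ENNReal.ofReal s) ν :=
        eLpNorm_mono_real fun θ => by simpa using hg θ
    _ = ENNReal.ofReal c * eLpNorm (fun θ => (1 + v * ‖head (rotate θ x)‖) ^ (-a))
          (ENNReal.ofReal s) ν := by
        rw [← Real.enorm_of_nonneg hc]
        exact eLpNorm_const_smul c _ _ _
    _ ≤ ENNReal.ofReal c * ENNReal.ofReal (((C : ℝ) + 1) ^ (1 / s) * v ^ (-((d : ℝ) / s))) := by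
        gcongr
    _ = _ := by
        rw [← ENNReal.ofReal_mul hc]
        congr 1; ring

/-- Since T(1 + y/T) = T + y ≥ cS, spending δ powers of the second factor improves T^(-δ) to S^(-δ).
In the application T depends on the rotation and S does not. -/
theorem rpow_neg_mul_one_add_div_rpow_le {c y S T δ N : ℝ} (hc : 0 < c) (hy : 0 ≤ y) (hT : 1 ≤ T)
    (hTS : T ≤ S) (hS : c * S ≤ T + y) (hδ : 0 ≤ δ) (hN : δ ≤ N) :
    T ^ (-δ) * (1 + y / T) ^ (-N) ≤ c ^ (-δ) * S ^ (-δ) * (1 + y / S) ^ (-(N - δ)) := by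
  have hT0 : 0 < T := by linarith
  have hS0 : 0 < S := by linarith
  have e : (1 + y / T) ^ (-N) = (1 + y / T) ^ (-δ) * (1 + y / T) ^ (-(N - δ)) := by
    rw [← Real.rpow_add (by positivity)]; ring_nf
  rw [e, ← mul_assoc, ← Real.mul_rpow hT0.le (by positivity), ← Real.mul_rpow hc.le hS0.le]
  have e2 : T * (1 + y / T) = T + y := by field_simp
  rw [e2]
  refine mul_le_mul ?_ ?_ (by positivity) (by positivity)
  · exact Real.rpow_le_rpow_of_nonpos (by positivity) hS (by linarith)
  · refine Real.rpow_le_rpow_of_nonpos (by positivity) ?_ (by linarith)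
    gcongr

/-- For ρ ≤ 1 ≤ M and β ≥ 1 the factor (Mρ)^β exceeds Mρ at most by M^(β-1). -/
theorem scaled_norm_le_one_add {β M ρ R h t : ℝ} (hβ : 1 ≤ β) (hM : 1 ≤ M) (hρ0 : 0 < ρ) (hρ1 : ρ ≤ 1)
    (hh : 0 ≤ h) (ht : 0 ≤ t) (hR : R ≤ h + t) :
    M ^ (1 - β) * (1 + (M * ρ) ^ β * R) ≤ 1 + (M * ρ) ^ β * t + M * ρ * h := by
  have hM0 : 0 < M := by linarith
  have h1 : M ^ (1 - β) ≤ 1 := Real.rpow_le_one_of_one_le_of_nonpos hM (by linarith)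
  have h2 : M ^ (1 - β) * (M * ρ) ^ β ≤ M * ρ := by
    rw [Real.mul_rpow hM0.le hρ0.le, ← mul_assoc, ← Real.rpow_add hM0]
    have : ρ ^ β ≤ ρ := by
      simpa using Real.rpow_le_rpow_of_exponent_ge hρ0 hρ1 hβ
    simpa using mul_le_mul_of_nonneg_left this hM0.le
  have h3 : 0 < (M * ρ) ^ β := by positivity
  have h4 : 0 < M ^ (1 - β) := by positivity
  calc M ^ (1 - β) * (1 + (M * ρ) ^ β * R) ≤ M ^ (1 - β) * (1 + (M * ρ) ^ β * (h + t)) := by gcongr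
    _ = M ^ (1 - β) + M ^ (1 - β) * (M * ρ) ^ β * h + M ^ (1 - β) * ((M * ρ) ^ β * t) := by ring
    _ ≤ 1 + M * ρ * h + 1 * ((M * ρ) ^ β * t) := by gcongr
    _ = _ := by ring

theorem continuous_rotate_left {n : ℕ} (x : E n) : Continuous fun θ : SO n => rotate θ x := by
  have h : Continuous fun θ : SO n => (θ, x) := by fun_prop
  have := (continuous_rotate (n := n)).comp h
  exact this

set_option maxHeartbeats 1600000 in
/-- The multiplier of the dyadic sum, averaged over the rotations. -/
theorem exists_eLpNorm_oscInt_dyadicSum_le (hd : 1 ≤ d) (ν : Measure (SO (d + 1))) [ν.IsHaarMeasure]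
    {β s κ M : ℝ} (hβ : 2 < β) (hs : 1 < s) (hκ : κ = d / β * (1 + (β - 1) / s)) (hκd : κ < d / 2)
    (hM : 1 ≤ M) {χ : E d → ℝ} (hχ : Integrable χ)
    (hosc : OscDecay (fun x : E d => ‖x‖ ^ β) χ) :
    ∃ C : ℝ≥0, ∀ K ξ, eLpNorm (fun θ =>
      ‖oscInt (fun x : E d => ‖x‖ ^ β) (dyadicSum χ M K) (head (rotate θ ξ)) (last (rotate θ ξ))‖ *
        (1 + |last (rotate θ ξ)|) ^ κ) (ENNReal.ofReal s) ν ≤ C := by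
  have hM0 : 0 < M := by linarith
  have hs0 : 0 < s := by linarith
  have hβ0 : 0 < β := by linarith
  have hd0 : (0 : ℝ) < d := by exact_mod_cast hd
  have hκ0 : 0 < κ := by rw [hκ]; have : 0 < β - 1 := by linarith
                         positivity
  have hfin : finrank ℝ (E d) = d := finrank_euclideanSpace_fin
  -- The surplus of the available decay d/2 over κ; it sums the scales with u ≥ 1.
  set δ := (d : ℝ) / 2 - κ with hδ
  have hδ0 : 0 < δ := by rw [hδ]; linarith
  -- This exponent sums the scales with u < 1. It is positive because βε = d - d/s and s > 1.
  set ε := κ - d / s with hε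
  have hεe : β * ε = d - d / s := by rw [hε, hκ]; field_simp; ring
  have hε0 : 0 < ε := by
    have : (d : ℝ) / s < d := div_lt_self hd0 hs
    refine pos_of_mul_pos_right ?_ hβ0.le
    rw [hεe]; linarith
  -- Total exponent of ρ when u ≥ 1: d from the dilation, -βκ from the weight, and (β - 1)d/s from
  -- the rotational average. The relation between κ and s is exactly its vanishing.
  have hκe : d - β * κ + (β - 1) * (d / s) = 0 := by rw [hκ]; field_simp; ring
  -- After δ powers are spent on improving T to S, more than d/s powers must remain for the L^s
  -- average.
  obtain ⟨N, hN⟩ := exists_nat_gt (δ + d / s)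
  set a := (N : ℝ) - δ with ha
  have has : (d : ℝ) < a * s := by
    rw [← div_lt_iff₀ hs0]; linarith
  have ha0 : 0 < a := by
    have : 0 < (d : ℝ) / s := by positivity
    linarith
  obtain ⟨C₁, hC₁0, hC₁⟩ := exists_eLpNorm_rotate_head_le hd ν hs0 has
  obtain ⟨C₀, hC₀0, hC₀⟩ := hosc N
  have hC₀' := hC₀
  rw [hfin] at hC₀
  set q : ℝ := (1 / 2) ^ β with hq
  have hq0 : 0 < q := by positivity
  have hq1 : q < 1 := Real.rpow_lt_one (by norm_num) (by norm_num) hβ0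
  obtain ⟨C₂, hC₂0, hC₂⟩ := exists_sum_min_rpow_le hq0 hq1 hδ0 hε0
  obtain ⟨C₃, hC₃0, hC₃⟩ := exists_norm_oscInt_dyadicSum_le (V := E d) hβ.le le_rfl
    (by rw [hfin, zero_mul]; exact hd0) hM hχ hosc
  set B := 1 + M ^ β with hB
  have hB0 : 0 < B := by positivity
  set c := M ^ (1 - β) with hc
  have hc0 : 0 < c := by positivity
  set D₁ := M ^ d * C₀ * c ^ (-δ) * B ^ ((d : ℝ) / s) with hD₁
  set D₂ := M ^ d * C₀ * 2 ^ κ * B ^ ((d : ℝ) / s) with hD₂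
  have hD₁0 : 0 < D₁ := by positivity
  have hD₂0 : 0 < D₂ := by positivity
  set L := C₁ * (D₁ + D₂) * C₂ with hL
  have hL0 : 0 < L := by positivity
  refine ⟨(ENNReal.ofReal L + ENNReal.ofReal (C₃ * 2 ^ κ) * ν Set.univ ^ (1 / s)).toNNReal,
    fun K ξ => ?_⟩
  rw [ENNReal.coe_toNNReal (ENNReal.add_ne_top.2 ⟨ENNReal.ofReal_ne_top, ENNReal.mul_ne_top
    ENNReal.ofReal_ne_top (ENNReal.rpow_ne_top_of_nonneg (by positivity) (measure_ne_top _ _))⟩)]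
  -- For |ξ| < 1 the weight is at most 2^κ, and the plain bound with exponent 0 suffices.
  rcases lt_or_ge ‖ξ‖ 1 with hR | hR
  · refine le_trans ?_ le_add_self
    have h1 : ∀ θ : SO (d + 1), ‖‖oscInt (fun x : E d => ‖x‖ ^ β) (dyadicSum χ M K) (head (rotate θ ξ))
        (last (rotate θ ξ))‖ * (1 + |last (rotate θ ξ)|) ^ κ‖ ≤ C₃ * 2 ^ κ := by
      intro θ
      rw [Real.norm_of_nonneg (by positivity)]
      have h2 := hC₃ K (head (rotate θ ξ)) (last (rotate θ ξ))
      rw [Real.rpow_zero, mul_one] at h2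
      have h3 : |last (rotate θ ξ)| ≤ 1 := (abs_last_le _).trans (by rw [norm_rotate]; exact hR.le)
      gcongr
      linarith
    refine (eLpNorm_le_of_ae_bound (.of_forall h1)).trans (le_of_eq ?_)
    rw [ENNReal.toReal_ofReal hs0.le, mul_comm, one_div]
  · refine le_trans ?_ le_self_add
    set R := ‖ξ‖ with hRdef
    have hR0 : 0 < R := by linarith
    set ζ := R⁻¹ • ξ with hζ
    have hζ1 : ‖ζ‖ = 1 := by
      rw [hζ, norm_smul, norm_inv, Real.norm_of_nonneg hR0.le, ← hRdef, inv_mul_cancel₀ hR0.ne']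
    have hξζ : ξ = R • ζ := by rw [hζ, smul_inv_smul₀ hR0.ne']
    have hhead : ∀ θ : SO (d + 1), ‖head (rotate θ ξ)‖ = R * ‖head (rotate θ ζ)‖ := by
      intro θ
      nth_rewrite 1 [hξζ]
      rw [rotate_smul, head_smul, norm_smul, Real.norm_of_nonneg hR0.le]
    have htR : ∀ θ : SO (d + 1), |last (rotate θ ξ)| ≤ R := fun θ =>
      (abs_last_le _).trans (by rw [norm_rotate])
    have hRht : ∀ θ : SO (d + 1), R ≤ ‖head (rotate θ ξ)‖ + |last (rotate θ ξ)| := fun θ => by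
      have := norm_le_head_add_last (rotate θ ξ)
      rwa [norm_rotate] at this
    let g : ℕ → SO (d + 1) → ℝ := fun k θ => ‖(((M * (1 / 2) ^ k) ^ d : ℝ) : ℂ) *
      oscInt (fun x : E d => ‖x‖ ^ β) χ ((M * (1 / 2) ^ k) • head (rotate θ ξ))
        ((M * (1 / 2) ^ k) ^ β * last (rotate θ ξ))‖ * (1 + |last (rotate θ ξ)|) ^ κ
    have hgm : ∀ k, AEStronglyMeasurable (g k) ν := by
      intro k
      have h1 : Continuous fun θ : SO (d + 1) => ((M * (1 / 2) ^ k) • head (rotate θ ξ),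
          (M * (1 / 2) ^ k) ^ β * last (rotate θ ξ)) := by
        have h2 : Continuous fun θ : SO (d + 1) => head (rotate θ ξ) :=
          continuous_head.comp (continuous_rotate_left ξ)
        have h3 : Continuous fun θ : SO (d + 1) => last (rotate θ ξ) :=
          continuous_last.comp (continuous_rotate_left ξ)
        exact (h2.const_smul (M * (1 / 2) ^ k)).prodMk (continuous_const.mul h3)
      have h2 := (continuous_oscInt (Continuous.rpow_const (p := β) (continuous_norm (E := E d))
        fun _ => Or.inr hβ0.le) hχ).comp h1
      have h3 : Continuous fun θ : SO (d + 1) => (1 + |last (rotate θ ξ)|) ^ κ :=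
        Continuous.rpow_const (continuous_const.add
          (continuous_last.comp (continuous_rotate_left ξ)).abs) fun _ => Or.inr hκ0.le
      exact ((continuous_const.mul h2).norm.mul h3).aestronglyMeasurable
    have hterm : ∀ k, eLpNorm (g k) (ENNReal.ofReal s) ν ≤ ENNReal.ofReal (C₁ * (D₁ + D₂) *
        (if 1 ≤ q ^ k * R then (q ^ k * R) ^ (-δ) else (q ^ k * R) ^ ε)) := by
      intro k
      have hρ0 : (0 : ℝ) < (1 / 2) ^ k := by positivity
      have hρ1 : ((1 : ℝ) / 2) ^ k ≤ 1 := pow_le_one₀ (by norm_num) (by norm_num)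
      have hqρ : q ^ k = (((1 : ℝ) / 2) ^ k) ^ β := by
        rw [hq, ← Real.rpow_natCast, ← Real.rpow_mul (by norm_num), ← Real.rpow_natCast (1 / 2) k,
          ← Real.rpow_mul (by norm_num), mul_comm]
      have hgk : ∀ θ, ‖g k θ‖ = (M * (1 / 2) ^ k) ^ d * (‖oscInt (fun x : E d => ‖x‖ ^ β) χ
          ((M * (1 / 2) ^ k) • head (rotate θ ξ)) ((M * (1 / 2) ^ k) ^ β * last (rotate θ ξ))‖ *
          (1 + |last (rotate θ ξ)|) ^ κ) := by
        intro θ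
        simp only [g]
        rw [Real.norm_of_nonneg (by positivity), norm_mul, Complex.norm_real,
          Real.norm_of_nonneg (by positivity), mul_assoc]
      rw [hqρ]
      generalize ((1 : ℝ) / 2) ^ k = ρ at hρ0 hρ1 hgk ⊢
      set u := ρ ^ β * R with hu
      have hu0 : 0 < u := by positivity
      set S := 1 + (M * ρ) ^ β * R with hS
      have hSu : S = 1 + M ^ β * u := by rw [hS, Real.mul_rpow hM0.le hρ0.le, mul_assoc]
      have hS0 : 0 < S := by positivity
      split_ifs with hu1
      -- Case u ≥ 1: S is comparable to u, and the concentration parameter MρR/S is at least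
      -- ρ^(1-β)/B.
      · have hb : ∀ θ, ‖g k θ‖ ≤ ((M * ρ) ^ d * (C₀ * ρ ^ (-(β * κ)) * (c ^ (-δ) * S ^ (-δ)))) *
            (1 + M * ρ * R / S * ‖head (rotate θ ζ)‖) ^ (-a) := by
          intro θ
          rw [hgk]
          have h1 := norm_oscInt_mul_rpow_le hβ0.le hκ0.le hM hρ0 hρ1 hC₀' hC₀0.le
            (head (rotate θ ξ)) (last (rotate θ ξ))
          rw [hfin, show κ - (d : ℝ) / 2 = -δ by rw [hδ]; ring] at h1
          have ht := htR θ
          have h2 := rpow_neg_mul_one_add_div_rpow_le (c := c) (y := M * ρ * ‖head (rotate θ ξ)‖)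
            (T := 1 + (M * ρ) ^ β * |last (rotate θ ξ)|) (S := S) (δ := δ) (N := N) hc0 (by positivity)
            (by have : 0 ≤ (M * ρ) ^ β * |last (rotate θ ξ)| := by positivity
                linarith) (by rw [hS]; gcongr)
            (scaled_norm_le_one_add (by linarith) hM hρ0 hρ1 (norm_nonneg _) (abs_nonneg _) (hRht θ))
            hδ0.le (by linarith)
          have e1 : M * ρ * ‖head (rotate θ ξ)‖ / S = M * ρ * R / S * ‖head (rotate θ ζ)‖ := by
            rw [hhead]; ring
          rw [e1] at h2
          rw [mul_assoc ((M * ρ) ^ d)]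
          refine mul_le_mul_of_nonneg_left (h1.trans ?_) (by positivity)
          rw [mul_assoc (C₀ * ρ ^ (-(β * κ))), mul_assoc (C₀ * ρ ^ (-(β * κ)))]
          exact mul_le_mul_of_nonneg_left h2 (by positivity)
        refine (hC₁ _ _ ζ _ (by positivity) (by positivity) hζ1 hb).trans (ENNReal.ofReal_le_ofReal ?_)
        rw [mul_assoc C₁]
        refine mul_le_mul_of_nonneg_left ?_ hC₁0.le
        have h3 : ρ ^ (1 - β) / B ≤ M * ρ * R / S := by
          have h4 : ρ ^ (1 - β) * u = ρ * R := by
            rw [hu, ← mul_assoc, ← Real.rpow_add hρ0]; simp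
          rw [div_le_div_iff₀ hB0 hS0]
          have h5 : S ≤ B * u := by rw [hSu, hB, add_mul, one_mul]; gcongr
          calc ρ ^ (1 - β) * S ≤ ρ ^ (1 - β) * (B * u) := by gcongr
            _ = ρ * R * B := by rw [← h4]; ring
            _ ≤ M * ρ * R * B := by
              gcongr
              exact le_mul_of_one_le_left hρ0.le hM
        have h6 : (M * ρ * R / S) ^ (-((d : ℝ) / s)) ≤
            ρ ^ ((β - 1) * (d / s)) * B ^ ((d : ℝ) / s) := by
          refine (Real.rpow_le_rpow_of_nonpos (by positivity) h3
            (by have : 0 ≤ (d : ℝ) / s := by positivity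
                linarith)).trans (le_of_eq ?_)
          rw [Real.div_rpow (by positivity) hB0.le, ← Real.rpow_mul hρ0.le, Real.rpow_neg hB0.le,
            div_inv_eq_mul]
          ring_nf
        have h7 : S ^ (-δ) ≤ u ^ (-δ) := by
          refine Real.rpow_le_rpow_of_nonpos hu0 ?_ (by linarith)
          have : 1 ≤ M ^ β := Real.one_le_rpow hM hβ0.le
          rw [hSu]
          exact (le_mul_of_one_le_left hu0.le this).trans (by linarith)
        have h8 : ρ ^ (d : ℝ) * ρ ^ (-(β * κ)) * ρ ^ ((β - 1) * (d / s)) = 1 := by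
          rw [← Real.rpow_add hρ0, ← Real.rpow_add hρ0, ← sub_eq_add_neg, hκe, Real.rpow_zero]
        rw [Real.rpow_natCast] at h8
        calc (M * ρ) ^ d * (C₀ * ρ ^ (-(β * κ)) * (c ^ (-δ) * S ^ (-δ))) *
              (M * ρ * R / S) ^ (-((d : ℝ) / s))
            ≤ (M * ρ) ^ d * (C₀ * ρ ^ (-(β * κ)) * (c ^ (-δ) * u ^ (-δ))) *
              (ρ ^ ((β - 1) * (d / s)) * B ^ ((d : ℝ) / s)) := by gcongr
          _ = D₁ * u ^ (-δ) * (ρ ^ d * ρ ^ (-(β * κ)) * ρ ^ ((β - 1) * (d / s))) := by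
              rw [hD₁, mul_pow]; ring
          _ = D₁ * u ^ (-δ) := by rw [h8, mul_one]
          _ ≤ (D₁ + D₂) * u ^ (-δ) := by gcongr; linarith
      -- Case u < 1: S is bounded, so there is no useful decay in t. Only the decay in ξ' is used,
      -- with (1 + |t|)^κ ≤ (2R)^κ; averaging gives (ρR)^(-d/s), and the product is a multiple of
      -- u^ε.
      · have hu1' : u ≤ 1 := (not_le.1 hu1).le
        have hSB : S ≤ B := by
          rw [hSu, hB]
          gcongr
          exact mul_le_of_le_one_right (by positivity) hu1'
        have hb : ∀ θ, ‖g k θ‖ ≤ ((M * ρ) ^ d * (C₀ * (2 * R) ^ κ)) *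
            (1 + ρ * R / B * ‖head (rotate θ ζ)‖) ^ (-a) := by
          intro θ
          rw [hgk]
          have h1 := hC₀ ((M * ρ) • head (rotate θ ξ)) ((M * ρ) ^ β * last (rotate θ ξ))
          have ht := htR θ
          rw [norm_smul, abs_mul, Real.norm_of_nonneg (by positivity : 0 ≤ M * ρ),
            abs_of_nonneg (by positivity : 0 ≤ (M * ρ) ^ β)] at h1
          have hT1 : 1 ≤ 1 + (M * ρ) ^ β * |last (rotate θ ξ)| := by
            have : 0 ≤ (M * ρ) ^ β * |last (rotate θ ξ)| := by positivity
            linarith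
          have hTB : 1 + (M * ρ) ^ β * |last (rotate θ ξ)| ≤ B := by
            refine le_trans ?_ hSB
            rw [hS]; gcongr
          have h2 : (1 + (M * ρ) ^ β * |last (rotate θ ξ)|) ^ (-((d : ℝ) / 2)) ≤ 1 :=
            Real.rpow_le_one_of_one_le_of_nonpos hT1 (by linarith)
          have h3 : (1 + M * ρ * ‖head (rotate θ ξ)‖ / (1 + (M * ρ) ^ β * |last (rotate θ ξ)|)) ^
              (-(N : ℝ)) ≤ (1 + ρ * R / B * ‖head (rotate θ ζ)‖) ^ (-a) := by
            have h4 : 1 + ρ * R / B * ‖head (rotate θ ζ)‖ ≤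
                1 + M * ρ * ‖head (rotate θ ξ)‖ / (1 + (M * ρ) ^ β * |last (rotate θ ξ)|) := by
              have e : ρ * R / B * ‖head (rotate θ ζ)‖ = 1 * ρ * ‖head (rotate θ ξ)‖ / B := by
                rw [hhead]; ring
              rw [e]
              gcongr
            have h5 : 0 ≤ ρ * R / B * ‖head (rotate θ ζ)‖ := by positivity
            refine (Real.rpow_le_rpow_of_nonpos (by linarith) h4 (by simp)).trans ?_
            exact Real.rpow_le_rpow_of_exponent_le (by linarith) (by linarith)
          have h6 : (1 + |last (rotate θ ξ)|) ^ κ ≤ (2 * R) ^ κ := by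
            gcongr; linarith
          rw [mul_assoc ((M * ρ) ^ d)]
          refine mul_le_mul_of_nonneg_left ?_ (by positivity)
          calc _ ≤ (C₀ * 1 * (1 + ρ * R / B * ‖head (rotate θ ζ)‖) ^ (-a)) * (2 * R) ^ κ := by
                refine mul_le_mul (h1.trans ?_) h6 (by positivity) (by positivity)
                gcongr
            _ = _ := by ring
        refine (hC₁ _ _ ζ _ (by positivity) (by positivity) hζ1 hb).trans (ENNReal.ofReal_le_ofReal ?_)
        rw [mul_assoc C₁]
        refine mul_le_mul_of_nonneg_left ?_ hC₁0.le
        have h7 : u ^ ε = ρ ^ ((d : ℝ) - d / s) * R ^ ε := by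
          rw [hu, Real.mul_rpow (by positivity) hR0.le, ← Real.rpow_mul hρ0.le, hεe]
        have h8 : (ρ * R / B) ^ (-((d : ℝ) / s)) =
            ρ ^ (-((d : ℝ) / s)) * R ^ (-((d : ℝ) / s)) * B ^ ((d : ℝ) / s) := by
          rw [Real.div_rpow (by positivity) hB0.le, Real.mul_rpow hρ0.le hR0.le, Real.rpow_neg hB0.le,
            div_inv_eq_mul]
        calc (M * ρ) ^ d * (C₀ * (2 * R) ^ κ) * (ρ * R / B) ^ (-((d : ℝ) / s))
            = D₂ * u ^ ε := by
              rw [h7, h8, hD₂, mul_pow, Real.mul_rpow (by norm_num) hR0.le, sub_eq_add_neg,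
                Real.rpow_add hρ0, Real.rpow_natCast, hε, sub_eq_add_neg, Real.rpow_add hR0]
              ring
          _ ≤ (D₁ + D₂) * u ^ ε := by gcongr; linarith
    calc _ ≤ eLpNorm (∑ k ∈ Finset.range K, g k) (ENNReal.ofReal s) ν := by
          refine eLpNorm_mono_real fun θ => ?_
          rw [Real.norm_of_nonneg (by positivity), oscInt_dyadicSum hβ0.le hM0 hχ, Finset.sum_apply,
            hfin, ← Finset.sum_mul]
          gcongr
          exact norm_sum_le _ _
      _ ≤ ∑ k ∈ Finset.range K, eLpNorm (g k) (ENNReal.ofReal s) ν :=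
          eLpNorm_sum_le (fun k _ => hgm k) (by simpa using hs.le)
      _ ≤ ∑ k ∈ Finset.range K, ENNReal.ofReal (C₁ * (D₁ + D₂) *
          (if 1 ≤ q ^ k * R then (q ^ k * R) ^ (-δ) else (q ^ k * R) ^ ε)) :=
          Finset.sum_le_sum fun k _ => hterm k
      _ ≤ ENNReal.ofReal L := by
          rw [← ENNReal.ofReal_sum_of_nonneg]
          · refine ENNReal.ofReal_le_ofReal ?_
            rw [← Finset.mul_sum, hL]
            exact mul_le_mul_of_nonneg_left (hC₂ K R hR0) (by positivity)
          · intro k _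
            split_ifs <;> positivity

end AveragedMultiplier

/-! ### The analytic family and its two boundary estimates -/

section AnalyticFamily
open Module FourierTransform
open scoped RealInnerProductSpace

/-- `F` is bounded by `C` and vanishes outside the closed ball of radius `R`. -/
def BoundedOnBall {X : Type*} [NormedAddCommGroup X] (C R : ℝ) (F : X → ℂ) : Prop :=
  ∀ x, ‖F x‖ ≤ (Metric.closedBall (0 : X) R).indicator (fun _ => C) x

variable {X : Type*} [NormedAddCommGroup X] [InnerProductSpace ℝ X] [FiniteDimensional ℝ X]
  [MeasurableSpace X] [BorelSpace X]

theorem integrable_indicator_closedBall (C R : ℝ) :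
    Integrable ((Metric.closedBall (0 : X) R).indicator fun _ => C) :=
  (integrable_indicator_iff Metric.isClosed_closedBall.measurableSet).2
    (integrableOn_const (hs := measure_closedBall_lt_top.ne))

theorem BoundedOnBall.integrable {C R : ℝ} {F : X → ℂ} (hF : BoundedOnBall C R F)
    (hFm : Measurable F) : Integrable F :=
  (integrable_indicator_closedBall C R).mono' hFm.aestronglyMeasurable (.of_forall hF)

theorem BoundedOnBall.memLp {C R : ℝ} {F : X → ℂ} (hF : BoundedOnBall C R F) (hFm : Measurable F)
    (p : ℝ≥0∞) : MemLp F p := by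
  refine MemLp.of_le (memLp_indicator_const p Metric.isClosed_closedBall.measurableSet C
    (Or.inr (measure_closedBall_lt_top (x := (0 : X)) (r := R)).ne)) hFm.aestronglyMeasurable
    (.of_forall fun x => (hF x).trans (le_abs_self _))

theorem measurable_fourierInv_section {Ω : Type*} [MeasurableSpace Ω] {G : Ω × X → ℂ}
    (hG : Measurable G) : Measurable fun p : Ω × X => 𝓕⁻ (fun x => G (p.1, x)) p.2 := by
  have h : StronglyMeasurable fun q : (Ω × X) × X =>
      (Real.fourierChar ⟪q.2, q.1.2⟫ : ℂ) * G (q.1.1, q.2) := by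
    refine Measurable.stronglyMeasurable (Measurable.mul ?_ ?_)
    · have h1 : Continuous fun t : ℝ => (Real.fourierChar t : ℂ) :=
        Real.continuous_fourierChar.subtype_val
      have h2 : Measurable fun q : (Ω × X) × X => ⟪q.2, q.1.2⟫ :=
        measurable_snd.inner (measurable_snd.comp measurable_fst)
      exact h1.measurable.comp h2
    · exact hG.comp ((measurable_fst.comp measurable_fst).prodMk measurable_snd)
  have h' := h.integral_prod_right' (ν := volume)
  convert h'.measurable using 2 with p
  rw [Real.fourierInv_eq]
  simp only [Circle.smul_def, smul_eq_mul]

variable {d : ℕ}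

/-- The Fourier transform of the measure `η dy` on the graph of `φ`, rotated by `θ⁻¹`. -/
def symbol (φ η : E d → ℝ) (θ : SO (d + 1)) (ξ : E (d + 1)) : ℂ :=
  oscInt φ η (head (rotate θ ξ)) (last (rotate θ ξ))

/-- The symbol of `1 + ∂ / ∂xₙ`, rotated by `θ⁻¹`. -/
def base (θ : SO (d + 1)) (ξ : E (d + 1)) : ℂ :=
  1 + 2 * Real.pi * last (rotate θ ξ) * Complex.I

theorem re_base (θ : SO (d + 1)) (ξ : E (d + 1)) : (base θ ξ).re = 1 := by
  simp [base]

theorem im_base (θ : SO (d + 1)) (ξ : E (d + 1)) : (base θ ξ).im = 2 * Real.pi * last (rotate θ ξ) := by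
  simp [base]

theorem one_le_norm_base (θ : SO (d + 1)) (ξ : E (d + 1)) : 1 ≤ ‖base θ ξ‖ := by
  simpa [re_base] using Complex.abs_re_le_norm (base θ ξ)

theorem base_ne_zero (θ : SO (d + 1)) (ξ : E (d + 1)) : base θ ξ ≠ 0 :=
  norm_pos_iff.1 (one_pos.trans_le (one_le_norm_base θ ξ))

theorem norm_base_le (θ : SO (d + 1)) (ξ : E (d + 1)) :
    ‖base θ ξ‖ ≤ 2 * Real.pi * (1 + |last (rotate θ ξ)|) := by
  have h := Complex.norm_le_abs_re_add_abs_im (base θ ξ)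
  rw [re_base, im_base, abs_mul, abs_of_pos Real.two_pi_pos, abs_one] at h
  have := Real.pi_gt_three
  linarith

/-- The base has real part 1, so its argument is at most π/2 in modulus and the power grows at most
like exp(π|Im z|/2). -/
theorem norm_base_cpow_le (θ : SO (d + 1)) (ξ : E (d + 1)) (z : ℂ) :
    ‖base θ ξ ^ (-z)‖ ≤ ‖base θ ξ‖ ^ (-z.re) * Real.exp (Real.pi / 2 * |z.im|) := by
  rw [Complex.norm_cpow_of_ne_zero (base_ne_zero θ ξ), Complex.neg_re, Complex.neg_im, div_eq_mul_inv,
    ← Real.exp_neg]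
  gcongr
  have h1 : |Complex.arg (base θ ξ)| ≤ Real.pi / 2 :=
    Complex.abs_arg_le_pi_div_two_iff.2 (by rw [re_base]; exact zero_le_one)
  rw [mul_neg, neg_neg]
  calc Complex.arg (base θ ξ) * z.im ≤ |Complex.arg (base θ ξ) * z.im| := le_abs_self _
    _ ≤ _ := by rw [abs_mul]; gcongr

theorem measurable_symbol {φ η : E d → ℝ} (hφ : Continuous φ) (hη : Integrable η) :
    Measurable fun p : SO (d + 1) × E (d + 1) => symbol φ η p.1 p.2 := by
  have h1 : Measurable fun p : SO (d + 1) × E (d + 1) => head (rotate p.1 p.2) :=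
    continuous_head.measurable.comp measurable_rotate
  have h2 : Measurable fun p : SO (d + 1) × E (d + 1) => last (rotate p.1 p.2) :=
    continuous_last.measurable.comp measurable_rotate
  have h3 := (continuous_oscInt hφ hη).measurable.comp (h1.prodMk h2)
  exact h3

theorem measurable_base : Measurable fun p : SO (d + 1) × E (d + 1) => base p.1 p.2 := by
  have h1 : Measurable fun p : SO (d + 1) × E (d + 1) => last (rotate p.1 p.2) :=
    continuous_last.measurable.comp measurable_rotate
  unfold base
  fun_prop

/-- The integrand of `pairing`. -/
def pairingIntegrand (φ η : E d → ℝ) (F : E (d + 1) → ℂ) (G : SO (d + 1) × E (d + 1) → ℂ) (z : ℂ)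
    (p : SO (d + 1) × E (d + 1)) : ℂ :=
  𝓕 F p.2 * (symbol φ η p.1 p.2 * base p.1 p.2 ^ (-z)) * 𝓕⁻ (fun x => G (p.1, x)) p.2

/-- The bilinear form of the analytic family of operators with multipliers
`symbol * base ^ (-z)`. -/
def pairing (W : Measure (SO (d + 1))) (φ η : E d → ℝ) (F : E (d + 1) → ℂ)
    (G : SO (d + 1) × E (d + 1) → ℂ) (z : ℂ) : ℂ :=
  ∫ p, pairingIntegrand φ η F G z p ∂(W.prod volume)

/-- A majorant of `pairingIntegrand` in the half plane `-κ ≤ re z`. -/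
def pairingMajorant (φ η : E d → ℝ) (κ : ℝ) (F : E (d + 1) → ℂ) (G : SO (d + 1) × E (d + 1) → ℂ)
    (p : SO (d + 1) × E (d + 1)) : ℝ :=
  ‖𝓕 F p.2‖ * (‖symbol φ η p.1 p.2‖ * ‖base p.1 p.2‖ ^ κ) * ‖𝓕⁻ (fun x => G (p.1, x)) p.2‖

theorem norm_pairingIntegrand_le (φ η : E d → ℝ) {κ : ℝ} (F : E (d + 1) → ℂ)
    (G : SO (d + 1) × E (d + 1) → ℂ) {z : ℂ} (hz : -κ ≤ z.re) (p : SO (d + 1) × E (d + 1)) :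
    ‖pairingIntegrand φ η F G z p‖ ≤
      Real.exp (Real.pi / 2 * |z.im|) * pairingMajorant φ η κ F G p := by
  unfold pairingIntegrand pairingMajorant
  rw [norm_mul, norm_mul, norm_mul]
  have h := norm_base_cpow_le p.1 p.2 z
  have h1 : ‖base p.1 p.2‖ ^ (-z.re) ≤ ‖base p.1 p.2‖ ^ κ :=
    Real.rpow_le_rpow_of_exponent_le (one_le_norm_base _ _) (by linarith)
  calc _ ≤ ‖𝓕 F p.2‖ * (‖symbol φ η p.1 p.2‖ * (‖base p.1 p.2‖ ^ κ *
        Real.exp (Real.pi / 2 * |z.im|))) * ‖𝓕⁻ (fun x => G (p.1, x)) p.2‖ := by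
        gcongr
        exact h.trans (by gcongr)
    _ = _ := by ring

theorem measurable_pairingIntegrand {φ η : E d → ℝ} (hφ : Continuous φ) (hη : Integrable η)
    {F : E (d + 1) → ℂ} (hF : Integrable F) {G : SO (d + 1) × E (d + 1) → ℂ} (hG : Measurable G)
    (z : ℂ) : Measurable (pairingIntegrand φ η F G z) := by
  refine Measurable.mul (Measurable.mul ?_ ?_) (measurable_fourierInv_section hG)
  · exact (continuous_fourier hF).measurable.comp measurable_snd
  · exact (measurable_symbol hφ hη).mul (measurable_base.pow_const _)

theorem measurable_pairingMajorant {φ η : E d → ℝ} (hφ : Continuous φ) (hη : Integrable η) (κ : ℝ)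
    {F : E (d + 1) → ℂ} (hF : Integrable F) {G : SO (d + 1) × E (d + 1) → ℂ} (hG : Measurable G) :
    Measurable (pairingMajorant φ η κ F G) := by
  refine Measurable.mul (Measurable.mul ?_ ?_) (measurable_fourierInv_section hG).norm
  · exact ((continuous_fourier hF).measurable.comp measurable_snd).norm
  · exact (measurable_symbol hφ hη).norm.mul (measurable_base.norm.pow_const _)

/-- The L² endpoint. After Cauchy–Schwarz in (θ, ξ), the multiplier is integrated in θ first, which
uses only the averaged bound; Plancherel is then applied to F and to G(θ, ·) for each θ. -/
theorem lintegral_pairingMajorant_le (W : Measure (SO (d + 1))) [SFinite W] {φ η : E d → ℝ}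
    (hφ : Continuous φ) (hη : Integrable η) {κ : ℝ}
    (hm : ∀ ξ, ∫⁻ θ, ENNReal.ofReal (‖symbol φ η θ ξ‖ * ‖base θ ξ‖ ^ κ) ^ 2 ∂W ≤ 1)
    {F : E (d + 1) → ℂ} (hF : Integrable F) (hF2 : MemLp F 2) {G : SO (d + 1) × E (d + 1) → ℂ}
    (hG : Measurable G) (hG1 : ∀ θ, Integrable fun x => G (θ, x))
    (hG2 : ∀ θ, MemLp (fun x => G (θ, x)) 2) :
    ∫⁻ p, ENNReal.ofReal (pairingMajorant φ η κ F G p) ∂(W.prod volume) ≤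
      (∫⁻ x, ‖F x‖ₑ ^ 2) ^ (1 / 2 : ℝ) * (∫⁻ p, ‖G p‖ₑ ^ 2 ∂(W.prod volume)) ^ (1 / 2 : ℝ) := by
  let w : SO (d + 1) × E (d + 1) → ℝ≥0∞ := fun p =>
    ENNReal.ofReal (‖symbol φ η p.1 p.2‖ * ‖base p.1 p.2‖ ^ κ)
  have hw : Measurable w :=
    ((measurable_symbol hφ hη).norm.mul (measurable_base.norm.pow_const _)).ennreal_ofReal
  have hFm : Measurable fun p : SO (d + 1) × E (d + 1) => ‖𝓕 F p.2‖ₑ :=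
    ((continuous_fourier hF).measurable.comp measurable_snd).enorm
  have hGm : Measurable fun p : SO (d + 1) × E (d + 1) => ‖𝓕⁻ (fun x => G (p.1, x)) p.2‖ₑ :=
    (measurable_fourierInv_section hG).enorm
  have h1 : ∀ p, ENNReal.ofReal (pairingMajorant φ η κ F G p) =
      ((fun p : SO (d + 1) × E (d + 1) => ‖𝓕 F p.2‖ₑ * w p) *
        fun p : SO (d + 1) × E (d + 1) => ‖𝓕⁻ (fun x => G (p.1, x)) p.2‖ₑ) p := by
    intro p
    simp only [pairingMajorant, Pi.mul_apply, w]
    rw [ENNReal.ofReal_mul (by positivity), ENNReal.ofReal_mul (by positivity), ofReal_norm, ofReal_norm]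
  simp_rw [h1]
  refine (ENNReal.lintegral_mul_le_Lp_mul_Lq _ Real.HolderConjugate.two_two
    (hFm.mul hw).aemeasurable hGm.aemeasurable).trans ?_
  simp only [ENNReal.rpow_ofNat]
  refine mul_le_mul' (ENNReal.rpow_le_rpow ?_ (by norm_num)) (ENNReal.rpow_le_rpow ?_ (by norm_num))
  · rw [lintegral_prod_symm _ ((hFm.mul hw).pow_const 2).aemeasurable]
    have h2 : ∀ ξ, ∫⁻ θ, (‖𝓕 F ξ‖ₑ * w (θ, ξ)) ^ 2 ∂W ≤ ‖𝓕 F ξ‖ₑ ^ 2 := by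
      intro ξ
      simp_rw [mul_pow]
      have hw' : Measurable fun θ => w (θ, ξ) := hw.comp (measurable_id.prodMk measurable_const)
      rw [lintegral_const_mul _ (hw'.pow_const 2)]
      exact mul_le_of_le_one_right zero_le (hm ξ)
    refine (lintegral_mono h2).trans (le_of_eq ?_)
    rw [← lintegral_enorm_sq_eq, ← lintegral_enorm_sq_eq, eLpNorm_fourier hF hF2]
  · rw [lintegral_prod _ (hGm.pow_const 2).aemeasurable,
      lintegral_prod _ (hG.enorm.pow_const 2).aemeasurable]
    refine lintegral_mono fun θ => le_of_eq ?_
    beta_reduce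
    rw [← lintegral_enorm_sq_eq, ← lintegral_enorm_sq_eq, eLpNorm_fourierInv (hG1 θ) (hG2 θ)]

theorem fourier_graph_translate (φ η : E d → ℝ) (θ : SO (d + 1)) (ξ : E (d + 1)) :
    ∫ y, (Real.fourierChar (-⟪rotate θ⁻¹ (join y (φ y)), ξ⟫) : ℂ) * (η y : ℂ) = symbol φ η θ ξ := by
  unfold symbol oscInt
  simp_rw [inner_rotate_inv, inner_join]

/-- The phase splits into a part on the graph and a part in the vertical displacement, so the double
integral is a product. -/
theorem fourier_graph_translate_gammaKernel (φ η : E d → ℝ) (θ : SO (d + 1)) (ξ : E (d + 1)) {z : ℂ}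
    (hz : 0 < z.re) :
    ∫ q : E d × ℝ, (Real.fourierChar (-⟪rotate θ⁻¹ (join q.1 (φ q.1 + q.2)), ξ⟫) : ℂ) *
      ((η q.1 : ℂ) * gammaKernel z q.2) = symbol φ η θ ξ * base θ ξ ^ (-z) := by
  have h : ∀ q : E d × ℝ, (Real.fourierChar (-⟪rotate θ⁻¹ (join q.1 (φ q.1 + q.2)), ξ⟫) : ℂ) *
      ((η q.1 : ℂ) * gammaKernel z q.2) =
      ((Real.fourierChar (-(⟪q.1, head (rotate θ ξ)⟫ + φ q.1 * last (rotate θ ξ))) : ℂ) * (η q.1 : ℂ)) *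
        ((Real.fourierChar (-(q.2 * last (rotate θ ξ))) : ℂ) * gammaKernel z q.2) := by
    intro q
    rw [inner_rotate_inv, inner_join, show -(⟪q.1, head (rotate θ ξ)⟫ +
      (φ q.1 + q.2) * last (rotate θ ξ)) = -(⟪q.1, head (rotate θ ξ)⟫ + φ q.1 * last (rotate θ ξ)) +
        -(q.2 * last (rotate θ ξ)) by ring, AddChar.map_add_eq_mul, Circle.coe_mul]
    ring
  simp_rw [h]
  have h2 := integral_prod_mul (μ := (volume : Measure (E d))) (ν := (volume : Measure ℝ))
    (fun y => (Real.fourierChar (-(⟪y, head (rotate θ ξ)⟫ + φ y * last (rotate θ ξ))) : ℂ) * (η y : ℂ))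
    (fun t => (Real.fourierChar (-(t * last (rotate θ ξ))) : ℂ) * gammaKernel z t)
  rw [integral_fourierChar_mul_gammaKernel hz] at h2
  exact h2

theorem measurable_join : Measurable fun p : E d × ℝ => join p.1 p.2 :=
  measurePreserving_join.measurable

theorem measurable_rotate_const (θ : SO (d + 1)) : Measurable (rotate θ : E (d + 1) → E (d + 1)) :=
  (measurePreserving_rotate θ).measurable

/-- The value of the analytic family at `0`. -/
theorem pairing_zero (W : Measure (SO (d + 1))) [SFinite W] {φ η : E d → ℝ} (hφ : Continuous φ)
    (hη : Integrable η) {F : E (d + 1) → ℂ} (hFm : Measurable F) (hF : Integrable F) (hF2 : MemLp F 2)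
    {G : SO (d + 1) × E (d + 1) → ℂ} (hG : Measurable G) (hG1 : ∀ θ, Integrable fun x => G (θ, x))
    (hG2 : ∀ θ, MemLp (fun x => G (θ, x)) 2)
    (hint : Integrable (pairingIntegrand φ η F G 0) (W.prod volume)) :
    pairing W φ η F G 0 =
      ∫ θ, (∫ x, (∫ y, (η y : ℂ) * F (x - rotate θ⁻¹ (join y (φ y)))) * G (θ, x)) ∂W := by
  unfold pairing
  rw [integral_prod _ hint]
  refine integral_congr_ae (.of_forall fun θ => ?_)
  have hγ : Measurable fun y : E d => rotate θ⁻¹ (join y (φ y)) :=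
    (measurable_rotate_const θ⁻¹).comp (measurable_join.comp (measurable_id.prodMk hφ.measurable))
  have h := integral_translate_mul_eq hγ (ρ := volume) (h := fun y => (η y : ℂ)) hη.ofReal hFm hF hF2
    (hG.comp measurable_prodMk_left) (hG1 θ) (hG2 θ)
  beta_reduce
  refine Eq.trans ?_ h.symm
  refine integral_congr_ae (.of_forall fun ξ => ?_)
  beta_reduce
  rw [fourier_graph_translate]
  simp only [pairingIntegrand, neg_zero, Complex.cpow_zero, mul_one]
  rfl

/-- The shear (y, t) ↦ (y, φ(y) + t) preserves Lebesgue measure. The smeared surface measure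
therefore has a density on ℝⁿ bounded by A times the bound of the Gamma kernel. -/
theorem enorm_integral_gammaKernel_le {φ η : E d → ℝ} (hφ : Measurable φ) {A : ℝ}
    (hA : ∀ y, |η y| ≤ A) {F : E (d + 1) → ℂ} (hFm : Measurable F) (θ : SO (d + 1)) (τ : ℝ)
    (x : E (d + 1)) :
    ‖∫ q : E d × ℝ, ((η q.1 : ℂ) * gammaKernel (1 + τ * Complex.I) q.2) *
      F (x - rotate θ⁻¹ (join q.1 (φ q.1 + q.2)))‖ₑ ≤
      ENNReal.ofReal (A * Real.exp (Real.pi * |τ|)) * ∫⁻ x, ‖F x‖ₑ := by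
  have hA0 : 0 ≤ A := (abs_nonneg _).trans (hA 0)
  have hmp : MeasurePreserving (fun q : E d × ℝ => (q.1, φ q.1 + q.2)) (volume.prod volume)
      (volume.prod volume) := by
    refine (MeasurePreserving.id volume).skew_product (g := fun y t => φ y + t) ?_
      (.of_forall fun y => (measurePreserving_add_left volume (φ y)).map_eq)
    exact (hφ.comp measurable_fst).add measurable_snd
  have hmp2 := (measurePreserving_rotate θ⁻¹).comp (measurePreserving_join.comp hmp)
  calc _ ≤ ∫⁻ q : E d × ℝ, ‖((η q.1 : ℂ) * gammaKernel (1 + τ * Complex.I) q.2) *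
      F (x - rotate θ⁻¹ (join q.1 (φ q.1 + q.2)))‖ₑ := enorm_integral_le_lintegral_enorm _
    _ ≤ ∫⁻ q : E d × ℝ, ENNReal.ofReal (A * Real.exp (Real.pi * |τ|)) *
      ‖F (x - rotate θ⁻¹ (join q.1 (φ q.1 + q.2)))‖ₑ := by
        refine lintegral_mono fun q => ?_
        rw [enorm_mul]
        gcongr
        rw [← ofReal_norm]
        refine ENNReal.ofReal_le_ofReal ?_
        rw [norm_mul, Complex.norm_real]
        exact mul_le_mul (hA _) (norm_gammaKernel_le τ _) (norm_nonneg _) hA0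
    _ = _ := by
        have hF' : Measurable fun y => ‖F (x - y)‖ₑ := (hFm.comp (measurable_const.sub measurable_id)).enorm
        have h2 : Measurable fun q : E d × ℝ => ‖F (x - rotate θ⁻¹ (join q.1 (φ q.1 + q.2)))‖ₑ :=
          hF'.comp hmp2.measurable
        rw [lintegral_const_mul _ h2]
        congr 1
        have := hmp2.lintegral_comp hF'
        rw [← lintegral_sub_left_eq_self (fun y => ‖F y‖ₑ) x]
        exact this

/-- The analytic family on the line `re z = 1`. -/
theorem enorm_pairing_one_add_le (W : Measure (SO (d + 1))) [SFinite W] {φ η : E d → ℝ}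
    (hφ : Continuous φ) (hη : Integrable η) {A : ℝ} (hA : ∀ y, |η y| ≤ A) {F : E (d + 1) → ℂ}
    (hFm : Measurable F) (hF : Integrable F) (hF2 : MemLp F 2) {G : SO (d + 1) × E (d + 1) → ℂ}
    (hG : Measurable G) (hG1 : ∀ θ, Integrable fun x => G (θ, x))
    (hG2 : ∀ θ, MemLp (fun x => G (θ, x)) 2) (τ : ℝ)
    (hint : Integrable (pairingIntegrand φ η F G (1 + τ * Complex.I)) (W.prod volume)) :
    ‖pairing W φ η F G (1 + τ * Complex.I)‖ₑ ≤ ENNReal.ofReal (A * Real.exp (Real.pi * |τ|)) *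
      (∫⁻ x, ‖F x‖ₑ) * ∫⁻ p, ‖G p‖ₑ ∂(W.prod volume) := by
  unfold pairing
  rw [integral_prod _ hint]
  have hz : 0 < (1 + τ * Complex.I : ℂ).re := by simp
  have key : ∀ θ, ∫ ξ, pairingIntegrand φ η F G (1 + τ * Complex.I) (θ, ξ) =
      ∫ x, (∫ q : E d × ℝ, ((η q.1 : ℂ) * gammaKernel (1 + τ * Complex.I) q.2) *
        F (x - rotate θ⁻¹ (join q.1 (φ q.1 + q.2)))) * G (θ, x) := by
    intro θ
    have hγ : Measurable fun q : E d × ℝ => rotate θ⁻¹ (join q.1 (φ q.1 + q.2)) :=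
      (measurable_rotate_const θ⁻¹).comp (measurable_join.comp
        (measurable_fst.prodMk ((hφ.measurable.comp measurable_fst).add measurable_snd)))
    have h := integral_translate_mul_eq hγ (ρ := volume)
      (h := fun q : E d × ℝ => (η q.1 : ℂ) * gammaKernel (1 + τ * Complex.I) q.2)
      (hη.ofReal.mul_prod (integrable_gammaKernel hz)) hFm hF hF2
      (hG.comp measurable_prodMk_left) (hG1 θ) (hG2 θ)
    refine Eq.trans ?_ h.symm
    refine integral_congr_ae (.of_forall fun ξ => ?_)
    beta_reduce
    rw [fourier_graph_translate_gammaKernel _ _ _ _ hz]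
    rfl
  simp_rw [key]
  calc _ ≤ ∫⁻ θ, ‖∫ x, (∫ q : E d × ℝ, ((η q.1 : ℂ) * gammaKernel (1 + τ * Complex.I) q.2) *
        F (x - rotate θ⁻¹ (join q.1 (φ q.1 + q.2)))) * G (θ, x)‖ₑ ∂W :=
        enorm_integral_le_lintegral_enorm _
    _ ≤ ∫⁻ θ, (∫⁻ x, ENNReal.ofReal (A * Real.exp (Real.pi * |τ|)) * (∫⁻ x, ‖F x‖ₑ) *
          ‖G (θ, x)‖ₑ) ∂W := by
        refine lintegral_mono fun θ => (enorm_integral_le_lintegral_enorm _).trans ?_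
        refine lintegral_mono fun x => ?_
        rw [enorm_mul]
        gcongr
        exact enorm_integral_gammaKernel_le hφ.measurable hA hFm θ τ x
    _ = _ := by
        rw [lintegral_prod _ hG.enorm.aemeasurable, ← lintegral_const_mul _ hG.enorm.lintegral_prod_right']
        refine lintegral_congr fun θ => ?_
        have h2 : Measurable fun x => ‖G (θ, x)‖ₑ := hG.enorm.comp measurable_prodMk_left
        rw [lintegral_const_mul _ h2]

end AnalyticFamily

/-! ### Analyticity of the pairing; complex powers of simple functions -/

section ThreeLines
open Module FourierTransform
open scoped RealInnerProductSpace

variable {d : ℕ}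

theorem integrable_pairingMajorant (W : Measure (SO (d + 1))) [IsFiniteMeasure W] {φ η : E d → ℝ}
    (hφ : Continuous φ) (hη : Integrable η) {κ : ℝ}
    (hm : ∀ ξ, ∫⁻ θ, ENNReal.ofReal (‖symbol φ η θ ξ‖ * ‖base θ ξ‖ ^ κ) ^ 2 ∂W ≤ 1)
    {C D R : ℝ} {F : E (d + 1) → ℂ} (hFm : Measurable F) (hF : BoundedOnBall C R F)
    {G : SO (d + 1) × E (d + 1) → ℂ} (hGm : Measurable G)
    (hG : ∀ θ, BoundedOnBall D R fun x => G (θ, x)) :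
    Integrable (pairingMajorant φ η κ F G) (W.prod volume) := by
  have hsec : ∀ θ, Measurable fun x => G (θ, x) := fun θ => hGm.comp measurable_prodMk_left
  refine ⟨(measurable_pairingMajorant hφ hη κ (hF.integrable hFm) hGm).aestronglyMeasurable, ?_⟩
  rw [hasFiniteIntegral_iff_ofReal (.of_forall fun p => by unfold pairingMajorant; positivity)]
  refine (lintegral_pairingMajorant_le W hφ hη hm (hF.integrable hFm) (hF.memLp hFm 2) hGm
    (fun θ => (hG θ).integrable (hsec θ)) fun θ => (hG θ).memLp (hsec θ) 2).trans_lt ?_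
  refine ENNReal.mul_lt_top (ENNReal.rpow_lt_top_of_nonneg (by norm_num) ?_)
    (ENNReal.rpow_lt_top_of_nonneg (by norm_num) ?_)
  · rw [← lintegral_enorm_sq_eq]
    exact ENNReal.pow_ne_top (hF.memLp hFm 2).2.ne
  · rw [lintegral_prod _ (hGm.enorm.pow_const 2).aemeasurable]
    have h1 : ∀ θ, ∫⁻ x, ‖G (θ, x)‖ₑ ^ 2 ≤ eLpNorm ((Metric.closedBall (0 : E (d + 1)) R).indicator
        fun _ => (D : ℂ)) 2 volume ^ 2 := by
      intro θ
      rw [← lintegral_enorm_sq_eq (fun x => G (θ, x))]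
      gcongr
      refine eLpNorm_mono fun x => ((hG θ) x).trans ?_
      by_cases hx : x ∈ Metric.closedBall (0 : E (d + 1)) R
      · simp [Set.indicator_of_mem hx, le_abs_self]
      · simp [Set.indicator_of_notMem hx]
    refine ((lintegral_mono h1).trans_lt ?_).ne
    rw [lintegral_const]
    exact ENNReal.mul_lt_top (ENNReal.pow_lt_top (memLp_indicator_const 2
      Metric.isClosed_closedBall.measurableSet _
      (Or.inr (measure_closedBall_lt_top (x := (0 : E (d + 1))) (r := R)).ne)).2) (measure_lt_top _ _)

section Analyticity

variable {W : Measure (SO (d + 1))} {φ η : E d → ℝ} (hφ : Continuous φ) (hη : Integrable η) {κ : ℝ}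
  {F : E (d + 1) → ℂ} (hF : Integrable F) {G : SO (d + 1) × E (d + 1) → ℂ} (hG : Measurable G)
  (hM : Integrable (pairingMajorant φ η κ F G) (W.prod volume))

include hφ hη hF hG hM

theorem integrable_pairingIntegrand {z : ℂ} (hz : -κ ≤ z.re) :
    Integrable (pairingIntegrand φ η F G z) (W.prod volume) :=
  (hM.const_mul _).mono' (measurable_pairingIntegrand hφ hη hF hG z).aestronglyMeasurable
    (.of_forall fun p => norm_pairingIntegrand_le φ η F G hz p)

theorem continuousOn_pairing : ContinuousOn (pairing W φ η F G) {z | -κ ≤ z.re} := by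
  intro z₀ _
  refine continuousWithinAt_of_dominated (bound := fun p =>
    Real.exp (Real.pi / 2 * (|z₀.im| + 1)) * pairingMajorant φ η κ F G p)
    (.of_forall fun z => (measurable_pairingIntegrand hφ hη hF hG z).aestronglyMeasurable) ?_
    (hM.const_mul _) (.of_forall fun p => ?_)
  · have h1 : ∀ᶠ z in 𝓝[{z : ℂ | -κ ≤ z.re}] z₀, |z.im| < |z₀.im| + 1 :=
      (Complex.continuous_im.abs.continuousWithinAt).eventually_lt continuousWithinAt_const (by simp)
    filter_upwards [h1, self_mem_nhdsWithin] with z hz hz2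
    refine .of_forall fun p => (norm_pairingIntegrand_le φ η F G hz2 p).trans ?_
    have : 0 ≤ pairingMajorant φ η κ F G p := by unfold pairingMajorant; positivity
    gcongr
  · refine Continuous.continuousWithinAt ?_
    unfold pairingIntegrand
    refine (continuous_const.mul (continuous_const.mul ?_)).mul continuous_const
    exact continuous_neg.const_cpow (Or.inl (base_ne_zero _ _))

/-- Differentiation produces log(base), which is O(|base|^ε) because |base| ≥ 1. In the open half
plane there is room to absorb this power into the majorant at -κ. -/
theorem differentiableAt_pairing {z₀ : ℂ} (hz₀ : -κ < z₀.re) :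
    DifferentiableAt ℂ (pairing W φ η F G) z₀ := by
  -- On the ball of radius ε this keeps Re z ≥ -(κ - ε), leaving one power ε for the logarithm.
  set ε := (z₀.re + κ) / 3 with hε
  have hε0 : 0 < ε := by rw [hε]; linarith
  have h := hasDerivAt_integral_of_dominated_loc_of_deriv_le (μ := W.prod volume)
    (F := fun z p => pairingIntegrand φ η F G z p) (x₀ := z₀)
    (F' := fun z p => pairingIntegrand φ η F G z p * (-Complex.log (base p.1 p.2)))
    (bound := fun p => (1 / ε + Real.pi) * Real.exp (Real.pi / 2 * (|z₀.im| + ε)) *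
      pairingMajorant φ η κ F G p) (Metric.ball_mem_nhds z₀ hε0)
    (.of_forall fun z => (measurable_pairingIntegrand hφ hη hF hG z).aestronglyMeasurable)
    (integrable_pairingIntegrand hφ hη hF hG hM hz₀.le)
    ((measurable_pairingIntegrand hφ hη hF hG z₀).mul
      (Complex.measurable_log.comp measurable_base).neg).aestronglyMeasurable
    (.of_forall fun p z hz => ?_) (hM.const_mul _) (.of_forall fun p z _ => ?_)
  · exact h.2.differentiableAt
  · rw [Metric.mem_ball, dist_eq_norm] at hz
    have hre : |z.re - z₀.re| < ε := (Complex.abs_re_le_norm (z - z₀)).trans_lt hz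
    have him : |z.im| ≤ |z₀.im| + ε := by
      have h1 : |z.im - z₀.im| < ε := (Complex.abs_im_le_norm (z - z₀)).trans_lt hz
      have h2 := abs_add_le (z.im - z₀.im) z₀.im
      rw [sub_add_cancel] at h2
      linarith
    have hb1 := one_le_norm_base p.1 p.2
    have hz' : -(κ - ε) ≤ z.re := by
      have := (abs_lt.1 hre).1
      rw [hε] at this ⊢
      linarith
    have h1 := norm_pairingIntegrand_le φ η F G hz' p
    have h2 : ‖Complex.log (base p.1 p.2)‖ ≤ (1 / ε + Real.pi) * ‖base p.1 p.2‖ ^ ε := by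
      have h3 := Complex.norm_le_abs_re_add_abs_im (Complex.log (base p.1 p.2))
      rw [Complex.log_re, Complex.log_im, abs_of_nonneg (Real.log_nonneg hb1)] at h3
      have h4 := Real.log_le_rpow_div (norm_nonneg (base p.1 p.2)) hε0
      have h5 := Complex.abs_arg_le_pi (base p.1 p.2)
      have h6 : 1 ≤ ‖base p.1 p.2‖ ^ ε := Real.one_le_rpow hb1 hε0.le
      calc _ ≤ _ := h3
        _ ≤ ‖base p.1 p.2‖ ^ ε / ε + Real.pi * ‖base p.1 p.2‖ ^ ε := by
          refine add_le_add h4 (h5.trans ?_)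
          exact le_mul_of_one_le_right Real.pi_pos.le h6
        _ = _ := by ring
    have h7 : pairingMajorant φ η (κ - ε) F G p * ‖base p.1 p.2‖ ^ ε = pairingMajorant φ η κ F G p := by
      unfold pairingMajorant
      have : ‖base p.1 p.2‖ ^ κ = ‖base p.1 p.2‖ ^ (κ - ε) * ‖base p.1 p.2‖ ^ ε := by
        rw [← Real.rpow_add (by linarith)]; ring_nf
      rw [this]; ring
    have h8 : 0 ≤ pairingMajorant φ η (κ - ε) F G p := by unfold pairingMajorant; positivity
    rw [norm_mul, norm_neg]
    calc _ ≤ (Real.exp (Real.pi / 2 * |z.im|) * pairingMajorant φ η (κ - ε) F G p) *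
          ((1 / ε + Real.pi) * ‖base p.1 p.2‖ ^ ε) := by gcongr
      _ ≤ (Real.exp (Real.pi / 2 * (|z₀.im| + ε)) * pairingMajorant φ η (κ - ε) F G p) *
          ((1 / ε + Real.pi) * ‖base p.1 p.2‖ ^ ε) := by gcongr
      _ = _ := by rw [← h7]; ring
  · have h1 : HasDerivAt (fun z : ℂ => base p.1 p.2 ^ (-z))
        (base p.1 p.2 ^ (-z) * Complex.log (base p.1 p.2) * -1) z :=
      (hasDerivAt_neg z).const_cpow (Or.inl (base_ne_zero _ _))
    have h2 := (((h1.const_mul (symbol φ η p.1 p.2)).const_mul (𝓕 F p.2))).mul_const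
      (𝓕⁻ (fun x => G (p.1, x)) p.2)
    refine h2.congr_deriv ?_
    simp only [pairingIntegrand]; ring

end Analyticity

section SimpleFunctions

variable {α : Type*} [MeasurableSpace α]

/-- The indicator function of a level set of a simple function. -/
def levelIndicator (u : SimpleFunc α ℝ≥0) (a : ℝ≥0) : α → ℂ := (u ⁻¹' {a}).indicator 1

theorem measurable_levelIndicator (u : SimpleFunc α ℝ≥0) (a : ℝ≥0) :
    Measurable (levelIndicator u a) := measurable_one.indicator (u.measurableSet_fiber a)

/-- The complex power of a simple function. -/
def cpowFun (u : SimpleFunc α ℝ≥0) (w : ℂ) (x : α) : ℂ := ((u x : ℝ) : ℂ) ^ w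

theorem measurable_cpowFun (u : SimpleFunc α ℝ≥0) (w : ℂ) : Measurable (cpowFun u w) := by
  have h : Measurable fun x => ((u x : ℝ) : ℂ) :=
    Complex.measurable_ofReal.comp (measurable_coe_nnreal_real.comp u.measurable)
  exact h.pow_const w

theorem norm_cpowFun (u : SimpleFunc α ℝ≥0) {w : ℂ} (hw : 0 < w.re) (x : α) :
    ‖cpowFun u w x‖ = (u x : ℝ) ^ w.re :=
  Complex.norm_cpow_eq_rpow_re_of_nonneg (u x).2 hw.ne'

theorem enorm_cpowFun (u : SimpleFunc α ℝ≥0) {w : ℂ} (hw : 0 < w.re) (x : α) :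
    ‖cpowFun u w x‖ₑ = (u x : ℝ≥0∞) ^ w.re := by
  rw [← ofReal_norm, norm_cpowFun u hw, ← ENNReal.ofReal_rpow_of_nonneg (NNReal.coe_nonneg _) hw.le,
    ENNReal.ofReal_coe_nnreal]

/-- The value 0 is omitted since 0^w = 0 for w ≠ 0. The remaining level sets do not depend on w, so
all dependence on w sits in finitely many coefficients. -/
theorem cpowFun_eq_sum (u : SimpleFunc α ℝ≥0) {w : ℂ} (hw : w ≠ 0) (x : α) :
    cpowFun u w x = ∑ a ∈ u.range.erase 0, ((a : ℝ) : ℂ) ^ w * levelIndicator u a x := by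
  by_cases hx : u x = 0
  · rw [Finset.sum_eq_zero]
    · simp [cpowFun, hx, Complex.zero_cpow hw]
    · intro a ha
      have : x ∉ u ⁻¹' {a} := fun h => (Finset.ne_of_mem_erase ha) (by rw [← hx]; exact h.symm)
      simp [levelIndicator, Set.indicator_of_notMem this]
  · rw [Finset.sum_eq_single (u x)]
    · simp [levelIndicator, cpowFun]
    · intro a _ ha
      have : x ∉ u ⁻¹' {a} := fun h => ha h.symm
      simp [levelIndicator, Set.indicator_of_notMem this]
    · intro h
      exact absurd (Finset.mem_erase.2 ⟨hx, u.mem_range_self x⟩) h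

theorem exists_bound_simpleFunc (u : SimpleFunc α ℝ≥0) : ∃ C : ℝ≥0, ∀ x, u x ≤ C :=
  ⟨u.range.sup id, fun x => Finset.le_sup (f := id) (u.mem_range_self x)⟩

end SimpleFunctions

end ThreeLines

/-! ### Stein interpolation -/

section SteinInterpolation
open Module FourierTransform
open scoped RealInnerProductSpace

section FourierSum

variable {X : Type*} [NormedAddCommGroup X] [InnerProductSpace ℝ X] [FiniteDimensional ℝ X]
  [MeasurableSpace X] [BorelSpace X] {ι : Type*}

theorem integral_circle_smul_sum {X : Type*} [MeasurableSpace X] {μ : Measure X} (s : Finset ι)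
    (c : ι → ℂ) {F : ι → X → ℂ} (hF : ∀ i ∈ s, Integrable (F i) μ) {e : X → Circle}
    (he : AEStronglyMeasurable (fun x => (e x : ℂ)) μ) :
    ∫ x, e x • ∑ i ∈ s, c i * F i x ∂μ = ∑ i ∈ s, c i * ∫ x, e x • F i x ∂μ := by
  simp_rw [← integral_const_mul]
  rw [← integral_finsetSum]
  · refine integral_congr_ae (.of_forall fun x => ?_)
    simp only [Circle.smul_def, smul_eq_mul, Finset.mul_sum]
    exact Finset.sum_congr rfl fun i _ => by ring
  · intro i hi
    refine Integrable.const_mul ?_ _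
    refine (hF i hi).norm.mono' (he.mul (hF i hi).1) (.of_forall fun x => ?_)
    simp only [Circle.smul_def, smul_eq_mul, norm_mul, Circle.norm_coe, one_mul, le_refl]

theorem fourier_sum (s : Finset ι) (c : ι → ℂ) {F : ι → X → ℂ} (hF : ∀ i ∈ s, Integrable (F i))
    (ξ : X) : 𝓕 (fun x => ∑ i ∈ s, c i * F i x) ξ = ∑ i ∈ s, c i * 𝓕 (F i) ξ := by
  simp_rw [Real.fourier_eq]
  exact integral_circle_smul_sum s c hF
    (Real.continuous_fourierChar.comp (by fun_prop)).subtype_val.aestronglyMeasurable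

theorem fourierInv_sum (s : Finset ι) (c : ι → ℂ) {F : ι → X → ℂ} (hF : ∀ i ∈ s, Integrable (F i))
    (ξ : X) : 𝓕⁻ (fun x => ∑ i ∈ s, c i * F i x) ξ = ∑ i ∈ s, c i * 𝓕⁻ (F i) ξ := by
  simp_rw [Real.fourierInv_eq]
  exact integral_circle_smul_sum s c hF
    (Real.continuous_fourierChar.comp (by fun_prop)).subtype_val.aestronglyMeasurable

end FourierSum

variable {d : ℕ}

theorem norm_levelIndicator_le {α : Type*} [MeasurableSpace α] (u : SimpleFunc α ℝ≥0) (a : ℝ≥0)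
    (x : α) : ‖levelIndicator u a x‖ ≤ 1 := by
  rw [levelIndicator, Set.indicator]
  split_ifs <;> simp

theorem boundedOnBall_levelIndicator {f : SimpleFunc (E d) ℝ≥0} {R : ℝ}
    (hf : ∀ x, R < ‖x‖ → f x = 0) {a : ℝ≥0} (ha : a ≠ 0) :
    BoundedOnBall 1 R (levelIndicator f a) := by
  intro x
  by_cases hx : x ∈ Metric.closedBall (0 : E d) R
  · rw [Set.indicator_of_mem hx]
    exact norm_levelIndicator_le _ _ _
  · have h0 := hf x (by simpa using hx)
    have : x ∉ f ⁻¹' {a} := fun h => ha (h.symm.trans h0)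
    simp [levelIndicator, Set.indicator_of_notMem this, Set.indicator_of_notMem hx]

theorem boundedOnBall_levelIndicator_section {Ω : Type*} [MeasurableSpace Ω]
    {g : SimpleFunc (Ω × E d) ℝ≥0} {R : ℝ} (hg : ∀ θ x, R < ‖x‖ → g (θ, x) = 0) {a : ℝ≥0}
    (ha : a ≠ 0) (θ : Ω) : BoundedOnBall 1 R (fun x => levelIndicator g a (θ, x)) := by
  intro x
  by_cases hx : x ∈ Metric.closedBall (0 : E d) R
  · rw [Set.indicator_of_mem hx]
    exact norm_levelIndicator_le _ _ _
  · have h0 := hg θ x (by simpa using hx)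
    have : (θ, x) ∉ g ⁻¹' {a} := fun h => ha (h.symm.trans h0)
    simp [levelIndicator, Set.indicator_of_notMem this, Set.indicator_of_notMem hx]

theorem boundedOnBall_cpow {u : E d → ℝ≥0} {R : ℝ} (hu : ∀ x, R < ‖x‖ → u x = 0) {C : ℝ≥0}
    (hC : ∀ x, u x ≤ C) {w : ℂ} (hw : 0 < w.re) (hw2 : w.re ≤ 2) :
    BoundedOnBall (((C : ℝ) + 1) ^ (2 : ℝ)) R (fun x => ((u x : ℝ) : ℂ) ^ w) := by
  intro x
  beta_reduce
  rw [Complex.norm_cpow_eq_rpow_re_of_nonneg (NNReal.coe_nonneg _) hw.ne']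
  by_cases hx : x ∈ Metric.closedBall (0 : E d) R
  · rw [Set.indicator_of_mem hx]
    have h1 : (u x : ℝ) ≤ C := hC x
    have h0 : (0 : ℝ) ≤ u x := (u x).2
    calc (u x : ℝ) ^ w.re ≤ ((C : ℝ) + 1) ^ w.re :=
          Real.rpow_le_rpow h0 (by linarith) hw.le
      _ ≤ _ := Real.rpow_le_rpow_of_exponent_le (by linarith) hw2
  · rw [hu x (by simpa using hx), Set.indicator_of_notMem hx, NNReal.coe_zero, Real.zero_rpow hw.ne']

/-- Bilinearity on finite sums. The exponent w enters only through entire coefficients, which makes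
the interpolating function manifestly analytic. -/
theorem pairing_cpowFun_eq_sum {W : Measure (SO (d + 1))} [IsFiniteMeasure W] {φ η : E d → ℝ}
    (hφ : Continuous φ) (hη : Integrable η) {κ : ℝ}
    (hm : ∀ ξ, ∫⁻ θ, ENNReal.ofReal (‖symbol φ η θ ξ‖ * ‖base θ ξ‖ ^ κ) ^ 2 ∂W ≤ 1)
    {f : SimpleFunc (E (d + 1)) ℝ≥0} {g : SimpleFunc (SO (d + 1) × E (d + 1)) ℝ≥0} {R : ℝ}
    (hf : ∀ x, R < ‖x‖ → f x = 0) (hg : ∀ θ x, R < ‖x‖ → g (θ, x) = 0) {w z : ℂ} (hw : w ≠ 0)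
    (hz : -κ ≤ z.re) :
    pairing W φ η (cpowFun f w) (cpowFun g w) z = ∑ a ∈ f.range.erase 0, ∑ b ∈ g.range.erase 0,
      ((a : ℝ) : ℂ) ^ w * ((b : ℝ) : ℂ) ^ w *
        pairing W φ η (levelIndicator f a) (levelIndicator g b) z := by
  have hfa : ∀ a ∈ f.range.erase 0, BoundedOnBall 1 R (levelIndicator f a) := fun a ha =>
    boundedOnBall_levelIndicator hf (Finset.ne_of_mem_erase ha)
  have hgb : ∀ b ∈ g.range.erase 0, ∀ θ, BoundedOnBall 1 R (fun x => levelIndicator g b (θ, x)) :=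
    fun b hb => boundedOnBall_levelIndicator_section hg (Finset.ne_of_mem_erase hb)
  have hfi : ∀ a ∈ f.range.erase 0, Integrable (levelIndicator f a) := fun a ha =>
    (hfa a ha).integrable (measurable_levelIndicator f a)
  have hgi : ∀ θ, ∀ b ∈ g.range.erase 0, Integrable (fun x => levelIndicator g b (θ, x)) :=
    fun θ b hb => (hgb b hb θ).integrable ((measurable_levelIndicator g b).comp measurable_prodMk_left)
  have hint : ∀ a ∈ f.range.erase 0, ∀ b ∈ g.range.erase 0, Integrable
      (pairingIntegrand φ η (levelIndicator f a) (levelIndicator g b) z) (W.prod volume) :=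
    fun a ha b hb => integrable_pairingIntegrand hφ hη (hfi a ha) (measurable_levelIndicator g b)
      (integrable_pairingMajorant W hφ hη hm (measurable_levelIndicator f a) (hfa a ha)
        (measurable_levelIndicator g b) (hgb b hb)) hz
  have e : ∀ p, pairingIntegrand φ η (cpowFun f w) (cpowFun g w) z p =
      ∑ a ∈ f.range.erase 0, ∑ b ∈ g.range.erase 0, ((a : ℝ) : ℂ) ^ w * ((b : ℝ) : ℂ) ^ w *
        pairingIntegrand φ η (levelIndicator f a) (levelIndicator g b) z p := by
    intro p
    have e1 : 𝓕 (cpowFun f w) p.2 = ∑ a ∈ f.range.erase 0, ((a : ℝ) : ℂ) ^ w *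
        𝓕 (levelIndicator f a) p.2 := by
      rw [← fourier_sum _ _ hfi, funext (cpowFun_eq_sum f hw)]
    have e2 : 𝓕⁻ (fun x => cpowFun g w (p.1, x)) p.2 = ∑ b ∈ g.range.erase 0, ((b : ℝ) : ℂ) ^ w *
        𝓕⁻ (fun x => levelIndicator g b (p.1, x)) p.2 := by
      rw [← fourierInv_sum _ _ (hgi p.1)]
      simp_rw [cpowFun_eq_sum g hw]
    unfold pairingIntegrand
    rw [e1, e2, Finset.sum_mul, Finset.sum_mul_sum]
    refine Finset.sum_congr rfl fun a _ => Finset.sum_congr rfl fun b _ => ?_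
    ring
  unfold pairing
  simp_rw [e]
  rw [integral_finsetSum _ fun a ha => integrable_finsetSum _ fun b hb => (hint a ha b hb).const_mul _]
  refine Finset.sum_congr rfl fun a ha => ?_
  rw [integral_finsetSum _ fun b hb => (hint a ha b hb).const_mul _]
  refine Finset.sum_congr rfl fun b hb => ?_
  rw [integral_const_mul]

/-- The constant of the interpolation argument. -/
def steinConst (A κ : ℝ) : ℝ := (1 + A) * Real.exp (κ ^ 2 + 1 + Real.pi ^ 2)

/-- The Gaussian decay exp(-(Im z)²) beats the exponential growth, because π|y| - y² ≤ π². -/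
theorem exp_mul_norm_exp_sq_le {A κ : ℝ} (hA : 0 ≤ A) {c : ℝ} (hc : c ≤ 1 + A) {a : ℝ} (_ : 0 ≤ c)
    (ha : a ≤ Real.pi) (z : ℂ) (hz : z.re ^ 2 ≤ κ ^ 2 + 1) :
    ‖Complex.exp (z ^ 2)‖ * (c * Real.exp (a * |z.im|)) ≤ steinConst A κ := by
  have h1 : (z ^ 2).re = z.re ^ 2 - z.im ^ 2 := by simp [sq]
  rw [Complex.norm_exp, h1, mul_left_comm, ← Real.exp_add]
  unfold steinConst
  have h2 : |z.im| ^ 2 = z.im ^ 2 := sq_abs _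
  have h3 : a * |z.im| ≤ Real.pi * |z.im| := by gcongr
  have h4 : z.re ^ 2 - z.im ^ 2 + a * |z.im| ≤ κ ^ 2 + 1 + Real.pi ^ 2 := by
    nlinarith [sq_nonneg (|z.im| - Real.pi / 2)]
  gcongr

/-- **Stein interpolation** between `L²` at `re z = -κ` and `L¹ → L^∞` at `re z = 1`. -/
theorem norm_pairing_zero_le {W : Measure (SO (d + 1))} [IsFiniteMeasure W] {φ η : E d → ℝ}
    (hφ : Continuous φ) (hη : Integrable η) {A : ℝ} (hA : ∀ y, |η y| ≤ A) {κ : ℝ} (hκ : 0 ≤ κ)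
    (hm : ∀ ξ, ∫⁻ θ, ENNReal.ofReal (‖symbol φ η θ ξ‖ * ‖base θ ξ‖ ^ κ) ^ 2 ∂W ≤ 1)
    {f : SimpleFunc (E (d + 1)) ℝ≥0} {g : SimpleFunc (SO (d + 1) × E (d + 1)) ℝ≥0} {R : ℝ}
    (hf : ∀ x, R < ‖x‖ → f x = 0) (hg : ∀ θ x, R < ‖x‖ → g (θ, x) = 0)
    {p : ℝ} (hp : p = (2 + 2 * κ) / (1 + 2 * κ)) (hfp : ∫⁻ x, (f x : ℝ≥0∞) ^ p ≤ 1)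
    (hgp : ∫⁻ q, (g q : ℝ≥0∞) ^ p ∂(W.prod volume) ≤ 1) :
    ‖pairing W φ η (fun x => ((f x : ℝ) : ℂ)) (fun q => ((g q : ℝ) : ℂ)) 0‖ ≤ steinConst A κ := by
  have hA0 : 0 ≤ A := (abs_nonneg _).trans (hA 0)
  -- With this slope, w(z) = 1 + cz has real part p/2 on Re z = -κ and p on Re z = 1, and w(0) = 1.
  -- Normalized L^p inputs become normalized in L² on the left edge and in L¹ on the right edge.
  set c : ℝ := 1 / (1 + 2 * κ) with hc
  have hc0 : 0 < c := by positivity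
  have hcκ : c * κ < 1 / 2 := by
    rw [hc, div_mul_eq_mul_div, div_lt_div_iff₀ (by positivity) (by norm_num)]; linarith
  have hpc : p = 1 + c := by rw [hp, hc]; field_simp; ring
  have hpc2 : p / 2 = 1 - c * κ := by rw [hp, hc]; field_simp; ring
  have hp0 : 0 < p := by rw [hpc]; linarith
  have hc1 : c ≤ 1 := by rw [hc, div_le_one (by positivity)]; linarith
  let w : ℂ → ℂ := fun z => 1 + c * z
  have hwre : ∀ z, (w z).re = 1 + c * z.re := fun z => by simp [w]
  have hwpos : ∀ z : ℂ, -κ ≤ z.re → 0 < (w z).re := fun z hz => by rw [hwre]; nlinarith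
  have hw2 : ∀ z : ℂ, z.re ≤ 1 → (w z).re ≤ 2 := fun z hz => by rw [hwre]; nlinarith
  have hw0 : ∀ z : ℂ, -κ ≤ z.re → w z ≠ 0 := fun z hz h => by
    have := hwpos z hz; rw [h] at this; simp at this
  let Φ : ℂ → ℂ := fun z => Complex.exp (z ^ 2) * ∑ a ∈ f.range.erase 0, ∑ b ∈ g.range.erase 0,
      ((a : ℝ) : ℂ) ^ w z * ((b : ℝ) : ℂ) ^ w z *
        pairing W φ η (levelIndicator f a) (levelIndicator g b) z
  have hΦ : ∀ z : ℂ, -κ ≤ z.re → Φ z = Complex.exp (z ^ 2) *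
      pairing W φ η (cpowFun f (w z)) (cpowFun g (w z)) z := fun z hz => by
    rw [pairing_cpowFun_eq_sum hφ hη hm hf hg (hw0 z hz) hz]
  have hFm : ∀ z, Measurable (cpowFun f (w z)) := fun z => measurable_cpowFun f _
  have hGm : ∀ z, Measurable (cpowFun g (w z)) := fun z => measurable_cpowFun g _
  have hGs : ∀ z θ, Measurable fun x => cpowFun g (w z) (θ, x) := fun z θ =>
    (hGm z).comp measurable_prodMk_left
  obtain ⟨Cf, hCf⟩ := exists_bound_simpleFunc f
  obtain ⟨Cg, hCg⟩ := exists_bound_simpleFunc g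
  have hFb : ∀ z : ℂ, -κ ≤ z.re → z.re ≤ 1 →
      BoundedOnBall (((Cf : ℝ) + 1) ^ (2 : ℝ)) R (cpowFun f (w z)) := fun z h1 h2 =>
    boundedOnBall_cpow hf hCf (hwpos z h1) (hw2 z h2)
  have hGb : ∀ z : ℂ, -κ ≤ z.re → z.re ≤ 1 → ∀ θ,
      BoundedOnBall (((Cg : ℝ) + 1) ^ (2 : ℝ)) R (fun x => cpowFun g (w z) (θ, x)) := fun z h1 h2 θ =>
    boundedOnBall_cpow (hg θ) (fun x => hCg (θ, x)) (hwpos z h1) (hw2 z h2)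
  have hMaj : ∀ z : ℂ, -κ ≤ z.re → z.re ≤ 1 → Integrable
      (pairingMajorant φ η κ (cpowFun f (w z)) (cpowFun g (w z))) (W.prod volume) := fun z h1 h2 =>
    integrable_pairingMajorant W hφ hη hm (hFm z) (hFb z h1 h2) (hGm z) (hGb z h1 h2)
  -- Since |base| ≥ 1, the L² estimate at -κ controls the pairing throughout the strip. It serves on
  -- the left edge and for the growth condition.
  have hnorm : ∀ z : ℂ, -κ ≤ z.re → z.re ≤ 1 → ∀ B : ℝ≥0∞, B ≠ ⊤ →
      (∫⁻ x, ‖cpowFun f (w z) x‖ₑ ^ 2) ^ (1 / 2 : ℝ) *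
        (∫⁻ q, ‖cpowFun g (w z) q‖ₑ ^ 2 ∂(W.prod volume)) ^ (1 / 2 : ℝ) ≤ B →
      ‖pairing W φ η (cpowFun f (w z)) (cpowFun g (w z)) z‖ ≤
        B.toReal * Real.exp (Real.pi / 2 * |z.im|) := by
    intro z h1 h2 B hB hle
    have h3 : ‖pairing W φ η (cpowFun f (w z)) (cpowFun g (w z)) z‖ ≤
        ∫ q, Real.exp (Real.pi / 2 * |z.im|) *
          pairingMajorant φ η κ (cpowFun f (w z)) (cpowFun g (w z)) q ∂(W.prod volume) :=
      norm_integral_le_of_norm_le ((hMaj z h1 h2).const_mul _)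
        (.of_forall fun q => norm_pairingIntegrand_le φ η _ _ h1 q)
    refine h3.trans ?_
    rw [integral_const_mul, mul_comm]
    gcongr
    rw [integral_eq_lintegral_of_nonneg_ae (.of_forall fun q => by unfold pairingMajorant; positivity)
      (hMaj z h1 h2).1]
    refine ENNReal.toReal_mono hB (le_trans ?_ hle)
    exact lintegral_pairingMajorant_le W hφ hη hm ((hFb z h1 h2).integrable (hFm z))
      ((hFb z h1 h2).memLp (hFm z) 2) (hGm z) (fun θ => (hGb z h1 h2 θ).integrable (hGs z θ))
      fun θ => (hGb z h1 h2 θ).memLp (hGs z θ) 2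
  have hsub : ∀ z : ℂ, z ∈ closure (Complex.re ⁻¹' Set.Ioo (-κ) 1) → -κ ≤ z.re ∧ z.re ≤ 1 := by
    intro z hz
    have h1 : closure (Complex.re ⁻¹' Set.Ioo (-κ) 1) ⊆ Complex.re ⁻¹' Set.Icc (-κ) 1 :=
      closure_minimal (Set.preimage_mono Set.Ioo_subset_Icc_self)
        (isClosed_Icc.preimage Complex.continuous_re)
    exact h1 hz
  have hMab : ∀ a ∈ f.range.erase 0, ∀ b ∈ g.range.erase 0, Integrable
      (pairingMajorant φ η κ (levelIndicator f a) (levelIndicator g b)) (W.prod volume) :=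
    fun a ha b hb => integrable_pairingMajorant W hφ hη hm (measurable_levelIndicator f a)
      (boundedOnBall_levelIndicator hf (Finset.ne_of_mem_erase ha)) (measurable_levelIndicator g b)
      (boundedOnBall_levelIndicator_section hg (Finset.ne_of_mem_erase hb))
  have hfi : ∀ a ∈ f.range.erase 0, Integrable (levelIndicator f a) := fun a ha =>
    (boundedOnBall_levelIndicator hf (Finset.ne_of_mem_erase ha)).integrable
      (measurable_levelIndicator f a)
  have hpow : ∀ (a : ℝ≥0), a ≠ 0 → Differentiable ℂ fun z => ((a : ℝ) : ℂ) ^ w z := fun a ha =>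
    ((differentiable_const _).add ((differentiable_const _).mul differentiable_id)).const_cpow
      (Or.inl (by exact_mod_cast ha))
  have hdiff : DiffContOnCl ℂ Φ (Complex.re ⁻¹' Set.Ioo (-κ) 1) := by
    refine ⟨fun z hz => DifferentiableAt.differentiableWithinAt ?_, ?_⟩
    · refine DifferentiableAt.mul (by fun_prop) ?_
      refine DifferentiableAt.fun_sum fun a ha => DifferentiableAt.fun_sum fun b hb => ?_
      refine DifferentiableAt.mul ((hpow a (Finset.ne_of_mem_erase ha) z).mul
        (hpow b (Finset.ne_of_mem_erase hb) z)) ?_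
      exact differentiableAt_pairing hφ hη (hfi a ha) (measurable_levelIndicator g b)
        (hMab a ha b hb) hz.1
    · refine ContinuousOn.mul (by fun_prop) ?_
      refine continuousOn_finsetSum _ fun a ha => continuousOn_finsetSum _ fun b hb => ?_
      refine ContinuousOn.mul ((hpow a (Finset.ne_of_mem_erase ha)).continuous.mul
        (hpow b (Finset.ne_of_mem_erase hb)).continuous).continuousOn ?_
      exact (continuousOn_pairing hφ hη (hfi a ha) (measurable_levelIndicator g b)
        (hMab a ha b hb)).mono fun z hz => (hsub z hz).1
  have hleft : ∀ z : ℂ, z.re = -κ → ‖Φ z‖ ≤ steinConst A κ := by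
    intro z hz
    have h1 : -κ ≤ z.re := hz.ge
    have h2 : z.re ≤ 1 := by rw [hz]; linarith
    have hwz : (w z).re = p / 2 := by rw [hwre, hz, hpc2]; ring
    rw [hΦ z h1, norm_mul]
    have h3 := hnorm z h1 h2 1 ENNReal.one_ne_top (by
      have e1 : ∀ x, ‖cpowFun f (w z) x‖ₑ ^ 2 = (f x : ℝ≥0∞) ^ p := fun x => by
        rw [enorm_cpowFun f (hwpos z h1), hwz, ← ENNReal.rpow_natCast, ← ENNReal.rpow_mul]
        congr 1; push_cast; ring
      have e2 : ∀ x, ‖cpowFun g (w z) x‖ₑ ^ 2 = (g x : ℝ≥0∞) ^ p := fun x => by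
        rw [enorm_cpowFun g (hwpos z h1), hwz, ← ENNReal.rpow_natCast, ← ENNReal.rpow_mul]
        congr 1; push_cast; ring
      simp_rw [e1, e2]
      exact mul_le_one' (ENNReal.rpow_le_one hfp (by norm_num)) (ENNReal.rpow_le_one hgp (by norm_num)))
    refine (mul_le_mul_of_nonneg_left h3 (norm_nonneg _)).trans ?_
    refine exp_mul_norm_exp_sq_le hA0 (by simpa using hA0) (by simp) (by linarith [Real.pi_pos]) z ?_
    rw [hz]; linarith [sq_nonneg κ, neg_sq κ]
  have hright : ∀ z : ℂ, z.re = 1 → ‖Φ z‖ ≤ steinConst A κ := by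
    intro z hz
    have h1 : -κ ≤ z.re := by rw [hz]; linarith
    have h2 : z.re ≤ 1 := hz.le
    have hwz : (w z).re = p := by rw [hwre, hz, hpc]; ring
    have hz' : z = 1 + z.im * Complex.I := by
      rw [← Complex.re_add_im z, hz]; simp
    rw [hΦ z h1, norm_mul]
    have h3 : ‖pairing W φ η (cpowFun f (w z)) (cpowFun g (w z)) z‖ₑ ≤
        ENNReal.ofReal (A * Real.exp (Real.pi * |z.im|)) := by
      have h4 := enorm_pairing_one_add_le W hφ hη hA (hFm z) ((hFb z h1 h2).integrable (hFm z))
        ((hFb z h1 h2).memLp (hFm z) 2) (hGm z) (fun θ => (hGb z h1 h2 θ).integrable (hGs z θ))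
        (fun θ => (hGb z h1 h2 θ).memLp (hGs z θ) 2) z.im
        (by rw [← hz']; exact integrable_pairingIntegrand hφ hη ((hFb z h1 h2).integrable (hFm z))
              (hGm z) (hMaj z h1 h2) h1)
      rw [← hz'] at h4
      refine h4.trans ?_
      simp_rw [enorm_cpowFun f (hwpos z h1), enorm_cpowFun g (hwpos z h1), hwz]
      rw [mul_assoc]
      exact mul_le_of_le_one_right zero_le (mul_le_one' hfp hgp)
    have h5 : ‖pairing W φ η (cpowFun f (w z)) (cpowFun g (w z)) z‖ ≤
        A * Real.exp (Real.pi * |z.im|) := by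
      rw [← ofReal_norm] at h3
      exact (ENNReal.ofReal_le_ofReal_iff (by positivity)).1 h3
    refine (mul_le_mul_of_nonneg_left h5 (norm_nonneg _)).trans ?_
    refine exp_mul_norm_exp_sq_le hA0 (by linarith) hA0 le_rfl z ?_
    rw [hz]; linarith [sq_nonneg κ]
  -- In the strip the powers are uniformly bounded and supported in one ball, so Φ is bounded there
  -- and zero growth parameters are enough.
  have hgrowth : ∃ c < Real.pi / (1 - -κ), ∃ B, Φ =O[comap (_root_.abs ∘ Complex.im) atTop ⊓
      𝓟 (Complex.re ⁻¹' Set.Ioo (-κ) 1)] fun z => Real.exp (B * Real.exp (c * |z.im|)) := by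
    refine ⟨0, div_pos Real.pi_pos (by linarith), 0, ?_⟩
    let If : E (d + 1) → ℂ := (Metric.closedBall (0 : E (d + 1)) R).indicator
      fun _ => ((((Cf : ℝ) + 1) ^ (2 : ℝ) : ℝ) : ℂ)
    let Ig : SO (d + 1) × E (d + 1) → ℂ := fun q => (Metric.closedBall (0 : E (d + 1)) R).indicator
      (fun _ => ((((Cg : ℝ) + 1) ^ (2 : ℝ) : ℝ) : ℂ)) q.2
    let B : ℝ≥0∞ := (∫⁻ x, ‖If x‖ₑ ^ 2) ^ (1 / 2 : ℝ) *
      (∫⁻ q, ‖Ig q‖ₑ ^ 2 ∂(W.prod volume)) ^ (1 / 2 : ℝ)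
    have hBt : B ≠ ⊤ := by
      have hmeas : Measurable Ig :=
        (measurable_const.indicator Metric.isClosed_closedBall.measurableSet).comp measurable_snd
      have hlt : ∀ C : ℂ, ∫⁻ x : E (d + 1), ‖(Metric.closedBall (0 : E (d + 1)) R).indicator
          (fun _ => C) x‖ₑ ^ 2 ≠ ⊤ := fun C => by
        rw [← lintegral_enorm_sq_eq]
        exact ENNReal.pow_ne_top (memLp_indicator_const 2 Metric.isClosed_closedBall.measurableSet C
          (Or.inr (measure_closedBall_lt_top (x := (0 : E (d + 1))) (r := R)).ne)).2.ne
      refine ENNReal.mul_ne_top (ENNReal.rpow_ne_top_of_nonneg (by norm_num) (hlt _))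
        (ENNReal.rpow_ne_top_of_nonneg (by norm_num) ?_)
      rw [lintegral_prod _ (hmeas.enorm.pow_const 2).aemeasurable]
      simp only [Ig, lintegral_const]
      exact ENNReal.mul_ne_top (hlt _) (measure_ne_top _ _)
    refine Asymptotics.IsBigO.of_bound (steinConst B.toReal κ) ?_
    filter_upwards [mem_inf_of_right (mem_principal_self _)] with z hz
    have h1 : -κ ≤ z.re := hz.1.le
    have h2 : z.re ≤ 1 := hz.2.le
    rw [hΦ z h1, norm_mul, zero_mul, Real.exp_zero, norm_one, mul_one]
    have hind : ∀ (C : ℝ) (u : ℂ) (x : E (d + 1)), 0 ≤ C →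
        ‖u‖ ≤ (Metric.closedBall (0 : E (d + 1)) R).indicator (fun _ => C) x →
        ‖u‖ₑ ≤ ‖(Metric.closedBall (0 : E (d + 1)) R).indicator (fun _ => (C : ℂ)) x‖ₑ := by
      intro C u x hC hu
      rw [enorm_le_iff_norm_le]
      refine hu.trans (le_of_eq ?_)
      by_cases hx : x ∈ Metric.closedBall (0 : E (d + 1)) R
      · rw [Set.indicator_of_mem hx, Set.indicator_of_mem hx, Complex.norm_real,
          Real.norm_of_nonneg hC]
      · rw [Set.indicator_of_notMem hx, Set.indicator_of_notMem hx, norm_zero]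
    have h3 := hnorm z h1 h2 B hBt (by
      refine mul_le_mul' (ENNReal.rpow_le_rpow (lintegral_mono fun x => ?_) (by norm_num))
        (ENNReal.rpow_le_rpow (lintegral_mono fun q => ?_) (by norm_num))
      · exact pow_le_pow_left' (hind _ _ x (by positivity) (hFb z h1 h2 x)) 2
      · exact pow_le_pow_left' (hind _ _ q.2 (by positivity) (hGb z h1 h2 q.1 q.2)) 2)
    refine (mul_le_mul_of_nonneg_left h3 (norm_nonneg _)).trans ?_
    refine exp_mul_norm_exp_sq_le ENNReal.toReal_nonneg (by linarith) ENNReal.toReal_nonneg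
      (by linarith [Real.pi_pos]) z ?_
    have h4 := hz.1
    have h5 := hz.2
    rcases le_total 0 z.re with h | h
    · nlinarith [sq_nonneg κ]
    · nlinarith
  have hres := PhragmenLindelof.vertical_strip (z := 0) hdiff hgrowth hleft hright (by simp [hκ])
    (by simp)
  rw [hΦ 0 (by simp [hκ])] at hres
  have hw1 : w 0 = 1 := by simp [w]
  have ef : cpowFun f 1 = fun x => ((f x : ℝ) : ℂ) := by funext x; simp [cpowFun]
  have eg : cpowFun g 1 = fun x => ((g x : ℝ) : ℂ) := by funext x; simp [cpowFun]
  simpa [hw1, ef, eg] using hres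

end SteinInterpolation

/-! ### From the bilinear form to norm bounds by duality -/

section Duality

/-- Restricting the n-th approximation to N ≤ n gives, for N a norm, the bounded support which the
interpolation requires. -/
theorem exists_simpleFunc_tendsto {α : Type*} [MeasurableSpace α] {h : α → ℝ≥0∞} (hh : Measurable h)
    {N : α → ℝ} (hN : Measurable N) :
    ∃ s : ℕ → SimpleFunc α ℝ≥0, (∀ x, Monotone fun n => s n x) ∧
      (∀ (n : ℕ) x, (n : ℝ) < N x → s n x = 0) ∧ (∀ n x, (s n x : ℝ≥0∞) ≤ h x) ∧
      ∀ x, Tendsto (fun n => (s n x : ℝ≥0∞)) atTop (𝓝 (h x)) := by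
  have hms : ∀ n : ℕ, MeasurableSet {x | N x ≤ n} := fun n => measurableSet_le hN measurable_const
  let s : ℕ → SimpleFunc α ℝ≥0 := fun n =>
    ((SimpleFunc.eapprox h n).map ENNReal.toNNReal).restrict {x | N x ≤ n}
  have hs1 : ∀ (n : ℕ) x, N x ≤ n → (s n x : ℝ≥0∞) = SimpleFunc.eapprox h n x := by
    intro n x hx
    simp only [s, SimpleFunc.restrict_apply _ (hms n)]
    rw [Set.indicator_of_mem (by exact hx), SimpleFunc.map_apply,
      ENNReal.coe_toNNReal (SimpleFunc.eapprox_lt_top h n x).ne]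
  have hs0 : ∀ (n : ℕ) x, (n : ℝ) < N x → s n x = 0 := by
    intro n x hx
    simp only [s, SimpleFunc.restrict_apply _ (hms n)]
    exact Set.indicator_of_notMem (by simpa using hx) _
  have hle : ∀ x, ∀ n, SimpleFunc.eapprox h n x ≤ h x := by
    intro x n
    rw [← SimpleFunc.iSup_eapprox_apply hh x]
    exact le_iSup (fun n => SimpleFunc.eapprox h n x) n
  refine ⟨s, fun x n m hnm => ?_, hs0, fun n x => ?_, fun x => ?_⟩
  · beta_reduce
    rcases lt_or_ge (n : ℝ) (N x) with hx | hx
    · rw [hs0 n x hx]; exact zero_le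
    · have hx' : N x ≤ m := hx.trans (by exact_mod_cast hnm)
      rw [← ENNReal.coe_le_coe, hs1 n x hx, hs1 m x hx']
      exact SimpleFunc.monotone_eapprox h hnm x
  · rcases lt_or_ge (n : ℝ) (N x) with hx | hx
    · rw [hs0 n x hx]; exact zero_le
    · rw [hs1 n x hx]; exact hle x n
  · obtain ⟨n₀, hn₀⟩ := exists_nat_ge (N x)
    refine (SimpleFunc.tendsto_eapprox hh x).congr' ?_
    filter_upwards [eventually_ge_atTop n₀] with n hn
    exact (hs1 n x (hn₀.trans (by exact_mod_cast hn))).symm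

variable {d : ℕ}

/-- The positive operator `f ↦ ∫ η(y) f(x - θ⁻¹(y, φ(y))) dy`. -/
def graphAverage (φ η : E d → ℝ) (f : E (d + 1) → ℝ≥0∞) (θ : SO (d + 1)) (x : E (d + 1)) : ℝ≥0∞ :=
  ∫⁻ y, ENNReal.ofReal (η y) * f (x - rotate θ⁻¹ (join y (φ y)))

theorem measurable_rotate_inv_graph {φ : E d → ℝ} (hφ : Measurable φ) :
    Measurable fun q : (SO (d + 1) × E (d + 1)) × E d => rotate q.1.1⁻¹ (join q.2 (φ q.2)) := by
  have h1 : Measurable fun q : (SO (d + 1) × E (d + 1)) × E d => join q.2 (φ q.2) :=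
    measurable_join.comp (measurable_snd.prodMk (hφ.comp measurable_snd))
  have h2 : Measurable fun q : (SO (d + 1) × E (d + 1)) × E d => q.1.1 := measurable_fst.comp measurable_fst
  have h3 := (measurable_rotate_inv (n := d + 1)).comp (h2.prodMk h1)
  exact h3

theorem measurable_graphAverage_integrand {φ η : E d → ℝ} (hφ : Measurable φ) (hη : Measurable η)
    {f : E (d + 1) → ℝ≥0∞} (hf : Measurable f) :
    Measurable fun q : (SO (d + 1) × E (d + 1)) × E d =>
      ENNReal.ofReal (η q.2) * f (q.1.2 - rotate q.1.1⁻¹ (join q.2 (φ q.2))) :=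
  (hη.comp measurable_snd).ennreal_ofReal.mul
    (hf.comp ((measurable_snd.comp measurable_fst).sub (measurable_rotate_inv_graph hφ)))

theorem measurable_graphAverage {φ η : E d → ℝ} (hφ : Measurable φ) (hη : Measurable η)
    {f : E (d + 1) → ℝ≥0∞} (hf : Measurable f) :
    Measurable fun p : SO (d + 1) × E (d + 1) => graphAverage φ η f p.1 p.2 :=
  (measurable_graphAverage_integrand hφ hη hf).lintegral_prod_right'

theorem measurable_graphAverage_section {φ η : E d → ℝ} (hφ : Measurable φ) (hη : Measurable η)
    {f : E (d + 1) → ℝ≥0∞} (hf : Measurable f) (θ : SO (d + 1)) (x : E (d + 1)) :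
    Measurable fun y => ENNReal.ofReal (η y) * f (x - rotate θ⁻¹ (join y (φ y))) :=
  (measurable_graphAverage_integrand hφ hη hf).comp
    (measurable_const.prodMk measurable_id : Measurable fun y : E d => ((θ, x), y))

theorem graphAverage_le {φ η : E d → ℝ} {f : E (d + 1) → ℝ≥0∞} {C : ℝ≥0∞} (hC : C ≠ ⊤)
    (hf : ∀ x, f x ≤ C)
    (θ : SO (d + 1)) (x : E (d + 1)) :
    graphAverage φ η f θ x ≤ (∫⁻ y, ENNReal.ofReal (η y)) * C :=
  (lintegral_mono fun _ => mul_le_mul_right (hf _) _).trans (lintegral_mul_const' _ _ hC).le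

theorem graphAverage_mono {φ η : E d → ℝ} {f g : E (d + 1) → ℝ≥0∞} (h : ∀ x, f x ≤ g x)
    (θ : SO (d + 1)) (x : E (d + 1)) : graphAverage φ η f θ x ≤ graphAverage φ η g θ x :=
  lintegral_mono fun _ => by gcongr; exact h _

theorem graphAverage_const_mul {φ η : E d → ℝ} (f : E (d + 1) → ℝ≥0∞) {c : ℝ≥0∞} (hc : c ≠ ⊤)
    (θ : SO (d + 1)) (x : E (d + 1)) :
    graphAverage φ η (fun x => c * f x) θ x = c * graphAverage φ η f θ x := by
  unfold graphAverage
  rw [← lintegral_const_mul' _ _ hc]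
  exact lintegral_congr fun y => by ring

theorem tendsto_graphAverage {φ η : E d → ℝ} (hφ : Measurable φ) (hη : Measurable η)
    {f : ℕ → E (d + 1) → ℝ≥0∞} (hf : ∀ n, Measurable (f n)) (hmono : ∀ x, Monotone fun n => f n x)
    {g : E (d + 1) → ℝ≥0∞} (hg : ∀ x, Tendsto (fun n => f n x) atTop (𝓝 (g x))) (θ : SO (d + 1))
    (x : E (d + 1)) :
    Tendsto (fun n => graphAverage φ η (f n) θ x) atTop (𝓝 (graphAverage φ η g θ x)) := by
  refine lintegral_tendsto_of_tendsto_of_monotone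
    (fun n => (measurable_graphAverage_section hφ hη (hf n) θ x).aemeasurable)
    (.of_forall fun y n m hnm => ?_) (.of_forall fun y => ?_)
  · exact mul_le_mul_right (hmono _ hnm) _
  · exact ENNReal.Tendsto.const_mul (hg _) (Or.inr ENNReal.ofReal_ne_top)

variable {W : Measure (SO (d + 1))} [IsFiniteMeasure W] {φ η : E d → ℝ}

theorem lintegral_graphAverage_mul_ne_top (hη : Integrable η)
    {f : SimpleFunc (E (d + 1)) ℝ≥0} {g : SimpleFunc (SO (d + 1) × E (d + 1)) ℝ≥0} {R : ℝ}
    (hg : ∀ θ x, R < ‖x‖ → g (θ, x) = 0) :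
    ∫⁻ q, graphAverage φ η (fun x => f x) q.1 q.2 * g q ∂(W.prod volume) ≠ ⊤ := by
  obtain ⟨Cf, hCf⟩ := exists_bound_simpleFunc f
  obtain ⟨Cg, hCg⟩ := exists_bound_simpleFunc g
  have hηt : (∫⁻ y, ENNReal.ofReal (η y)) ≠ ⊤ := hη.lintegral_lt_top.ne
  have h1 : ∀ q : SO (d + 1) × E (d + 1), graphAverage φ η (fun x => f x) q.1 q.2 * g q ≤
      (Set.univ ×ˢ Metric.closedBall (0 : E (d + 1)) R).indicator
        (fun _ => (∫⁻ y, ENNReal.ofReal (η y)) * Cf * Cg) q := by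
    intro q
    by_cases hq : q.2 ∈ Metric.closedBall (0 : E (d + 1)) R
    · rw [Set.indicator_of_mem (Set.mk_mem_prod (Set.mem_univ q.1) hq)]
      exact mul_le_mul' (graphAverage_le ENNReal.coe_ne_top (fun x => by exact_mod_cast hCf x) _ _)
        (by exact_mod_cast hCg q)
    · have : g q = 0 := hg q.1 q.2 (by simpa using hq)
      rw [this]; simp
  refine ((lintegral_mono h1).trans_lt ?_).ne
  rw [lintegral_indicator_const (MeasurableSet.univ.prod Metric.isClosed_closedBall.measurableSet),
    Measure.prod_prod]
  exact ENNReal.mul_lt_top (ENNReal.mul_lt_top (ENNReal.mul_lt_top hηt.lt_top ENNReal.coe_lt_top)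
    ENNReal.coe_lt_top) (ENNReal.mul_lt_top (measure_lt_top _ _) measure_closedBall_lt_top)

variable (hφ : Continuous φ) (hηc : Continuous η) (hη : Integrable η) (hη0 : ∀ y, 0 ≤ η y)

include hφ hηc hη0

theorem integral_ofReal_mul_graph (f : SimpleFunc (E (d + 1)) ℝ≥0) (θ : SO (d + 1))
    (x : E (d + 1)) :
    ∫ y, (η y : ℂ) * ((f (x - rotate θ⁻¹ (join y (φ y))) : ℝ) : ℂ) =
      ((graphAverage φ η (fun x => f x) θ x).toReal : ℂ) := by
  have hfm : Measurable fun x => (f x : ℝ≥0∞) := f.measurable.coe_nnreal_ennreal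
  have h1 : ∀ y, (η y : ℂ) * ((f (x - rotate θ⁻¹ (join y (φ y))) : ℝ) : ℂ) =
      (((ENNReal.ofReal (η y) * f (x - rotate θ⁻¹ (join y (φ y)))).toReal : ℝ) : ℂ) := by
    intro y
    rw [ENNReal.toReal_mul, ENNReal.toReal_ofReal (hη0 y), ENNReal.coe_toReal]
    push_cast; rfl
  simp_rw [h1]
  rw [integral_complex_ofReal, integral_toReal
    (measurable_graphAverage_section hφ.measurable hηc.measurable hfm θ x).aemeasurable
    (.of_forall fun y => ENNReal.mul_lt_top ENNReal.ofReal_lt_top ENNReal.coe_lt_top)]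
  rfl

include hη

theorem integral_graphAverage_mul (f : SimpleFunc (E (d + 1)) ℝ≥0) {g : E (d + 1) → ℝ≥0}
    (hg : Measurable g) (θ : SO (d + 1)) :
    ∫ x, (∫ y, (η y : ℂ) * ((f (x - rotate θ⁻¹ (join y (φ y))) : ℝ) : ℂ)) * ((g x : ℝ) : ℂ) =
      ((∫⁻ x, graphAverage φ η (fun x => f x) θ x * g x).toReal : ℂ) := by
  have hηt : (∫⁻ y, ENNReal.ofReal (η y)) ≠ ⊤ := hη.lintegral_lt_top.ne
  obtain ⟨Cf, hCf⟩ := exists_bound_simpleFunc f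
  have hfm : Measurable fun x => (f x : ℝ≥0∞) := f.measurable.coe_nnreal_ennreal
  have hUt : ∀ x, graphAverage φ η (fun x => f x) θ x < ⊤ := fun x =>
    (graphAverage_le ENNReal.coe_ne_top (fun x => by exact_mod_cast hCf x) θ x).trans_lt
      (ENNReal.mul_lt_top hηt.lt_top ENNReal.coe_lt_top)
  have hUm : Measurable fun x => graphAverage φ η (fun x => f x) θ x := by
    have h := (measurable_graphAverage hφ.measurable hηc.measurable hfm).comp
      (measurable_prodMk_left (x := θ))
    exact h
  have hUg : Measurable fun x => graphAverage φ η (fun x => f x) θ x * g x :=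
    hUm.mul hg.coe_nnreal_ennreal
  rw [← integral_toReal hUg.aemeasurable (.of_forall fun x =>
    ENNReal.mul_lt_top (hUt x) ENNReal.coe_lt_top), ← integral_complex_ofReal]
  refine integral_congr_ae (.of_forall fun x => ?_)
  beta_reduce
  rw [integral_ofReal_mul_graph hφ hηc hη0 f θ x, ENNReal.toReal_mul, ENNReal.coe_toReal]
  push_cast; rfl

theorem pairing_zero_eq_lintegral {κ : ℝ} (hκ : 0 ≤ κ)
    (hm : ∀ ξ, ∫⁻ θ, ENNReal.ofReal (‖symbol φ η θ ξ‖ * ‖base θ ξ‖ ^ κ) ^ 2 ∂W ≤ 1)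
    {f : SimpleFunc (E (d + 1)) ℝ≥0} {g : SimpleFunc (SO (d + 1) × E (d + 1)) ℝ≥0} {R : ℝ}
    (hf : ∀ x, R < ‖x‖ → f x = 0) (hg : ∀ θ x, R < ‖x‖ → g (θ, x) = 0) :
    pairing W φ η (fun x => ((f x : ℝ) : ℂ)) (fun q => ((g q : ℝ) : ℂ)) 0 =
      ((∫⁻ q, graphAverage φ η (fun x => f x) q.1 q.2 * g q ∂(W.prod volume)).toReal : ℂ) := by
  obtain ⟨Cf, hCf⟩ := exists_bound_simpleFunc f
  obtain ⟨Cg, hCg⟩ := exists_bound_simpleFunc g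
  have hfm : Measurable fun x => (f x : ℝ≥0∞) := f.measurable.coe_nnreal_ennreal
  have hgm : Measurable fun q => (g q : ℝ≥0∞) := g.measurable.coe_nnreal_ennreal
  have hFm : Measurable fun x => ((f x : ℝ) : ℂ) :=
    Complex.measurable_ofReal.comp f.measurable.coe_nnreal_real
  have hGm : Measurable fun q => ((g q : ℝ) : ℂ) :=
    Complex.measurable_ofReal.comp g.measurable.coe_nnreal_real
  have hGs : ∀ θ, Measurable fun x => ((g (θ, x) : ℝ) : ℂ) := fun θ => hGm.comp measurable_prodMk_left
  have hFb : BoundedOnBall (((Cf : ℝ) + 1) ^ (2 : ℝ)) R fun x => ((f x : ℝ) : ℂ) := by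
    simpa using boundedOnBall_cpow (w := 1) hf hCf (by simp) (by simp)
  have hGb : ∀ θ, BoundedOnBall (((Cg : ℝ) + 1) ^ (2 : ℝ)) R fun x => ((g (θ, x) : ℝ) : ℂ) := fun θ => by
    simpa using boundedOnBall_cpow (w := 1) (hg θ) (fun x => hCg (θ, x)) (by simp) (by simp)
  have hFi := hFb.integrable hFm
  have hMaj := integrable_pairingMajorant W hφ hη hm hFm hFb hGm hGb
  have hUm := measurable_graphAverage hφ.measurable hηc.measurable hfm
  have hUg : Measurable fun q : SO (d + 1) × E (d + 1) =>
      graphAverage φ η (fun x => f x) q.1 q.2 * g q := hUm.mul hgm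
  have hnt := lintegral_graphAverage_mul_ne_top (W := W) (φ := φ) hη (f := f) hg
  rw [pairing_zero W hφ hη hFm hFi (hFb.memLp hFm 2) hGm (fun θ => (hGb θ).integrable (hGs θ))
    (fun θ => (hGb θ).memLp (hGs θ) 2)
    (integrable_pairingIntegrand hφ hη hFi hGm hMaj (by simpa using hκ))]
  have e2 : ∀ θ, ∫ x, (∫ y, (η y : ℂ) * ((f (x - rotate θ⁻¹ (join y (φ y))) : ℝ) : ℂ)) *
      ((g (θ, x) : ℝ) : ℂ) =
      ((∫⁻ x, graphAverage φ η (fun x => f x) θ x * g (θ, x)).toReal : ℂ) :=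
    fun θ => integral_graphAverage_mul hφ hηc hη hη0 f (g := fun x => g (θ, x))
      (g.measurable.comp measurable_prodMk_left) θ
  simp_rw [e2]
  have hm2 : AEMeasurable (fun θ => ∫⁻ x, graphAverage φ η (fun x => f x) θ x * g (θ, x)) W :=
    hUg.lintegral_prod_right'.aemeasurable
  rw [lintegral_prod _ hUg.aemeasurable] at hnt ⊢
  rw [integral_complex_ofReal, integral_toReal hm2 (ae_lt_top' hm2 hnt)]

theorem lintegral_graphAverage_mul_le_one {A : ℝ} (hA : ∀ y, η y ≤ A) {κ : ℝ} (hκ : 0 ≤ κ)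
    (hm : ∀ ξ, ∫⁻ θ, ENNReal.ofReal (‖symbol φ η θ ξ‖ * ‖base θ ξ‖ ^ κ) ^ 2 ∂W ≤ 1)
    {f : SimpleFunc (E (d + 1)) ℝ≥0} {g : SimpleFunc (SO (d + 1) × E (d + 1)) ℝ≥0} {R : ℝ}
    (hf : ∀ x, R < ‖x‖ → f x = 0) (hg : ∀ θ x, R < ‖x‖ → g (θ, x) = 0)
    {p : ℝ} (hp : p = (2 + 2 * κ) / (1 + 2 * κ)) (hfp : ∫⁻ x, (f x : ℝ≥0∞) ^ p ≤ 1)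
    (hgp : ∫⁻ q, (g q : ℝ≥0∞) ^ p ∂(W.prod volume) ≤ 1) :
    ∫⁻ q, graphAverage φ η (fun x => f x) q.1 q.2 * g q ∂(W.prod volume) ≤
      ENNReal.ofReal (steinConst A κ) := by
  have h1 := norm_pairing_zero_le hφ hη (A := A) (fun y => by rw [abs_of_nonneg (hη0 y)]; exact hA y)
    hκ hm hf hg hp hfp hgp
  rw [pairing_zero_eq_lintegral hφ hηc hη hη0 hκ hm hf hg, Complex.norm_real,
    Real.norm_of_nonneg ENNReal.toReal_nonneg] at h1
  rw [← ENNReal.ofReal_toReal (lintegral_graphAverage_mul_ne_top (W := W) (φ := φ) hη (f := f) hg)]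
  exact ENNReal.ofReal_le_ofReal h1

/-- Homogeneity in f and g. The scalars a, b are nonzero upper bounds of the norms rather than the
norms, so that one may divide by them. -/
theorem lintegral_graphAverage_mul_le {A : ℝ} (hA : ∀ y, η y ≤ A) {κ : ℝ} (hκ : 0 ≤ κ)
    (hm : ∀ ξ, ∫⁻ θ, ENNReal.ofReal (‖symbol φ η θ ξ‖ * ‖base θ ξ‖ ^ κ) ^ 2 ∂W ≤ 1)
    {f : SimpleFunc (E (d + 1)) ℝ≥0} {g : SimpleFunc (SO (d + 1) × E (d + 1)) ℝ≥0} {R : ℝ}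
    (hf : ∀ x, R < ‖x‖ → f x = 0) (hg : ∀ θ x, R < ‖x‖ → g (θ, x) = 0)
    {p : ℝ} (hp : p = (2 + 2 * κ) / (1 + 2 * κ)) {a b : ℝ≥0} (ha : a ≠ 0) (hb : b ≠ 0)
    (hfp : ∫⁻ x, (f x : ℝ≥0∞) ^ p ≤ (a : ℝ≥0∞) ^ p)
    (hgp : ∫⁻ q, (g q : ℝ≥0∞) ^ p ∂(W.prod volume) ≤ (b : ℝ≥0∞) ^ p) :
    ∫⁻ q, graphAverage φ η (fun x => f x) q.1 q.2 * g q ∂(W.prod volume) ≤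
      ENNReal.ofReal (steinConst A κ) * a * b := by
  have hp0 : 0 ≤ p := by rw [hp]; positivity
  have hnorm : ∀ {α : Type _} [MeasurableSpace α] {μ : Measure α} (h : SimpleFunc α ℝ≥0) {c : ℝ≥0},
      c ≠ 0 → ∫⁻ x, (h x : ℝ≥0∞) ^ p ∂μ ≤ (c : ℝ≥0∞) ^ p →
      ∫⁻ x, ((h.map (c⁻¹ * ·) x : ℝ≥0) : ℝ≥0∞) ^ p ∂μ ≤ 1 := by
    intro α _ μ h c hc hle
    have hc' : (c : ℝ≥0∞) ≠ 0 := by simpa using hc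
    have e : ∀ x, ((h.map (c⁻¹ * ·) x : ℝ≥0) : ℝ≥0∞) ^ p = (c⁻¹ : ℝ≥0∞) ^ p * (h x : ℝ≥0∞) ^ p := by
      intro x
      rw [SimpleFunc.map_apply, ENNReal.coe_mul, ENNReal.mul_rpow_of_nonneg _ _ hp0, ENNReal.coe_inv hc]
    simp_rw [e]
    rw [lintegral_const_mul' _ _ (ENNReal.rpow_ne_top_of_nonneg hp0 (ENNReal.inv_ne_top.2 hc')),
      ENNReal.inv_rpow]
    refine (mul_le_mul_right hle _).trans ?_
    exact ENNReal.inv_mul_le_one _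
  have h1 := lintegral_graphAverage_mul_le_one hφ hηc hη hη0 hA hκ hm (f := f.map (a⁻¹ * ·))
    (g := g.map (b⁻¹ * ·)) (R := R) (fun x hx => by simp [hf x hx]) (fun θ x hx => by simp [hg θ x hx])
    hp (hnorm f ha hfp) (hnorm g hb hgp)
  have ha' : (a : ℝ≥0∞) ≠ 0 := by simpa using ha
  have hb' : (b : ℝ≥0∞) ≠ 0 := by simpa using hb
  have e : ∀ q : SO (d + 1) × E (d + 1), graphAverage φ η (fun x => ((f.map (a⁻¹ * ·) x : ℝ≥0) : ℝ≥0∞))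
      q.1 q.2 * ((g.map (b⁻¹ * ·) q : ℝ≥0) : ℝ≥0∞) =
      ((a : ℝ≥0∞)⁻¹ * (b : ℝ≥0∞)⁻¹) * (graphAverage φ η (fun x => f x) q.1 q.2 * g q) := by
    intro q
    simp only [SimpleFunc.map_apply, ENNReal.coe_mul, ENNReal.coe_inv ha, ENNReal.coe_inv hb]
    rw [graphAverage_const_mul _ (ENNReal.inv_ne_top.2 ha')]
    ring
  simp_rw [e] at h1
  rw [lintegral_const_mul' _ _ (ENNReal.mul_ne_top (ENNReal.inv_ne_top.2 ha')
    (ENNReal.inv_ne_top.2 hb'))] at h1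
  generalize ∫⁻ q, graphAverage φ η (fun x => f x) q.1 q.2 * g q ∂(W.prod volume) = I at h1 ⊢
  calc I = ((a : ℝ≥0∞) * (a : ℝ≥0∞)⁻¹) * ((b : ℝ≥0∞) * (b : ℝ≥0∞)⁻¹) * I := by
        rw [ENNReal.mul_inv_cancel ha' ENNReal.coe_ne_top, ENNReal.mul_inv_cancel hb' ENNReal.coe_ne_top,
          one_mul, one_mul]
    _ = (a : ℝ≥0∞) * b * ((a : ℝ≥0∞)⁻¹ * (b : ℝ≥0∞)⁻¹ * I) := by ring
    _ ≤ (a : ℝ≥0∞) * b * ENNReal.ofReal (steinConst A κ) := mul_le_mul_right h1 _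
    _ = _ := by ring

/-- Duality by testing against approximations of U^(p'-1), the extremizer in Hölder's inequality,
where p' - 1 = 1 + 2κ. -/
theorem lintegral_graphAverage_rpow_le_of_simpleFunc {A : ℝ} (hA : ∀ y, η y ≤ A) {κ : ℝ} (hκ : 0 ≤ κ)
    (hm : ∀ ξ, ∫⁻ θ, ENNReal.ofReal (‖symbol φ η θ ξ‖ * ‖base θ ξ‖ ^ κ) ^ 2 ∂W ≤ 1)
    {f : SimpleFunc (E (d + 1)) ℝ≥0} {R : ℝ} (hf : ∀ x, R < ‖x‖ → f x = 0)
    {p : ℝ} (hp : p = (2 + 2 * κ) / (1 + 2 * κ)) {a : ℝ≥0} (ha : a ≠ 0)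
    (hfp : ∫⁻ x, (f x : ℝ≥0∞) ^ p ≤ (a : ℝ≥0∞) ^ p) :
    ∫⁻ q, graphAverage φ η (fun x => f x) q.1 q.2 ^ (2 + 2 * κ) ∂(W.prod volume) ≤
      (ENNReal.ofReal (steinConst A κ) * a) ^ (2 + 2 * κ) := by
  have hp1 : 1 < p := by rw [hp, lt_div_iff₀ (by positivity)]; linarith
  have hp0 : 0 < p := by linarith
  have hκ1 : (1 + 2 * κ) * (p - 1) = 1 := by rw [hp]; field_simp; ring
  have hκ2 : (1 + 2 * κ) * p = 2 + 2 * κ := by rw [hp]; field_simp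
  have hfm : Measurable fun x => (f x : ℝ≥0∞) := f.measurable.coe_nnreal_ennreal
  have hUm := measurable_graphAverage hφ.measurable hηc.measurable hfm
  set U : SO (d + 1) × E (d + 1) → ℝ≥0∞ := fun q => graphAverage φ η (fun x => f x) q.1 q.2 with hU
  obtain ⟨s, hs1, hs2, hs3, hs4⟩ := exists_simpleFunc_tendsto (hUm.pow_const (1 + 2 * κ))
    (N := fun q : SO (d + 1) × E (d + 1) => ‖q.2‖) measurable_snd.norm
  have hsm : ∀ n, Measurable fun q => (s n q : ℝ≥0∞) ^ p := fun n =>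
    (s n).measurable.coe_nnreal_ennreal.pow_const p
  have hlim : Tendsto (fun n => ∫⁻ q, (s n q : ℝ≥0∞) ^ p ∂(W.prod volume)) atTop
      (𝓝 (∫⁻ q, U q ^ (2 + 2 * κ) ∂(W.prod volume))) := by
    refine lintegral_tendsto_of_tendsto_of_monotone (fun n => (hsm n).aemeasurable)
      (.of_forall fun q n m hnm => ?_) (.of_forall fun q => ?_)
    · exact ENNReal.rpow_le_rpow (by exact_mod_cast hs1 q hnm) hp0.le
    · have h1 := ((ENNReal.continuous_rpow_const (y := p)).tendsto _).comp (hs4 q)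
      rw [← ENNReal.rpow_mul, hκ2] at h1
      exact h1
  refine le_of_tendsto' hlim fun n => ?_
  set J := ∫⁻ q, (s n q : ℝ≥0∞) ^ p ∂(W.prod volume) with hJ
  obtain ⟨Cs, hCs⟩ := exists_bound_simpleFunc (s n)
  -- Finiteness of J is what permits dividing J ≤ Z J^(1/p) by J^(1/p).
  have hJt : J ≠ ⊤ := by
    have h1 : ∀ q : SO (d + 1) × E (d + 1), (s n q : ℝ≥0∞) ^ p ≤
        (Set.univ ×ˢ Metric.closedBall (0 : E (d + 1)) n).indicator (fun _ => (Cs : ℝ≥0∞) ^ p) q := by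
      intro q
      by_cases hq : q.2 ∈ Metric.closedBall (0 : E (d + 1)) (n : ℝ)
      · rw [Set.indicator_of_mem (Set.mk_mem_prod (Set.mem_univ q.1) hq)]
        exact ENNReal.rpow_le_rpow (by exact_mod_cast hCs q) hp0.le
      · rw [hs2 n q (by simpa using hq)]; simp [hp0]
    refine ((lintegral_mono h1).trans_lt ?_).ne
    rw [lintegral_indicator_const (MeasurableSet.univ.prod Metric.isClosed_closedBall.measurableSet),
      Measure.prod_prod]
    exact ENNReal.mul_lt_top (ENNReal.rpow_lt_top_of_nonneg hp0.le ENNReal.coe_ne_top)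
      (ENNReal.mul_lt_top (measure_lt_top _ _) measure_closedBall_lt_top)
  rcases eq_or_ne J 0 with h0 | h0
  · rw [h0]; exact zero_le
  have hbt : J ^ (1 / p) ≠ ⊤ := ENNReal.rpow_ne_top_of_nonneg (by positivity) hJt
  have hb0 : (J ^ (1 / p)).toNNReal ≠ 0 := by
    rw [ENNReal.toNNReal_ne_zero]
    exact ⟨by simp [ENNReal.rpow_eq_zero_iff, h0, hJt], hbt⟩
  have hJp : (J ^ (1 / p)) ^ p = J := by
    rw [← ENNReal.rpow_mul, one_div, inv_mul_cancel₀ hp0.ne', ENNReal.rpow_one]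
  have h1 := lintegral_graphAverage_mul_le (W := W) hφ hηc hη hη0 hA hκ hm (f := f) (g := s n)
    (R := max R n) (fun x hx => hf x ((le_max_left _ _).trans_lt hx))
    (fun θ x hx => hs2 n (θ, x) ((le_max_right _ _).trans_lt hx)) hp ha hb0 hfp
    (by rw [ENNReal.coe_toNNReal hbt, hJp])
  rw [ENNReal.coe_toNNReal hbt] at h1
  have h2 : J ≤ ∫⁻ q, graphAverage φ η (fun x => f x) q.1 q.2 * s n q ∂(W.prod volume) := by
    refine lintegral_mono fun q => ?_
    have h3 : (s n q : ℝ≥0∞) ^ (p - 1) ≤ U q := by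
      refine (ENNReal.rpow_le_rpow (hs3 n q) (by linarith)).trans ?_
      rw [← ENNReal.rpow_mul, hκ1, ENNReal.rpow_one]
    calc (s n q : ℝ≥0∞) ^ p = (s n q : ℝ≥0∞) ^ (p - 1 + 1) := by rw [sub_add_cancel]
      _ = (s n q : ℝ≥0∞) ^ (p - 1) * s n q := by
        rw [ENNReal.rpow_add_of_nonneg _ _ (by linarith) zero_le_one, ENNReal.rpow_one]
      _ ≤ U q * s n q := mul_le_mul_left h3 _
  set Z := ENNReal.ofReal (steinConst A κ) * a with hZ
  have h3 : J ≤ Z * J ^ (1 / p) := h2.trans h1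
  have h4 : J ^ (1 - 1 / p) ≤ Z := by
    rw [ENNReal.rpow_sub _ _ h0 hJt, ENNReal.rpow_one]
    exact ENNReal.div_le_of_le_mul h3
  have h5 : (1 - 1 / p) * (2 + 2 * κ) = 1 := by rw [hp]; field_simp; ring
  calc J = (J ^ (1 - 1 / p)) ^ (2 + 2 * κ) := by rw [← ENNReal.rpow_mul, h5, ENNReal.rpow_one]
    _ ≤ Z ^ (2 + 2 * κ) := ENNReal.rpow_le_rpow h4 (by positivity)

theorem lintegral_graphAverage_rpow_le_one {A : ℝ} (hA : ∀ y, η y ≤ A) {κ : ℝ} (hκ : 0 ≤ κ)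
    (hm : ∀ ξ, ∫⁻ θ, ENNReal.ofReal (‖symbol φ η θ ξ‖ * ‖base θ ξ‖ ^ κ) ^ 2 ∂W ≤ 1)
    {f : E (d + 1) → ℝ≥0∞} (hfm : Measurable f)
    {p : ℝ} (hp : p = (2 + 2 * κ) / (1 + 2 * κ)) {a : ℝ≥0} (ha : a ≠ 0)
    (hfp : ∫⁻ x, f x ^ p ≤ (a : ℝ≥0∞) ^ p) :
    ∫⁻ q, graphAverage φ η f q.1 q.2 ^ (2 + 2 * κ) ∂(W.prod volume) ≤
      (ENNReal.ofReal (steinConst A κ) * a) ^ (2 + 2 * κ) := by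
  have hp0 : 0 ≤ p := by rw [hp]; positivity
  obtain ⟨s, hs1, hs2, hs3, hs4⟩ := exists_simpleFunc_tendsto hfm
    (N := fun x : E (d + 1) => ‖x‖) measurable_norm
  have hsm : ∀ n, Measurable fun x => (s n x : ℝ≥0∞) := fun n =>
    (s n).measurable.coe_nnreal_ennreal
  have hmono : ∀ x, Monotone fun n => (s n x : ℝ≥0∞) := fun x n m hnm => by
    exact ENNReal.coe_le_coe.2 (hs1 x hnm)
  have hlim : Tendsto (fun n => ∫⁻ q, graphAverage φ η (fun x => s n x) q.1 q.2 ^ (2 + 2 * κ)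
      ∂(W.prod volume)) atTop (𝓝 (∫⁻ q, graphAverage φ η f q.1 q.2 ^ (2 + 2 * κ) ∂(W.prod volume))) := by
    refine lintegral_tendsto_of_tendsto_of_monotone (fun n =>
      ((measurable_graphAverage hφ.measurable hηc.measurable (hsm n)).pow_const _).aemeasurable)
      (.of_forall fun q n m hnm => ?_) (.of_forall fun q => ?_)
    · exact ENNReal.rpow_le_rpow (graphAverage_mono (fun x => hmono x hnm) _ _) (by positivity)
    · exact ((ENNReal.continuous_rpow_const (y := 2 + 2 * κ)).tendsto _).comp
        (tendsto_graphAverage hφ.measurable hηc.measurable hsm hmono hs4 q.1 q.2)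
  refine le_of_tendsto' hlim fun n => ?_
  exact lintegral_graphAverage_rpow_le_of_simpleFunc hφ hηc hη hη0 hA hκ hm (hs2 n) hp ha
    ((lintegral_mono fun x => ENNReal.rpow_le_rpow (hs3 n x) hp0).trans hfp)

/-- An `L²` bound for the multiplier with respect to a measure `W` on the rotation group implies
the `L^p → L^{p'}` bound, `p' = 2 + 2 κ`. -/
theorem lintegral_graphAverage_rpow_le {A : ℝ} (hA : ∀ y, η y ≤ A) {κ : ℝ} (hκ : 0 ≤ κ) {B : ℝ≥0}
    (hB : B ≠ 0)
    (hm : ∀ ξ, ∫⁻ θ, ENNReal.ofReal (‖symbol φ η θ ξ‖ * ‖base θ ξ‖ ^ κ) ^ 2 ∂W ≤ B)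
    {f : E (d + 1) → ℝ≥0∞} (hfm : Measurable f)
    {p : ℝ} (hp : p = (2 + 2 * κ) / (1 + 2 * κ)) {a : ℝ≥0} (ha : a ≠ 0)
    (hfp : ∫⁻ x, f x ^ p ≤ (a : ℝ≥0∞) ^ p) :
    ∫⁻ θ, (∫⁻ x, graphAverage φ η f θ x ^ (2 + 2 * κ)) ∂W ≤
      B * (ENNReal.ofReal (steinConst A κ) * a) ^ (2 + 2 * κ) := by
  have hB' : (B : ℝ≥0∞) ≠ 0 := by simpa using hB
  -- Rescaling W by B⁻¹ normalizes the multiplier bound and leaves the L¹ → L^∞ constant A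
  -- unchanged, so B comes out linearly. This linearity is needed when W carries a weight.
  have h := lintegral_graphAverage_rpow_le_one (W := B⁻¹ • W) hφ hηc hη hη0 hA hκ (fun ξ => by
    rw [lintegral_smul_measure, ENNReal.smul_def, smul_eq_mul, ENNReal.coe_inv hB]
    refine (mul_le_mul_right (hm ξ) _).trans (le_of_eq ?_)
    exact ENNReal.inv_mul_cancel hB' ENNReal.coe_ne_top) hfm hp ha hfp
  rw [lintegral_prod _ ((measurable_graphAverage hφ.measurable hηc.measurable
    hfm).pow_const _).aemeasurable, lintegral_smul_measure, ENNReal.smul_def, smul_eq_mul,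
    ENNReal.coe_inv hB] at h
  calc _ = (B : ℝ≥0∞) * ((B : ℝ≥0∞)⁻¹ *
      ∫⁻ θ, (∫⁻ x, graphAverage φ η f θ x ^ (2 + 2 * κ)) ∂W) := by
        rw [← mul_assoc, ENNReal.mul_inv_cancel hB' ENNReal.coe_ne_top, one_mul]
    _ ≤ _ := mul_le_mul_right h _

end Duality

/-! ### Bounds uniform in the number of scales -/

section UniformBounds
open Module

variable {d : ℕ}

theorem norm_symbol_mul_base_rpow_le {κ : ℝ} (hκ : 0 ≤ κ) (φ η : E d → ℝ) (θ : SO (d + 1))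
    (ξ : E (d + 1)) : ‖symbol φ η θ ξ‖ * ‖base θ ξ‖ ^ κ ≤ (2 * Real.pi) ^ κ *
      (‖oscInt φ η (head (rotate θ ξ)) (last (rotate θ ξ))‖ * (1 + |last (rotate θ ξ)|) ^ κ) := by
  have h : ‖base θ ξ‖ ^ κ ≤ (2 * Real.pi) ^ κ * (1 + |last (rotate θ ξ)|) ^ κ := by
    rw [← Real.mul_rpow Real.two_pi_pos.le (by positivity)]
    exact Real.rpow_le_rpow (norm_nonneg _) (norm_base_le θ ξ) hκ
  calc _ ≤ ‖symbol φ η θ ξ‖ * ((2 * Real.pi) ^ κ * (1 + |last (rotate θ ξ)|) ^ κ) := by gcongr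
    _ = _ := by unfold symbol; ring

theorem measurable_symbol_mul_base_rpow {φ η : E d → ℝ} (hφ : Continuous φ) (hη : Integrable η)
    (κ : ℝ) (ξ : E (d + 1)) :
    Measurable fun θ => ENNReal.ofReal (‖symbol φ η θ ξ‖ * ‖base θ ξ‖ ^ κ) ^ 2 := by
  have h : Measurable fun p : SO (d + 1) × E (d + 1) =>
      ENNReal.ofReal (‖symbol φ η p.1 p.2‖ * ‖base p.1 p.2‖ ^ κ) ^ 2 :=
    ((measurable_symbol hφ hη).norm.mul (measurable_base.norm.pow_const κ)).ennreal_ofReal.pow_const 2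
  have h1 : Measurable fun θ : SO (d + 1) => (θ, ξ) := measurable_prodMk_right
  have h2 := h.comp h1
  exact h2

theorem continuous_norm_rpow {β : ℝ} (hβ : 0 ≤ β) : Continuous fun x : E d => ‖x‖ ^ β :=
  Continuous.rpow_const continuous_norm fun _ => Or.inr hβ

variable {β M : ℝ} {χ : E d → ℝ}

/-- The bound for a single rotation. -/
theorem exists_lintegral_graphAverage_rpow_le (hβ : 2 < β) (hM : 1 ≤ M) (hχ : Continuous χ)
    (hχc : HasCompactSupport χ) (hχ0 : ∀ x, 0 ≤ χ x) (hχz : ∀ x, ‖x‖ ≤ 1 / 2 → χ x = 0)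
    (hosc : OscDecay (fun x : E d => ‖x‖ ^ β) χ) {κ : ℝ} (hκ : 0 ≤ κ) (hκd : κ * β < d) {p : ℝ}
    (hp : p = (2 + 2 * κ) / (1 + 2 * κ)) :
    ∃ D : ℝ≥0, ∀ (K : ℕ) (θ : SO (d + 1)) (f : E (d + 1) → ℝ≥0∞) (a : ℝ≥0), Measurable f → a ≠ 0 →
      ∫⁻ x, f x ^ p ≤ (a : ℝ≥0∞) ^ p →
      ∫⁻ x, graphAverage (fun x : E d => ‖x‖ ^ β) (dyadicSum χ M K) f θ x ^ (2 + 2 * κ) ≤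
        D * (a : ℝ≥0∞) ^ (2 + 2 * κ) := by
  have hM0 : 0 < M := by linarith
  have hχi : Integrable χ := hχ.integrable_of_hasCompactSupport hχc
  obtain ⟨A, hA0, hA⟩ := exists_dyadicSum_le hχ hχc hχz hM0
  obtain ⟨C, hC0, hC⟩ := exists_norm_oscInt_dyadicSum_le (V := E d) hβ.le hκ
    (by rwa [finrank_euclideanSpace_fin]) hM hχi hosc
  let B : ℝ≥0 := (((2 * Real.pi) ^ κ * C) ^ 2).toNNReal
  have hB : B ≠ 0 := by
    have : 0 < ((2 * Real.pi) ^ κ * C) ^ 2 := by positivity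
    exact (Real.toNNReal_pos.2 this).ne'
  have hSt : ENNReal.ofReal (steinConst A κ) ^ (2 + 2 * κ) ≠ ⊤ :=
    ENNReal.rpow_ne_top_of_nonneg (by positivity) ENNReal.ofReal_ne_top
  refine ⟨B * (ENNReal.ofReal (steinConst A κ) ^ (2 + 2 * κ)).toNNReal, fun K θ f a hf ha hfp => ?_⟩
  -- A Dirac mass turns the averaged hypothesis into the pointwise multiplier bound for one
  -- rotation.
  have h := lintegral_graphAverage_rpow_le (W := Measure.dirac θ)
    (continuous_norm_rpow (β := β) (by linarith)) (continuous_dyadicSum hχ M K) (integrable_dyadicSum hχi hM0 K)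
    (dyadicSum_nonneg hχ0 M K) (hA K) hκ hB (fun ξ => ?_) hf hp ha hfp
  · have hm := ((measurable_graphAverage (φ := fun x : E d => ‖x‖ ^ β) (η := dyadicSum χ M K)
      (continuous_norm_rpow (β := β) (by linarith)).measurable (continuous_dyadicSum hχ M K).measurable
      hf).pow_const (2 + 2 * κ)).lintegral_prod_right' (ν := volume)
    rw [lintegral_dirac' _ hm] at h
    refine h.trans (le_of_eq ?_)
    rw [ENNReal.mul_rpow_of_nonneg _ _ (by positivity), ENNReal.coe_mul, ENNReal.coe_toNNReal hSt,
      mul_assoc]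
  · have hm : Measurable fun θ => ENNReal.ofReal (‖symbol (fun x : E d => ‖x‖ ^ β)
        (dyadicSum χ M K) θ ξ‖ * ‖base θ ξ‖ ^ κ) ^ 2 :=
      measurable_symbol_mul_base_rpow (continuous_norm_rpow (β := β) (by linarith))
        (integrable_dyadicSum hχi hM0 K) κ ξ
    rw [lintegral_dirac' _ hm, ← ENNReal.ofReal_pow (by positivity)]
    refine ENNReal.ofReal_le_ofReal ?_
    refine pow_le_pow_left₀ (by positivity) ?_ 2
    refine (norm_symbol_mul_base_rpow_le hκ _ _ θ ξ).trans ?_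
    exact mul_le_mul_of_nonneg_left (hC K _ _) (by positivity)

/-- Converse Hölder inequality, tested with w = min(Y, N)^(r-1). The truncation makes the integral
finite, so it can be divided out, and makes the weight bounded. -/
theorem lintegral_rpow_le_of_forall_weight {Ω : Type*} [MeasurableSpace Ω] (ν : Measure Ω)
    [IsFiniteMeasure ν] {Y : Ω → ℝ≥0∞} (hY : Measurable Y) {r : ℝ} (hr : 1 < r) {D : ℝ≥0∞}
    (h : ∀ w : Ω → ℝ≥0∞, Measurable w → (∃ N : ℝ≥0, ∀ θ, w θ ≤ N) →
      ∫⁻ θ, w θ ^ (r / (r - 1)) ∂ν ≠ 0 →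
      ∫⁻ θ, Y θ * w θ ∂ν ≤ D * (∫⁻ θ, w θ ^ (r / (r - 1)) ∂ν) ^ (1 - 1 / r)) :
    ∫⁻ θ, Y θ ^ r ∂ν ≤ D ^ r := by
  have hr0 : 0 < r := by linarith
  have hr1 : 0 < r - 1 := by linarith
  have hlim : Tendsto (fun N : ℕ => ∫⁻ θ, min (Y θ) N ^ r ∂ν) atTop (𝓝 (∫⁻ θ, Y θ ^ r ∂ν)) := by
    refine lintegral_tendsto_of_tendsto_of_monotone
      (fun N => ((hY.min measurable_const).pow_const r).aemeasurable) (.of_forall fun θ n m hnm => ?_)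
      (.of_forall fun θ => ?_)
    · exact ENNReal.rpow_le_rpow (min_le_min_left _ (by exact_mod_cast hnm)) hr0.le
    · refine ((ENNReal.continuous_rpow_const (y := r)).tendsto _).comp ?_
      have h1 : Tendsto (fun N : ℕ => min (Y θ) (N : ℝ≥0∞)) atTop (𝓝 (min (Y θ) ⊤)) :=
        tendsto_const_nhds.min ENNReal.tendsto_nat_nhds_top
      rwa [min_eq_left le_top] at h1
  refine le_of_tendsto' hlim fun N => ?_
  set I := ∫⁻ θ, min (Y θ) N ^ r ∂ν with hI
  rcases eq_or_ne I 0 with h0 | h0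
  · rw [h0]; exact zero_le
  have hIt : I ≠ ⊤ := by
    refine ((lintegral_mono fun θ => ENNReal.rpow_le_rpow (min_le_right (Y θ) (N : ℝ≥0∞))
      hr0.le).trans_lt ?_).ne
    rw [lintegral_const]
    exact ENNReal.mul_lt_top (ENNReal.rpow_lt_top_of_nonneg hr0.le (ENNReal.natCast_ne_top N))
      (measure_lt_top _ _)
  have e : ∀ θ, (min (Y θ) N ^ (r - 1)) ^ (r / (r - 1)) = min (Y θ) (N : ℝ≥0∞) ^ r := fun θ => by
    rw [← ENNReal.rpow_mul]; congr 1; field_simp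
  have h1 := h (fun θ => min (Y θ) N ^ (r - 1)) ((hY.min measurable_const).pow_const _)
    ⟨(N : ℝ≥0) ^ (r - 1), fun θ => by
      rw [ENNReal.coe_rpow_of_nonneg _ hr1.le]
      exact ENNReal.rpow_le_rpow (min_le_right _ _) hr1.le⟩ (by simp_rw [e]; exact h0)
  simp_rw [e] at h1
  have h2 : I ≤ D * I ^ (1 - 1 / r) := by
    refine le_trans (lintegral_mono fun θ => ?_) h1
    calc min (Y θ) (N : ℝ≥0∞) ^ r = min (Y θ) (N : ℝ≥0∞) ^ (1 + (r - 1)) := by rw [add_sub_cancel]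
      _ = min (Y θ) (N : ℝ≥0∞) * min (Y θ) (N : ℝ≥0∞) ^ (r - 1) := by
        rw [ENNReal.rpow_add_of_nonneg _ _ zero_le_one hr1.le, ENNReal.rpow_one]
      _ ≤ _ := mul_le_mul_left (min_le_left _ _) _
  have h3 : I ^ (1 / r) ≤ D := by
    have e1 : I ^ (1 / r) = I / I ^ (1 - 1 / r) := by
      have h4 := ENNReal.rpow_sub 1 (1 - 1 / r) h0 hIt
      rw [ENNReal.rpow_one] at h4
      rw [← h4]; congr 1; ring
    rw [e1]
    exact ENNReal.div_le_of_le_mul h2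
  calc I = (I ^ (1 / r)) ^ r := by
        rw [← ENNReal.rpow_mul, one_div, inv_mul_cancel₀ hr0.ne', ENNReal.rpow_one]
    _ ≤ D ^ r := ENNReal.rpow_le_rpow h3 hr0.le

/-- The bound for the average over the rotations. -/
theorem exists_lintegral_lintegral_graphAverage_rpow_le (hd : 1 ≤ d) (ν : Measure (SO (d + 1)))
    [ν.IsHaarMeasure] (hβ : 2 < β) (hM : 1 ≤ M) (hχ : Continuous χ)
    (hχc : HasCompactSupport χ) (hχ0 : ∀ x, 0 ≤ χ x) (hχz : ∀ x, ‖x‖ ≤ 1 / 2 → χ x = 0)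
    (hosc : OscDecay (fun x : E d => ‖x‖ ^ β) χ) {κ s : ℝ} (hs : 2 < s)
    (hκ : κ = d / β * (1 + (β - 1) / s)) (hκd : κ < d / 2) {p : ℝ}
    (hp : p = (2 + 2 * κ) / (1 + 2 * κ)) :
    ∃ D : ℝ≥0, ∀ (K : ℕ) (f : E (d + 1) → ℝ≥0∞) (a : ℝ≥0), Measurable f → a ≠ 0 →
      ∫⁻ x, f x ^ p ≤ (a : ℝ≥0∞) ^ p →
      ∫⁻ θ, (∫⁻ x, graphAverage (fun x : E d => ‖x‖ ^ β) (dyadicSum χ M K) f θ x ^ (2 + 2 * κ)) ^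
        (s / 2) ∂ν ≤ (D * (a : ℝ≥0∞) ^ (2 + 2 * κ)) ^ (s / 2) := by
  have hM0 : 0 < M := by linarith
  have hκ0 : 0 ≤ κ := by
    rw [hκ]
    have : 0 < β - 1 := by linarith
    positivity
  have hχi : Integrable χ := hχ.integrable_of_hasCompactSupport hχc
  obtain ⟨A, hA0, hA⟩ := exists_dyadicSum_le hχ hχc hχz hM0
  obtain ⟨C, hC⟩ := exists_eLpNorm_oscInt_dyadicSum_le hd ν hβ (by linarith) hκ hκd hM hχi hosc
  let B₀ : ℝ≥0 := ((2 * Real.pi) ^ κ).toNNReal ^ 2 * (C + 1) ^ 2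
  have hB₀ : B₀ ≠ 0 := by
    have h1 : 0 < (2 * Real.pi) ^ κ := by positivity
    have h2 : ((2 * Real.pi) ^ κ).toNNReal ≠ 0 := by simpa using h1
    positivity
  have hSt : ENNReal.ofReal (steinConst A κ) ^ (2 + 2 * κ) ≠ ⊤ :=
    ENNReal.rpow_ne_top_of_nonneg (by positivity) ENNReal.ofReal_ne_top
  refine ⟨B₀ * (ENNReal.ofReal (steinConst A κ) ^ (2 + 2 * κ)).toNNReal, fun K f a hf ha hfp => ?_⟩
  have hφ := continuous_norm_rpow (d := d) (β := β) (by linarith)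
  have hUm := measurable_graphAverage (φ := fun x : E d => ‖x‖ ^ β) (η := dyadicSum χ M K)
    hφ.measurable (continuous_dyadicSum hχ M K).measurable hf
  have hYm := (hUm.pow_const (2 + 2 * κ)).lintegral_prod_right' (ν := volume)
  have hr : 1 < s / 2 := by linarith
  refine lintegral_rpow_le_of_forall_weight ν hYm hr fun w hw ⟨N, hN⟩ hw0 => ?_
  have hconj : (s / 2).HolderConjugate (s / 2 / (s / 2 - 1)) := Real.HolderConjugate.conjExponent hr
  set J := ∫⁻ θ, w θ ^ (s / 2 / (s / 2 - 1)) ∂ν with hJ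
  have hJt : J ≠ ⊤ := by
    have h0 : 0 ≤ s / 2 / (s / 2 - 1) := hconj.symm.nonneg
    refine ((lintegral_mono fun θ => ENNReal.rpow_le_rpow (hN θ) h0).trans_lt ?_).ne
    rw [lintegral_const]
    exact ENNReal.mul_lt_top (ENNReal.rpow_lt_top_of_nonneg h0 ENNReal.coe_ne_top) (measure_lt_top _ _)
  have hexp : 1 / (s / 2 / (s / 2 - 1)) = 1 - 1 / (s / 2) := by
    field_simp
  have hJ' : J ^ (1 - 1 / (s / 2)) ≠ ⊤ := by
    refine ENNReal.rpow_ne_top_of_nonneg ?_ hJt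
    rw [← hexp]; exact one_div_nonneg.2 hconj.symm.nonneg
  -- The weighted Haar measure is the measure W of the interpolation theorem.
  have hfin : IsFiniteMeasure (ν.withDensity w) := by
    refine isFiniteMeasure_withDensity ?_
    refine ((lintegral_mono hN).trans_lt ?_).ne
    rw [lintegral_const]
    exact ENNReal.mul_lt_top ENNReal.coe_lt_top (measure_lt_top _ _)
  have hB : B₀ * (J ^ (1 - 1 / (s / 2))).toNNReal ≠ 0 := by
    refine mul_ne_zero hB₀ ?_
    rw [ENNReal.toNNReal_ne_zero]
    refine ⟨fun h => ?_, hJ'⟩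
    rw [ENNReal.rpow_eq_zero_iff] at h
    rcases h with h | h
    · exact hw0 h.1
    · exact hJt h.1
  have hmm : ∀ ξ, ∫⁻ θ, ENNReal.ofReal (‖symbol (fun x : E d => ‖x‖ ^ β) (dyadicSum χ M K) θ ξ‖ *
      ‖base θ ξ‖ ^ κ) ^ 2 ∂(ν.withDensity w) ≤
      ((B₀ * (J ^ (1 - 1 / (s / 2))).toNNReal : ℝ≥0) : ℝ≥0∞) := by
    intro ξ
    have hm : Measurable fun θ => ENNReal.ofReal (‖symbol (fun x : E d => ‖x‖ ^ β)
        (dyadicSum χ M K) θ ξ‖ * ‖base θ ξ‖ ^ κ) ^ 2 :=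
      measurable_symbol_mul_base_rpow hφ (integrable_dyadicSum hχi hM0 K) κ ξ
    rw [lintegral_withDensity_eq_lintegral_mul _ hw hm]
    -- Hölder with exponent s/2 on the squared multiplier produces the square of its L^s norm over
    -- the rotations, and the dual norm of the weight.
    have h3 := ENNReal.lintegral_mul_le_Lp_mul_Lq ν hconj hm.aemeasurable hw.aemeasurable
    rw [mul_comm w]
    refine h3.trans ?_
    rw [hexp, ENNReal.coe_mul, ENNReal.coe_toNNReal hJ']
    refine mul_le_mul_left ?_ _
    have h4 : ∀ θ, (ENNReal.ofReal (‖symbol (fun x : E d => ‖x‖ ^ β) (dyadicSum χ M K) θ ξ‖ *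
        ‖base θ ξ‖ ^ κ) ^ 2) ^ (s / 2) ≤ (ENNReal.ofReal ((2 * Real.pi) ^ κ)) ^ s *
        ‖‖oscInt (fun x : E d => ‖x‖ ^ β) (dyadicSum χ M K) (head (rotate θ ξ)) (last (rotate θ ξ))‖ *
          (1 + |last (rotate θ ξ)|) ^ κ‖ₑ ^ s := by
      intro θ
      rw [← ENNReal.rpow_natCast, ← ENNReal.rpow_mul, show ((2 : ℕ) : ℝ) * (s / 2) = s by
        push_cast; ring, ← ENNReal.mul_rpow_of_nonneg _ _ (by linarith), ← ofReal_norm,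
        Real.norm_of_nonneg (by positivity), ← ENNReal.ofReal_mul (by positivity)]
      refine ENNReal.rpow_le_rpow (ENNReal.ofReal_le_ofReal ?_) (by linarith)
      exact norm_symbol_mul_base_rpow_le hκ0 _ _ θ ξ
    have h5 := hC K ξ
    rw [eLpNorm_eq_lintegral_rpow_enorm_toReal (by simpa using by linarith) ENNReal.ofReal_ne_top,
      ENNReal.toReal_ofReal (by linarith)] at h5
    calc _ ≤ (∫⁻ θ, (ENNReal.ofReal ((2 * Real.pi) ^ κ)) ^ s *
        ‖‖oscInt (fun x : E d => ‖x‖ ^ β) (dyadicSum χ M K) (head (rotate θ ξ)) (last (rotate θ ξ))‖ *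
          (1 + |last (rotate θ ξ)|) ^ κ‖ₑ ^ s ∂ν) ^ (1 / (s / 2)) :=
          ENNReal.rpow_le_rpow (lintegral_mono h4) (by positivity)
      _ = ENNReal.ofReal ((2 * Real.pi) ^ κ) ^ (2 : ℝ) * ((∫⁻ θ,
        ‖‖oscInt (fun x : E d => ‖x‖ ^ β) (dyadicSum χ M K) (head (rotate θ ξ)) (last (rotate θ ξ))‖ *
          (1 + |last (rotate θ ξ)|) ^ κ‖ₑ ^ s ∂ν) ^ (1 / s)) ^ (2 : ℝ) := by
          rw [lintegral_const_mul' _ _ (ENNReal.rpow_ne_top_of_nonneg (by linarith)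
            ENNReal.ofReal_ne_top), ENNReal.mul_rpow_of_nonneg _ _ (by positivity),
            ← ENNReal.rpow_mul, ← ENNReal.rpow_mul, show s * (1 / (s / 2)) = 2 by field_simp,
            show 1 / s * 2 = 1 / (s / 2) by field_simp]
      _ ≤ ENNReal.ofReal ((2 * Real.pi) ^ κ) ^ (2 : ℝ) * ((C : ℝ≥0∞) + 1) ^ (2 : ℝ) := by
          gcongr
          exact h5.trans le_self_add
      _ = _ := by
          simp only [B₀, ENNReal.rpow_ofNat, ENNReal.coe_mul, ENNReal.coe_pow, ENNReal.coe_add,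
            ENNReal.coe_one]
          rfl
  have h := lintegral_graphAverage_rpow_le (W := ν.withDensity w)
    hφ (continuous_dyadicSum hχ M K) (integrable_dyadicSum hχi hM0 K)
    (dyadicSum_nonneg hχ0 M K) (hA K) hκ0 hB hmm hf hp ha hfp
  rw [lintegral_withDensity_eq_lintegral_mul _ hw hYm] at h
  calc _ = ∫⁻ θ, (w * fun θ => ∫⁻ x, graphAverage (fun x : E d => ‖x‖ ^ β) (dyadicSum χ M K) f θ x ^
        (2 + 2 * κ)) θ ∂ν := lintegral_congr fun θ => mul_comm _ _
    _ ≤ _ := h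
    _ = _ := by
      rw [ENNReal.mul_rpow_of_nonneg _ _ (by positivity), ENNReal.coe_mul B₀, ENNReal.coe_mul B₀,
        ENNReal.coe_toNNReal hSt, ENNReal.coe_toNNReal hJ']
      ring

end UniformBounds

/-! ### The surface measure and domination by dyadic averages -/

section Surface
open Module

variable {d : ℕ} {β : ℝ}

/-- The density of the surface measure in the coordinates of the graph. -/
def surfaceDensity (d : ℕ) (β : ℝ) (x : E d) : ℝ≥0∞ :=
  ENNReal.ofReal (Real.sqrt (1 + ‖gradient (fun x : E d => ‖x‖ ^ β) x‖ ^ 2))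

theorem norm_gradient_norm_rpow (hβ : 1 < β) (x : E d) :
    ‖gradient (fun x : E d => ‖x‖ ^ β) x‖ = β * ‖x‖ ^ (β - 1) := by
  rw [gradient, LinearIsometryEquiv.norm_map, norm_fderiv_norm_id_rpow x hβ]

theorem measurable_surfaceDensity (hβ : 1 < β) : Measurable (surfaceDensity d β) := by
  unfold surfaceDensity
  simp_rw [norm_gradient_norm_rpow hβ]
  fun_prop

theorem surfaceDensity_le (hβ : 1 < β) {M : ℝ} {x : E d} (hx : ‖x‖ ≤ M) :
    surfaceDensity d β x ≤ ENNReal.ofReal (Real.sqrt (1 + (β * M ^ (β - 1)) ^ 2)) := by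
  unfold surfaceDensity
  rw [norm_gradient_norm_rpow hβ]
  have := Real.rpow_le_rpow (norm_nonneg x) hx (by linarith : 0 ≤ β - 1)
  gcongr

theorem measurable_surface_graph (hβ : 0 ≤ β) : Measurable fun x : E d => join x (‖x‖ ^ β) :=
  measurable_join.comp (measurable_id.prodMk (continuous_norm_rpow hβ).measurable)

theorem surfaceMeasure_eq_map : surfaceMeasure (d + 1) β =
    ((volume : Measure (E d)).withDensity (surfaceDensity d β)).map
      fun x : E d => join x (‖x‖ ^ β) := by
  have h : (fun x : E d => join x (‖x‖ ^ β)) = fun x : E d => pointOf (n := d + 1) x (‖x‖ ^ β) :=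
    funext fun x => (pointOf_eq_join x _).symm
  rw [h]
  rfl

instance instSFiniteSurfaceMeasure : SFinite (surfaceMeasure (d + 1) β) := by
  rw [surfaceMeasure_eq_map]
  infer_instance

theorem lintegral_surfaceMeasure (hβ : 1 < β) {h : E (d + 1) → ℝ≥0∞} (hh : Measurable h) :
    ∫⁻ y, h y ∂(surfaceMeasure (d + 1) β) =
      ∫⁻ x : E d, surfaceDensity d β x * h (join x (‖x‖ ^ β)) := by
  have hj := measurable_surface_graph (d := d) (β := β) (by linarith)
  rw [surfaceMeasure_eq_map, lintegral_map hh hj]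
  exact lintegral_withDensity_eq_lintegral_mul _ (measurable_surfaceDensity hβ) (hh.comp hj)

theorem norm_le_norm_join (x : E d) (t : ℝ) : ‖x‖ ≤ ‖join x t‖ := by
  have h := inner_join x t (join x t)
  rw [real_inner_self_eq_norm_sq, head_join, last_join, real_inner_self_eq_norm_sq] at h
  rw [← sq_le_sq₀ (norm_nonneg _) (norm_nonneg _), h]
  nlinarith [mul_self_nonneg t]

/-- The transform of nonnegative functions with `|ψ|` in place of `ψ`. -/
def absTransform (β : ℝ) (ψ : E (d + 1) → ℂ) (f : E (d + 1) → ℝ≥0∞) (θ : SO (d + 1))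
    (x : E (d + 1)) : ℝ≥0∞ :=
  ∫⁻ y, ‖ψ y‖ₑ * f (x - rotate θ⁻¹ y) ∂(surfaceMeasure (d + 1) β)

theorem measurable_sub_rotate_inv :
    Measurable fun q : (SO (d + 1) × E (d + 1)) × E (d + 1) => q.1.2 - rotate q.1.1⁻¹ q.2 := by
  have h1 : Measurable fun q : (SO (d + 1) × E (d + 1)) × E (d + 1) => q.1.1 :=
    measurable_fst.comp measurable_fst
  have h2 := (measurable_rotate_inv (n := d + 1)).comp (h1.prodMk measurable_snd)
  exact (measurable_snd.comp measurable_fst).sub h2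

theorem measurable_sub_rotate_inv_section (θ : SO (d + 1)) :
    Measurable fun q : E (d + 1) × E (d + 1) => q.1 - rotate θ⁻¹ q.2 :=
  measurable_fst.sub ((measurable_rotate_const θ⁻¹).comp measurable_snd)

variable {ψ : E (d + 1) → ℂ}

theorem measurable_absTransform (hψ : Measurable ψ) {f : E (d + 1) → ℝ≥0∞} (hf : Measurable f) :
    Measurable fun p : SO (d + 1) × E (d + 1) => absTransform β ψ f p.1 p.2 := by
  have h1 := hf.comp (measurable_sub_rotate_inv (d := d))
  have h2 : Measurable fun q : (SO (d + 1) × E (d + 1)) × E (d + 1) => ‖ψ q.2‖ₑ :=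
    (hψ.comp measurable_snd).enorm
  exact (h2.mul h1).lintegral_prod_right'

/-- On the support of ψ the surface density and |ψ| are bounded, and every point 0 < |y| ≤ M lies in
an annulus on which some dilate of χ is at least 1. Monotone convergence moves the supremum over K
outside. -/
theorem exists_absTransform_le_iSup (hd : 1 ≤ d) (hβ : 1 < β) (hψ : Continuous ψ) {M : ℝ}
    (hM : 0 < M) (hψM : ∀ y, M < ‖y‖ → ψ y = 0) {χ : E d → ℝ} (hχ : Continuous χ)
    (hχ0 : ∀ x, 0 ≤ χ x) (hχ1 : ∀ x, 1 ≤ ‖x‖ → ‖x‖ ≤ 2 → 1 ≤ χ x) :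
    ∃ c : ℝ≥0, ∀ f : E (d + 1) → ℝ≥0∞, Measurable f → ∀ θ x, absTransform β ψ f θ x ≤
      ⨆ K, c * graphAverage (fun x : E d => ‖x‖ ^ β) (dyadicSum χ M K) f θ x := by
  have hψc : HasCompactSupport ψ := HasCompactSupport.intro (isCompact_closedBall 0 M) fun y hy =>
    hψM y (by simpa using hy)
  obtain ⟨B, hB⟩ := hψ.bounded_above_of_compact_support hψc
  have hφ := (continuous_norm_rpow (d := d) (β := β) (by linarith)).measurable
  have hj := measurable_surface_graph (d := d) (β := β) (by linarith)
  let c : ℝ≥0 := (Real.sqrt (1 + (β * M ^ (β - 1)) ^ 2)).toNNReal * B.toNNReal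
  refine ⟨c, fun f hf θ x => ?_⟩
  have hfm : Measurable fun y => f (x - rotate θ⁻¹ y) :=
    hf.comp (measurable_const.sub (measurable_rotate_const θ⁻¹))
  have hmono : Monotone fun K => dyadicSum χ M K := fun K L hKL y =>
    Finset.sum_le_sum_of_subset_of_nonneg (Finset.range_mono hKL) fun _ _ _ => hχ0 _
  have : Nonempty (Fin d) := ⟨⟨0, hd⟩⟩
  have hm : Measurable fun y => ‖ψ y‖ₑ * f (x - rotate θ⁻¹ y) := hψ.measurable.enorm.mul hfm
  rw [absTransform, lintegral_surfaceMeasure hβ hm, ← ENNReal.mul_iSup]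
  unfold graphAverage
  rw [← lintegral_iSup (fun K => measurable_graphAverage_section hφ
      (continuous_dyadicSum hχ M K).measurable hf θ x) fun K L hKL y => by
        dsimp only; gcongr; exact hmono hKL y,
    ← lintegral_const_mul' _ _ ENNReal.coe_ne_top]
  refine lintegral_mono_ae ?_
  -- The origin belongs to no dyadic annulus, but it is a null set because d ≥ 1.
  filter_upwards [Measure.ae_ne volume (0 : E d)] with y hy
  rcases lt_or_ge M ‖y‖ with h | h
  · rw [hψM _ (h.trans_le (norm_le_norm_join y _))]
    simp
  obtain ⟨K, hK⟩ := exists_one_le_dyadicSum hχ0 hχ1 hM hy h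
  have h1 : ‖ψ (join y (‖y‖ ^ β))‖ₑ ≤ (B.toNNReal : ℝ≥0∞) := by
    rw [← ofReal_norm]
    exact ENNReal.ofReal_le_ofReal (hB _)
  have h2 : (1 : ℝ≥0∞) ≤ ENNReal.ofReal (dyadicSum χ M K y) := by
    rw [← ENNReal.ofReal_one]
    exact ENNReal.ofReal_le_ofReal (hK K le_rfl)
  calc surfaceDensity d β y * (‖ψ (join y (‖y‖ ^ β))‖ₑ * f (x - rotate θ⁻¹ (join y (‖y‖ ^ β))))
      ≤ ENNReal.ofReal (Real.sqrt (1 + (β * M ^ (β - 1)) ^ 2)) * ((B.toNNReal : ℝ≥0∞) *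
        (1 * f (x - rotate θ⁻¹ (join y (‖y‖ ^ β))))) := by
        rw [one_mul]
        gcongr
        exact surfaceDensity_le hβ h
    _ ≤ ENNReal.ofReal (Real.sqrt (1 + (β * M ^ (β - 1)) ^ 2)) * ((B.toNNReal : ℝ≥0∞) *
        (ENNReal.ofReal (dyadicSum χ M K y) * f (x - rotate θ⁻¹ (join y (‖y‖ ^ β))))) := by
        gcongr
    _ = c * (ENNReal.ofReal (dyadicSum χ M K y) * f (x - rotate θ⁻¹ (join y (‖y‖ ^ β)))) := by
        simp only [c, ENNReal.coe_mul, mul_assoc]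
        rfl
    _ ≤ _ := by
        gcongr
        exact le_iSup (fun K => ENNReal.ofReal (dyadicSum χ M K y) *
          f (x - rotate θ⁻¹ (join y (‖y‖ ^ β)))) K

theorem lintegral_rpow_le_iSup {α : Type*} [MeasurableSpace α] {μ : Measure α} {g : α → ℝ≥0∞}
    {u : ℕ → α → ℝ≥0∞} (hu : ∀ K, Measurable (u K)) (hmono : Monotone u)
    (hg : ∀ x, g x ≤ ⨆ K, u K x) {r : ℝ} (hr : 0 < r) :
    ∫⁻ x, g x ^ r ∂μ ≤ ⨆ K, ∫⁻ x, u K x ^ r ∂μ := by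
  rw [← lintegral_iSup (fun K => (hu K).pow_const r) fun K L hKL x =>
    ENNReal.rpow_le_rpow (hmono hKL x) hr.le]
  refine lintegral_mono fun x => ?_
  have h := (ENNReal.orderIsoRpow r hr).map_iSup fun K => u K x
  simp only [ENNReal.orderIsoRpow_apply] at h
  rw [← h]
  exact ENNReal.rpow_le_rpow (hg x) hr.le

theorem monotone_graphAverage_dyadicSum {χ : E d → ℝ} (hχ0 : ∀ x, 0 ≤ χ x) (M : ℝ) (c : ℝ≥0∞)
    (φ : E d → ℝ) (f : E (d + 1) → ℝ≥0∞) (θ : SO (d + 1)) :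
    Monotone fun K x => c * graphAverage φ (dyadicSum χ M K) f θ x := by
  intro K L hKL x
  dsimp only
  unfold graphAverage
  gcongr with y
  exact Finset.sum_le_sum_of_subset_of_nonneg (Finset.range_mono hKL) fun _ _ _ => hχ0 _

theorem exists_lintegral_absTransform_rpow_le (hd : 1 ≤ d) (hβ : 2 < β) (hψ : Continuous ψ)
    (hψc : HasCompactSupport ψ) {κ : ℝ} (hκ : 0 ≤ κ) (hκd : κ * β < d) {p : ℝ}
    (hp : p = (2 + 2 * κ) / (1 + 2 * κ)) :
    ∃ D : ℝ≥0, ∀ (θ : SO (d + 1)) (f : E (d + 1) → ℝ≥0∞) (a : ℝ≥0), Measurable f → a ≠ 0 →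
      ∫⁻ x, f x ^ p ≤ (a : ℝ≥0∞) ^ p →
      ∫⁻ x, absTransform β ψ f θ x ^ (2 + 2 * κ) ≤ D * (a : ℝ≥0∞) ^ (2 + 2 * κ) := by
  obtain ⟨χ, hχ, hχc, hχ0, hχz, hχ1, hosc⟩ := exists_annulus_oscDecay (E d) hβ.le
  obtain ⟨r, hr⟩ := hψc.isCompact.isBounded.exists_norm_le
  have hM : 1 ≤ max r 1 := le_max_right _ _
  have hψM : ∀ y, max r 1 < ‖y‖ → ψ y = 0 := fun y hy => image_eq_zero_of_notMem_tsupport fun h =>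
    absurd ((hr y h).trans (le_max_left r 1)) (not_le.2 hy)
  obtain ⟨c, hc⟩ := exists_absTransform_le_iSup hd (one_lt_two.trans hβ) hψ (one_pos.trans_le hM) hψM hχ hχ0 hχ1
  obtain ⟨D, hD⟩ := exists_lintegral_graphAverage_rpow_le hβ hM hχ hχc hχ0 hχz hosc hκ hκd hp
  refine ⟨c ^ (2 + 2 * κ) * D, fun θ f a hf ha hfp => ?_⟩
  have hm : ∀ K, Measurable fun x =>
      graphAverage (fun x : E d => ‖x‖ ^ β) (dyadicSum χ (max r 1) K) f θ x := fun K => by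
    have h1 := measurable_graphAverage (φ := fun x : E d => ‖x‖ ^ β) (η := dyadicSum χ (max r 1) K)
      (continuous_norm_rpow (by linarith)).measurable (continuous_dyadicSum hχ _ K).measurable hf
    have h2 : Measurable fun x : E (d + 1) => (θ, x) := measurable_prodMk_left
    have h3 := h1.comp h2
    exact h3
  refine (lintegral_rpow_le_iSup (fun K => (hm K).const_mul (c : ℝ≥0∞))
    (monotone_graphAverage_dyadicSum hχ0 _ _ _ f θ) (hc f hf θ) (by linarith)).trans
    (iSup_le fun K => ?_)
  simp_rw [ENNReal.mul_rpow_of_nonneg _ _ (by linarith : 0 ≤ 2 + 2 * κ)]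
  rw [lintegral_const_mul' _ _ (ENNReal.rpow_ne_top_of_nonneg (by linarith) ENNReal.coe_ne_top),
    ENNReal.coe_mul, ENNReal.coe_rpow_of_nonneg _ (by linarith), mul_assoc]
  gcongr
  exact hD K θ f a hf ha hfp

theorem exists_lintegral_lintegral_absTransform_rpow_le (hd : 1 ≤ d) (ν : Measure (SO (d + 1)))
    [ν.IsHaarMeasure] (hβ : 2 < β) (hψ : Continuous ψ) (hψc : HasCompactSupport ψ) {κ s : ℝ}
    (hs : 2 < s) (hκ : κ = d / β * (1 + (β - 1) / s)) (hκd : κ < d / 2) {p : ℝ}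
    (hp : p = (2 + 2 * κ) / (1 + 2 * κ)) :
    ∃ D : ℝ≥0, ∀ (f : E (d + 1) → ℝ≥0∞) (a : ℝ≥0), Measurable f → a ≠ 0 →
      ∫⁻ x, f x ^ p ≤ (a : ℝ≥0∞) ^ p →
      ∫⁻ θ, (∫⁻ x, absTransform β ψ f θ x ^ (2 + 2 * κ)) ^ (s / 2) ∂ν ≤
        (D * (a : ℝ≥0∞) ^ (2 + 2 * κ)) ^ (s / 2) := by
  have hκ0 : 0 ≤ κ := by
    rw [hκ]
    have : 0 < β - 1 := by linarith
    positivity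
  obtain ⟨χ, hχ, hχc, hχ0, hχz, hχ1, hosc⟩ := exists_annulus_oscDecay (E d) hβ.le
  obtain ⟨r, hr⟩ := hψc.isCompact.isBounded.exists_norm_le
  have hM : 1 ≤ max r 1 := le_max_right _ _
  have hψM : ∀ y, max r 1 < ‖y‖ → ψ y = 0 := fun y hy => image_eq_zero_of_notMem_tsupport fun h =>
    absurd ((hr y h).trans (le_max_left r 1)) (not_le.2 hy)
  obtain ⟨c, hc⟩ := exists_absTransform_le_iSup hd (one_lt_two.trans hβ) hψ (one_pos.trans_le hM) hψM hχ hχ0 hχ1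
  obtain ⟨D, hD⟩ := exists_lintegral_lintegral_graphAverage_rpow_le hd ν hβ hM hχ hχc hχ0 hχz hosc hs
    hκ hκd hp
  refine ⟨c ^ (2 + 2 * κ) * D, fun f a hf ha hfp => ?_⟩
  have hm : ∀ K, Measurable fun p : SO (d + 1) × E (d + 1) =>
      c * graphAverage (fun x : E d => ‖x‖ ^ β) (dyadicSum χ (max r 1) K) f p.1 p.2 := fun K =>
    (measurable_graphAverage (φ := fun x : E d => ‖x‖ ^ β) (η := dyadicSum χ (max r 1) K)
      (continuous_norm_rpow (by linarith)).measurable (continuous_dyadicSum hχ _ K).measurable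
      hf).const_mul _
  have hm' : ∀ K θ, Measurable fun x =>
      c * graphAverage (fun x : E d => ‖x‖ ^ β) (dyadicSum χ (max r 1) K) f θ x := fun K θ => by
    have h2 : Measurable fun x : E (d + 1) => (θ, x) := measurable_prodMk_left
    have h3 := (hm K).comp h2
    exact h3
  have h0 : 0 < 2 + 2 * κ := by linarith
  refine (lintegral_rpow_le_iSup
    (fun K => ((hm K).pow_const (2 + 2 * κ)).lintegral_prod_right' (ν := volume))
    (fun K L hKL θ => lintegral_mono fun x => ENNReal.rpow_le_rpow
      (monotone_graphAverage_dyadicSum hχ0 _ _ _ f θ hKL x) h0.le)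
    (fun θ => lintegral_rpow_le_iSup (fun K => hm' K θ)
      (monotone_graphAverage_dyadicSum hχ0 _ _ _ f θ) (hc f hf θ) h0) (by linarith)).trans
    (iSup_le fun K => ?_)
  have hct : (c : ℝ≥0∞) ^ (2 + 2 * κ) ≠ ⊤ := ENNReal.rpow_ne_top_of_nonneg h0.le ENNReal.coe_ne_top
  have hs0 : 0 ≤ s / 2 := by linarith
  simp_rw [ENNReal.mul_rpow_of_nonneg _ _ h0.le, lintegral_const_mul' _ _ hct]
  simp_rw [ENNReal.mul_rpow_of_nonneg ((c : ℝ≥0∞) ^ (2 + 2 * κ)) _ hs0]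
  rw [lintegral_const_mul' _ _ (ENNReal.rpow_ne_top_of_nonneg hs0 hct), ENNReal.coe_mul,
    ENNReal.coe_rpow_of_nonneg _ h0.le, mul_assoc,
    ENNReal.mul_rpow_of_nonneg ((c : ℝ≥0∞) ^ (2 + 2 * κ)) _ hs0]
  gcongr
  exact hD K f a hf ha hfp

end Surface

/-! ### From nonnegative functions to the transform -/

section Boundedness

variable {d : ℕ} {β : ℝ} {ψ : E (d + 1) → ℂ}

theorem lintegral_enorm_surfaceMeasure_lt_top (hβ : 1 < β) (hψ : Continuous ψ)
    (hψc : HasCompactSupport ψ) : ∫⁻ y, ‖ψ y‖ₑ ∂(surfaceMeasure (d + 1) β) < ⊤ := by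
  obtain ⟨B, hB⟩ := hψ.bounded_above_of_compact_support hψc
  obtain ⟨M, hM⟩ := hψc.isCompact.isBounded.exists_norm_le
  have hm : Measurable fun y => ‖ψ y‖ₑ := hψ.measurable.enorm
  rw [lintegral_surfaceMeasure hβ hm]
  let c : ℝ≥0∞ := ENNReal.ofReal (Real.sqrt (1 + (β * M ^ (β - 1)) ^ 2)) * ENNReal.ofReal B
  have hc : c < ⊤ := ENNReal.mul_lt_top ENNReal.ofReal_lt_top ENNReal.ofReal_lt_top
  have h : ∀ x : E d, surfaceDensity d β x * ‖ψ (join x (‖x‖ ^ β))‖ₑ ≤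
      (Metric.closedBall (0 : E d) M).indicator (fun _ => c) x := by
    intro x
    by_cases hx : x ∈ Metric.closedBall (0 : E d) M
    · rw [Set.indicator_of_mem hx, ← ofReal_norm]
      exact mul_le_mul' (surfaceDensity_le hβ (by simpa using hx)) (ENNReal.ofReal_le_ofReal (hB _))
    · have h0 : ψ (join x (‖x‖ ^ β)) = 0 := image_eq_zero_of_notMem_tsupport fun h => hx (by
        simpa using (norm_le_norm_join x _).trans (hM _ h))
      simp [h0]
  refine (lintegral_mono h).trans_lt ?_
  rw [lintegral_indicator Metric.isClosed_closedBall.measurableSet, setLIntegral_const]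
  exact ENNReal.mul_lt_top hc measure_closedBall_lt_top

theorem lintegral_absTransform (hψ : Continuous ψ) {g : E (d + 1) → ℝ≥0∞} (hg : Measurable g)
    (θ : SO (d + 1)) : ∫⁻ x, absTransform β ψ g θ x =
      (∫⁻ y, ‖ψ y‖ₑ ∂(surfaceMeasure (d + 1) β)) * ∫⁻ x, g x := by
  unfold absTransform
  have hg1 := hg.comp (measurable_sub_rotate_inv_section θ)
  have hψ1 : Measurable fun q : E (d + 1) × E (d + 1) => ‖ψ q.2‖ₑ :=
    (hψ.measurable.comp measurable_snd).enorm
  have hψ2 : Measurable fun y => ‖ψ y‖ₑ := hψ.measurable.enorm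
  rw [lintegral_lintegral_swap (hψ1.mul hg1).aemeasurable, ← lintegral_mul_const _ hψ2]
  refine lintegral_congr fun y => ?_
  have h1 : Measurable fun x => g (x - rotate θ⁻¹ y) := hg.comp (measurable_id.sub_const _)
  rw [lintegral_const_mul _ h1, lintegral_sub_right_eq_self g]

/-- Since t ≤ 1 + t^p, the transform of g is bounded by the mass of |ψ| plus the transform of g^p,
which is integrable by Fubini. -/
theorem ae_absTransform_lt_top (hβ : 1 < β) (hψ : Continuous ψ) (hψc : HasCompactSupport ψ)
    {g : E (d + 1) → ℝ≥0∞} (hg : Measurable g) {p : ℝ} (hp : 1 ≤ p) (hgp : ∫⁻ x, g x ^ p < ⊤)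
    (θ : SO (d + 1)) : ∀ᵐ x, absTransform β ψ g θ x < ⊤ := by
  have hψt := lintegral_enorm_surfaceMeasure_lt_top hβ hψ hψc
  have hgpm : Measurable fun x => g x ^ p := hg.pow_const p
  have hm : Measurable fun x => absTransform β ψ (fun x => g x ^ p) θ x := by
    have h1 : Measurable fun x : E (d + 1) => (θ, x) := measurable_prodMk_left
    have h2 := (measurable_absTransform (β := β) hψ.measurable hgpm).comp h1
    exact h2
  have h := ae_lt_top hm (μ := volume) (by
    rw [lintegral_absTransform hψ hgpm θ]
    exact (ENNReal.mul_lt_top hψt hgp).ne)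
  filter_upwards [h] with x hx
  refine lt_of_le_of_lt ?_ (ENNReal.add_lt_top.2 ⟨hψt, hx⟩)
  unfold absTransform
  have hψ2 : Measurable fun y => ‖ψ y‖ₑ := hψ.measurable.enorm
  rw [← lintegral_add_left hψ2]
  refine lintegral_mono fun y => ?_
  rw [← mul_one_add]
  gcongr
  set t := g (x - rotate θ⁻¹ y)
  rcases le_total t 1 with ht | ht
  · exact ht.trans le_self_add
  · calc t = t ^ (1 : ℝ) := (ENNReal.rpow_one t).symm
      _ ≤ t ^ p := ENNReal.rpow_le_rpow_of_exponent_le ht hp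
      _ ≤ _ := le_add_self

/-- The surface measure is singular and may charge a Lebesgue null set, but by Fubini almost every
translate of the surface avoids charging it. Hence f may be changed on null sets. -/
theorem ae_ae_sub_rotate_inv {P : E (d + 1) → Prop} (h : ∀ᵐ x, P x) (θ : SO (d + 1)) :
    ∀ᵐ x, ∀ᵐ y ∂(surfaceMeasure (d + 1) β), P (x - rotate θ⁻¹ y) := by
  obtain ⟨s, hs, hsm, hs0⟩ := exists_measurable_superset_of_null (ae_iff.1 h)
  have h1 : ∀ᵐ x, ∀ᵐ y ∂(surfaceMeasure (d + 1) β), x - rotate θ⁻¹ y ∉ s := by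
    have hm : MeasurableSet {q : E (d + 1) × E (d + 1) | q.1 - rotate θ⁻¹ q.2 ∉ s} :=
      (measurable_sub_rotate_inv_section θ) hsm.compl
    rw [Measure.ae_ae_comm hm]
    refine .of_forall fun y => ?_
    exact (measurePreserving_sub_right volume (rotate θ⁻¹ y)).quasiMeasurePreserving.ae
      (compl_mem_ae_iff.2 hs0)
  filter_upwards [h1] with x hx
  filter_upwards [hx] with y hy
  by_contra hP
  exact hy (hs hP)

theorem ae_prod_ae_sub_rotate_inv (ν : Measure (SO (d + 1))) [SFinite ν] {P : E (d + 1) → Prop}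
    (h : ∀ᵐ x, P x) : ∀ᵐ z ∂(ν.prod volume), ∀ᵐ y ∂(surfaceMeasure (d + 1) β),
      P (z.2 - rotate z.1⁻¹ y) := by
  obtain ⟨s, hs, hsm, hs0⟩ := exists_measurable_superset_of_null (ae_iff.1 h)
  have h0 : ∀ᵐ x, x ∉ s := compl_mem_ae_iff.2 hs0
  have hT : MeasurableSet {q : (SO (d + 1) × E (d + 1)) × E (d + 1) |
      q.1.2 - rotate q.1.1⁻¹ q.2 ∈ s} := (measurable_sub_rotate_inv (d := d)) hsm
  have hm : MeasurableSet {z : SO (d + 1) × E (d + 1) |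
      ∀ᵐ y ∂(surfaceMeasure (d + 1) β), z.2 - rotate z.1⁻¹ y ∉ s} := by
    have h1 := (measurable_measure_prodMk_left (ν := surfaceMeasure (d + 1) β) hT)
      (measurableSet_singleton 0)
    convert h1 using 1
    ext z
    simp only [Set.mem_ofPred_eq, ae_iff, not_not]
    rfl
  have h1 := (Measure.ae_prod_iff_ae_ae hm (μ := ν) (ν := volume)).2
    (.of_forall fun θ => ae_ae_sub_rotate_inv h0 θ)
  filter_upwards [h1] with z hz
  filter_upwards [hz] with y hy
  by_contra hP
  exact hy (hs hP)

theorem stronglyMeasurable_radonTransform (hψ : Continuous ψ) {f : E (d + 1) → ℂ}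
    (hf : Measurable f) : StronglyMeasurable fun z : SO (d + 1) × E (d + 1) =>
      radonTransform (d + 1) β ψ f z.2 z.1 := by
  have h1 := hf.comp (measurable_sub_rotate_inv (d := d))
  have h2 : Measurable fun q : (SO (d + 1) × E (d + 1)) × E (d + 1) => ψ q.2 :=
    hψ.measurable.comp measurable_snd
  have h3 := (h2.mul h1).stronglyMeasurable.integral_prod_right' (ν := surfaceMeasure (d + 1) β)
  exact h3

theorem enorm_radonTransform_le {f f' : E (d + 1) → ℂ} {θ : SO (d + 1)} {x : E (d + 1)}
    (h : ∀ᵐ y ∂(surfaceMeasure (d + 1) β), f (x - rotate θ⁻¹ y) = f' (x - rotate θ⁻¹ y)) :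
    ‖radonTransform (d + 1) β ψ f x θ‖ₑ ≤ absTransform β ψ (fun x => ‖f' x‖ₑ) θ x := by
  refine (enorm_integral_le_lintegral_enorm _).trans (lintegral_mono_ae ?_)
  filter_upwards [h] with y hy
  rw [hy, enorm_mul]

/-- Boundedness of the transform follows from an a priori bound for nonnegative functions. -/
theorem radonBounded_of_absTransform (hβ : 1 < β) (hψ : Continuous ψ) (hψc : HasCompactSupport ψ)
    (ν : Measure (SO (d + 1))) [SFinite ν] {p r : ℝ} (hp : 1 ≤ p) (hr : 0 < r) {q : ℝ≥0∞}
    (H : ∃ C : ℝ≥0, ∀ (g : E (d + 1) → ℝ≥0∞) (a : ℝ≥0), Measurable g → a ≠ 0 →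
      ∫⁻ x, g x ^ p ≤ (a : ℝ≥0∞) ^ p →
      eLpNorm (fun θ => (∫⁻ x, absTransform β ψ g θ x ^ r) ^ (1 / r)) q ν ≤ C * a) :
    RadonBounded (d + 1) β ψ ν (ENNReal.ofReal p) q (ENNReal.ofReal r) := by
  obtain ⟨C, hC⟩ := H
  have hp0 : 0 < p := by linarith
  refine ⟨C, fun f hf => ?_⟩
  set f' := hf.1.mk f
  have hf'm : Measurable f' := hf.1.stronglyMeasurable_mk.measurable
  have hff' : ∀ᵐ x, f x = f' x := hf.1.ae_eq_mk
  have hgm : Measurable fun x => ‖f' x‖ₑ := hf'm.enorm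
  have hnorm : ∫⁻ x, ‖f' x‖ₑ ^ p = eLpNorm f (ENNReal.ofReal p) volume ^ p := by
    rw [eLpNorm_congr_ae hff', eLpNorm_eq_lintegral_rpow_enorm_toReal (by simpa using hp0)
      ENNReal.ofReal_ne_top, ENNReal.toReal_ofReal hp0.le, ← ENNReal.rpow_mul, one_div,
      inv_mul_cancel₀ hp0.ne', ENNReal.rpow_one]
  have hfin : eLpNorm f (ENNReal.ofReal p) volume ≠ ⊤ := hf.2.ne
  have hfp : ∫⁻ x, ‖f' x‖ₑ ^ p < ⊤ := by
    rw [hnorm]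
    exact ENNReal.rpow_lt_top_of_nonneg hp0.le hfin
  refine ⟨fun θ => ?_, ?_, ?_⟩
  · filter_upwards [ae_absTransform_lt_top hβ hψ hψc hgm hp hfp θ,
      ae_ae_sub_rotate_inv (β := β) hff' θ] with x hx1 hx2
    have h1 : Measurable fun y => f' (x - rotate θ⁻¹ y) :=
      hf'm.comp (measurable_const.sub (measurable_rotate_const θ⁻¹))
    have h2 : Integrable (fun y => ψ y * f' (x - rotate θ⁻¹ y)) (surfaceMeasure (d + 1) β) := by
      refine ⟨(hψ.measurable.mul h1).aestronglyMeasurable, ?_⟩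
      rw [hasFiniteIntegral_iff_enorm]
      simp_rw [enorm_mul]
      exact hx1
    refine h2.congr ?_
    filter_upwards [hx2] with y hy
    rw [hy]
  · refine ⟨_, stronglyMeasurable_radonTransform (β := β) hψ hf'm, ?_⟩
    filter_upwards [ae_prod_ae_sub_rotate_inv (β := β) ν hff'] with z hz
    refine integral_congr_ae ?_
    filter_upwards [hz] with y hy
    rw [hy]
  · have h1 : ∀ a : ℝ≥0, a ≠ 0 → eLpNorm f (ENNReal.ofReal p) volume ≤ a →
        mixedNorm ν (radonTransform (d + 1) β ψ f) q (ENNReal.ofReal r) ≤ C * a := by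
      intro a ha hfa
      refine le_trans ?_ (hC _ a hgm ha (hnorm.le.trans (ENNReal.rpow_le_rpow hfa hp0.le)))
      refine eLpNorm_mono_enorm fun θ => ?_
      simp only [enorm_eq_self]
      rw [eLpNorm_eq_lintegral_rpow_enorm_toReal (by simpa using hr) ENNReal.ofReal_ne_top,
        ENNReal.toReal_ofReal hr.le]
      refine ENNReal.rpow_le_rpow (lintegral_mono_ae ?_) (by positivity)
      filter_upwards [ae_ae_sub_rotate_inv (β := β) hff' θ] with x hx
      exact ENNReal.rpow_le_rpow (enorm_radonTransform_le hx) hr.le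
    -- The a priori bound needs a nonzero a, so a small amount is added to the norm, which may
    -- vanish; its contribution is at most ε.
    refine ENNReal.le_of_forall_pos_le_add fun ε hε _ => ?_
    have h2 := h1 ((eLpNorm f (ENNReal.ofReal p) volume).toNNReal + ε / (C + 1)) (by positivity) (by
      rw [ENNReal.coe_add, ENNReal.coe_toNNReal hfin]
      exact le_self_add)
    refine h2.trans ?_
    rw [ENNReal.coe_add, ENNReal.coe_toNNReal hfin, mul_add]
    gcongr
    rw [← ENNReal.coe_mul, ENNReal.coe_le_coe]
    calc C * (ε / (C + 1)) ≤ (C + 1) * (ε / (C + 1)) := by gcongr; exact le_self_add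
      _ = ε := mul_div_cancel₀ ε (by positivity)

theorem radonBounded_top (hd : 1 ≤ d) (hβ : 2 < β) (hψ : Continuous ψ) (hψc : HasCompactSupport ψ)
    (ν : Measure (SO (d + 1))) [SFinite ν] {κ : ℝ} (hκ : 0 ≤ κ) (hκd : κ * β < d) {p : ℝ}
    (hp : p = (2 + 2 * κ) / (1 + 2 * κ)) :
    RadonBounded (d + 1) β ψ ν (ENNReal.ofReal p) ⊤ (ENNReal.ofReal (2 + 2 * κ)) := by
  obtain ⟨D, hD⟩ := exists_lintegral_absTransform_rpow_le hd hβ hψ hψc hκ hκd hp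
  have h0 : 0 < 2 + 2 * κ := by linarith
  refine radonBounded_of_absTransform (by linarith) hψ hψc ν
    (by rw [hp, le_div_iff₀ (by linarith)]; linarith) h0
    ⟨D ^ (1 / (2 + 2 * κ)), fun g a hg ha hga => ?_⟩
  rw [eLpNorm_exponent_top]
  refine eLpNormEssSup_le_of_ae_enorm_bound (.of_forall fun θ => ?_)
  rw [enorm_eq_self]
  refine (ENNReal.rpow_le_rpow (hD θ g a hg ha hga) (by positivity)).trans (le_of_eq ?_)
  rw [ENNReal.mul_rpow_of_nonneg _ _ (by positivity), ← ENNReal.rpow_mul, mul_one_div_cancel h0.ne',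
    ENNReal.rpow_one, ENNReal.coe_rpow_of_nonneg _ (by positivity)]

/-- The power s/2 of the inner integral of p'-th powers corresponds to the outer exponent q = p's/2.
-/
theorem radonBounded_average (hd : 1 ≤ d) (hβ : 2 < β) (hψ : Continuous ψ)
    (hψc : HasCompactSupport ψ) (ν : Measure (SO (d + 1))) [ν.IsHaarMeasure] {κ s : ℝ}
    (hs : 2 < s) (hκ : κ = d / β * (1 + (β - 1) / s)) (hκd : κ < d / 2) {p : ℝ}
    (hp : p = (2 + 2 * κ) / (1 + 2 * κ)) :
    RadonBounded (d + 1) β ψ ν (ENNReal.ofReal p) (ENNReal.ofReal ((2 + 2 * κ) * (s / 2)))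
      (ENNReal.ofReal (2 + 2 * κ)) := by
  obtain ⟨D, hD⟩ := exists_lintegral_lintegral_absTransform_rpow_le hd ν hβ hψ hψc hs hκ hκd hp
  have hκ0 : 0 ≤ κ := by
    rw [hκ]
    have : 0 < β - 1 := by linarith
    positivity
  have h0 : 0 < 2 + 2 * κ := by linarith
  have hq : 0 < (2 + 2 * κ) * (s / 2) := by positivity
  refine radonBounded_of_absTransform (by linarith) hψ hψc ν
    (by rw [hp, le_div_iff₀ (by linarith)]; linarith) h0
    ⟨D ^ (1 / (2 + 2 * κ)), fun g a hg ha hga => ?_⟩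
  rw [eLpNorm_eq_lintegral_rpow_enorm_toReal (by simpa using hq) ENNReal.ofReal_ne_top,
    ENNReal.toReal_ofReal hq.le]
  simp_rw [enorm_eq_self, ← ENNReal.rpow_mul]
  rw [show 1 / (2 + 2 * κ) * ((2 + 2 * κ) * (s / 2)) = s / 2 by field_simp]
  refine (ENNReal.rpow_le_rpow (hD g a hg ha hga) (by positivity)).trans (le_of_eq ?_)
  rw [← ENNReal.rpow_mul, show s / 2 * (1 / ((2 + 2 * κ) * (s / 2))) = 1 / (2 + 2 * κ) by
      field_simp, ENNReal.mul_rpow_of_nonneg _ _ (by positivity), ← ENNReal.rpow_mul,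
    mul_one_div_cancel h0.ne', ENNReal.rpow_one, ENNReal.coe_rpow_of_nonneg _ (by positivity)]

end Boundedness

end RotatedRadon

end

theorem theorem6 (n : ℕ) (hn : 2 ≤ n) (β : ℝ) (hβ : 2 < β)
    (ψ : RotatedRadon.E n → ℂ) (hψ : ContDiff ℝ ∞ ψ) (hψc : HasCompactSupport ψ)
    (hψ1 : ∀ᶠ x in 𝓝 (0 : RotatedRadon.E n), ψ x = 1)
    (ν : Measure (RotatedRadon.SO n)) [ν.IsHaarMeasure]
    (p p' : ℝ) (hpp' : p.HolderConjugate p') :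
    (((n : ℝ) + 1) / n < p →
      p < (2 * β + 2 * ((n : ℝ) - 1)) / (β + 2 * ((n : ℝ) - 1)) →
      RotatedRadon.RadonBounded n β ψ ν (ENNReal.ofReal p)
        (ENNReal.ofReal
          (p' * ((n : ℝ) - 1) * (β - 1) / ((p' - 2) * β - 2 * ((n : ℝ) - 1))))
        (ENNReal.ofReal p')) ∧
    ((2 * β + 2 * ((n : ℝ) - 1)) / (β + 2 * ((n : ℝ) - 1)) < p →
      p ≤ 2 →
      RotatedRadon.RadonBounded n β ψ ν (ENNReal.ofReal p) ∞ (ENNReal.ofReal p')) := by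
  obtain ⟨d, rfl⟩ : ∃ d, n = d + 1 := ⟨n - 1, by omega⟩
  -- All conditions on p become linear conditions on κ = (p' - 2)/2.
  obtain ⟨κ, rfl⟩ : ∃ κ, p' = 2 + 2 * κ := ⟨(p' - 2) / 2, by ring⟩
  have hd : 1 ≤ d := by omega
  have hd' : (1 : ℝ) ≤ d := by exact_mod_cast hd
  have h1 : 0 < 1 + 2 * κ := by linarith [hpp'.symm.lt]
  have hp : p = (2 + 2 * κ) / (1 + 2 * κ) := by
    rw [hpp'.symm.conjugate_eq]
    congr 1
    ring
  have hβd : 0 < β + 2 * (d : ℝ) := by linarith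
  rw [show (((d + 1 : ℕ) : ℝ) - 1) = d by push_cast; ring]
  constructor
  · intro hp1 hp2
    rw [hp, div_lt_div_iff₀ (by positivity) h1] at hp1
    rw [hp, div_lt_div_iff₀ h1 hβd] at hp2
    push_cast at hp1
    -- The lower bound on p says κ < d/2, and the upper bound says κβ > d.
    have hκ1 : κ < d / 2 := by linarith
    have hκ2 : 0 < κ * β - d := by linarith
    have hβ1 : 0 < β - 1 := by linarith
    have hκβ : κ * β < d / 2 * β := mul_lt_mul_of_pos_right hκ1 (by linarith)
    have h := RotatedRadon.radonBounded_average (β := β) (κ := κ) (p := p)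
      -- The solution s of κ = (d/β)(1 + (β - 1)/s); the condition s > 2 follows from κ < d/2.
      (s := d * (β - 1) / (κ * β - d)) hd hβ hψ.continuous hψc ν
      (by rw [lt_div_iff₀ hκ2]; linarith) (by field_simp; ring) hκ1 hp
    convert h using 2
    rw [show (2 + 2 * κ - 2) * β - 2 * d = (κ * β - d) * 2 by ring]
    field_simp
  · intro hp1 hp2
    rw [hp, div_lt_div_iff₀ hβd h1] at hp1
    rw [hp, div_le_iff₀ h1] at hp2
    -- In this range the bounds on p read κβ < d and κ ≥ 0.
    exact RotatedRadon.radonBounded_top hd hβ hψ.continuous hψc ν (by linarith) (by linarith) hp
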